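/- Setting. Fix $d\in\mathbb N$, $d\ge 1$. Let $\mathcal L$ be the class of decreasing functions $\ell:(0,\infty)\to[1,\infty)$ with $\ell(\delta)=o(\delta^{-\tau})$ as $\delta\downarrow 0$ for every $\tau>0$, and $\mathcal G$ the class of strictly increasing functions $g:(0,1)\to(0,1)$ with $g(\epsilon)=o(\epsilon^M)$ as $\epsilon\downarrow0$ for every $M>0$; write $\|g\|_\infty=\sup_{(0,1)} g$ and $g^{-1}(r)=\sup\{t\in(0,1):g(t)\le r\}$ (the usual inverse on the range of $g$). For a distribution $P$ of a pair $(X,Y)$ on $\mathbb R^d\times\{0,1\}$ let $P_X$ be the law of $X$, $\pi_r=P(Y=r)$, and $P_r$ the conditional law of $X$ given $Y=r$. Let $B_r(x)$ be the open Euclidean ball and $a_d$ the volume of the unit ball. For $\theta=(\epsilon_0,M_0,\rho,\ell,g)\in(0,\infty)\times[1,\infty)\times(0,\infty)\times\mathcal L\times\mathcal G$, $\mathcal P_{d,\theta}$ is the class of $P$ such that $P_0,P_1$ have Lebesgue densities with versions $f_0,f_1$ for which, writing $\bar f=\pi_0f_0+\pi_1f_1$, $\eta=\pi_1f_1/\bar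 f$ (with $0/0=0$), $\mathcal S=\{\eta=1/2\}$ and $\mathcal S^{\epsilon}=\mathcal S+B_\epsilon(0)$: (A.1) $\bar f$ is continuous $P_X$-almost everywhere and its set of continuity points is open. (A.2) $\mathcal S\cap\{\bar f>0\}\neq\emptyset$; $\sup_{\mathcal S}\bar f\le M_0$; $\bar f$ is twice continuously differentiable on $\mathcal S^{\epsilon_0}$, with $\max\{\|\dot{\bar f}(x_0)\|,\sup_{u\in B_{\epsilon_0}(0)}\|\ddot{\bar f}(x_0+u)\|_{\mathrm{op}}\}\le\bar f(x_0)\,\ell(\bar f(x_0))$ for all $x_0\in\mathcal S$; and $P_X(B_r(x))\ge\epsilon_0a_dr^d\bar f(x)$ for all $x\notin\mathcal S^{\epsilon_0}$ and $r\in(0,\epsilon_0]$. (A.3) $\eta$ is twice differentiable on $\mathcal S^{2\epsilon_0}$; $\|\dot\eta\|\ge\epsilon_0M_0$ on $\mathcal S$; $\|\dot\eta\|\le M_0$ and $\|\ddot\eta\|_{\mathrm{op}}\le M_0$ on $\mathcal S^{2\epsilon_0}$; $\|\ddot\eta(z)-\ddot\eta(x)\|_{\mathrm{op}}\le\epsilon$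 whenever $\epsilon\in(0,1)$, $x,z\in\mathcal S^{2\epsilon_0}$ and $\|z-x\|\le g(\epsilon)$; $\eta$ is continuous on $\{\bar f>0\}$; and $|\eta(x)-1/2|\ge1/\ell(\bar f(x))$ for all $x\notin\mathcal S^{\epsilon_0}$ with $\bar f(x)>0$. (A.4) $\int\|x\|^\rho\,dP_X(x)\le M_0$ and $\int_{\mathcal S}\bar f^{\,d/(\rho+d)}\,d\mathrm{Vol}^{d-1}\le M_0$, where $\mathrm{Vol}^{d-1}$ is the $(d-1)$-dimensional surface measure. For $\gamma\in(0,2]$, $\lambda>0$, $\mathcal Q_{d,\gamma,\lambda}$ is the class of $P$ for which $P_X$ has a Lebesgue density $\bar f\le\lambda$ such that, for all $x,y$: if $\gamma\le1$, $|\bar f(y)-\bar f(x)|\le\lambda\|y-x\|^\gamma$; if $\gamma>1$, $\bar f$ is differentiable and $\|\dot{\bar f}(y)-\dot{\bar f}(x)\|\le\lambda\|y-x\|^{\gamma-1}$. The risk $R(C_n)$ of a classifier $C_n$ based on $n$ independent training pairs with law $P$ is the probability that it misclassifies an independent test pair with law $P$, and $C^{\mathrm{Bayes}}(x)=1$ if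 $P(Y=1\mid X=x)\ge1/2$ and $0$ otherwise. Write $$\mathcal R_n:=\inf_{C_n}\ \sup_{P\in\mathcal P_{d,\theta}\cap\mathcal Q_{d,\gamma,\lambda}}\{R(C_n)-R(C^{\mathrm{Bayes}})\},$$ the infimum being over all measurable $C_n:(\mathbb R^d\times\{0,1\})^n\times\mathbb R^d\to\{0,1\}$. Theorem. There exist $\lambda_*,\epsilon_*,M_*>0$ depending only on $d$ such that the following holds for every $\rho>0$, every $g\in\mathcal G$ with $r\mapsto r/g^{-1}(r)$ increasing for sufficiently small $r>0$, every $\gamma\in(0,2]$, $\lambda\ge\lambda_*$, $M_0\ge\max(M_*,1)$, $\epsilon_0\in(0,\min(\epsilon_*,1/(4M_0))]$ and $\ell\in\mathcal L$ with $\ell\ge2/\epsilon_0$ on $(0,\infty)$, with $\theta=(\epsilon_0,M_0,\rho,\ell,g)$. For $\nu\ge0$ and $n\in\mathbb N$, $n\ge1$, consider the equation $$\frac{q^{4+d+\nu(\rho+d)}}{g^{-1}(1/q)^2}=n,\qquad q\in(1/\|g\|_\infty,\infty).\qquad(*)$$ (i) If $n>\|g\|_\infty^{-\{4+d+\nu(\rho+d)\}}$,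 then $(*)$ has a unique solution. (ii) There is $c=c(d,\theta,\gamma,\lambda)>0$ such that for all $n\ge1$ and $\nu\ge0$ and every solution $q$ of $(*)$, $$\mathcal R_n\ \ge\ c\,g^{-1}(1/q)^{\frac{2d(1+\nu)}{4+d+\nu(\rho+d)}}\,n^{-\frac{4+\nu\rho}{4+d+\nu(\rho+d)}}.$$ (iii) For every $\epsilon>0$ there is $c=c(d,\theta,\gamma,\lambda,\epsilon)>0$ such that for all $n\ge1$, $$\mathcal R_n\ \ge\ c\,n^{-(\min\{\frac4{4+d},\frac\rho{\rho+d}\}+\epsilon)}.$$ -/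

import Mathlib

open MeasureTheory Set Filter Topology Asymptotics
open scoped MeasureTheory ENNReal

noncomputable section

namespace NNLower

/-- The feature space `ℝ^d` with its Euclidean norm. -/
abbrev E (d : ℕ) : Type := EuclideanSpace ℝ (Fin d)

/-- A distribution of a pair `(X, Y)` with values in `ℝ^d × {0,1}`. -/
abbrev Distr (d : ℕ) : Type := ProbabilityMeasure (E d × Fin 2)

/-! ### The function classes `𝓛` and `𝓖` -/

/-- Decreasing functions `ℓ : (0,∞) → [1,∞)` with `ℓ(δ) = o(δ^{-τ})` as `δ ↓ 0` for all `τ > 0`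
(only the values on `(0,∞)` matter). -/
structure IsClassL (l : ℝ → ℝ) : Prop where
  antitone : AntitoneOn l (Ioi 0)
  one_le : ∀ δ, 0 < δ → 1 ≤ l δ
  isLittleO : ∀ τ : ℝ, 0 < τ → l =o[𝓝[>] (0 : ℝ)] fun δ => δ ^ (-τ)

/-- Strictly increasing functions `g : (0,1) → (0,1)` with `g(ε) = o(ε^M)` as `ε ↓ 0` for all
`M > 0` (only the values on `(0,1)` matter). -/
structure IsClassG (g : ℝ → ℝ) : Prop where
  strictMono : StrictMonoOn g (Ioo 0 1)
  mapsTo : MapsTo g (Ioo 0 1) (Ioo 0 1)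
  isLittleO : ∀ M : ℝ, 0 < M → g =o[𝓝[>] (0 : ℝ)] fun ε => ε ^ M

/-- `‖g‖_∞` for a function on `(0,1)`. -/
def supNorm (g : ℝ → ℝ) : ℝ := sSup ((fun t => |g t|) '' Ioo 0 1)

/-- The inverse of a strictly increasing `g : (0,1) → (0,1)`. It is the ordinary inverse on the
range of `g`; across a jump of `g` it is constant. -/
def gInv (g : ℝ → ℝ) (r : ℝ) : ℝ := sSup {t | t ∈ Ioo (0 : ℝ) 1 ∧ g t ≤ r}

/-! ### Objects attached to a distribution -/

variable {d : ℕ}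

/-- The marginal distribution `P_X`. -/
def margX (P : Distr d) : Measure (E d) := (P : Measure (E d × Fin 2)).map Prod.fst

/-- The class probability `π_r = P(Y = r)`. -/
def classProb (P : Distr d) (r : Fin 2) : ℝ :=
  (P : Measure (E d × Fin 2)).real {z | z.2 = r}

/-- The conditional distribution `P_r` of `X` given `Y = r`. -/
def condLaw (P : Distr d) (r : Fin 2) : Measure (E d) :=
  (ProbabilityTheory.cond (P : Measure (E d × Fin 2)) {z | z.2 = r}).map Prod.fst

/-- `f` is a (version of the) Lebesgue density of `μ`. -/
structure IsDensity (μ : Measure (E d)) (f : E d → ℝ) : Prop where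
  measurable : Measurable f
  nonneg : ∀ x, 0 ≤ f x
  eq_withDensity : μ = (volume : Measure (E d)).withDensity fun x => ENNReal.ofReal (f x)

/-- `π₀ f₀ + π₁ f₁`. -/
def fbar (P : Distr d) (f₀ f₁ : E d → ℝ) (x : E d) : ℝ :=
  classProb P 0 * f₀ x + classProb P 1 * f₁ x

/-- `η = π₁ f₁ / (π₀ f₀ + π₁ f₁)`, with `0 / 0 = 0`. -/
def etaOf (P : Distr d) (f₀ f₁ : E d → ℝ) (x : E d) : ℝ :=
  classProb P 1 * f₁ x / fbar P f₀ f₁ x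

/-- The decision boundary `𝓢 = {η = 1/2}`. -/
def boundary (η : E d → ℝ) : Set (E d) := {x | η x = 1 / 2}

/-- The neighbourhood `𝓢^ε = 𝓢 + B_ε(0)`. -/
def nbhd (η : E d → ℝ) (ε : ℝ) : Set (E d) := Metric.thickening ε (boundary η)

/-! ### The class `𝓟_{d,θ}`

First derivatives are Fréchet derivatives, whose operator norm is the Euclidean norm of the
gradient; `fderiv ℝ (fderiv ℝ f) x` is the Hessian as a bilinear form, whose norm is the operator
norm of the Hessian matrix. -/

/-- The marginal density is continuous almost everywhere, on an open set. -/
structure DensityCond (PX : Measure (E d)) (f : E d → ℝ) : Prop where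
  ae_continuousAt : ∀ᵐ x ∂PX, ContinuousAt f x
  isOpen : IsOpen {x | ContinuousAt f x}

/-- Smoothness of the marginal density near `𝓢` and minimal mass. Note that `f > 0` on `𝓢` when `η` is given by `etaOf`. -/
structure MarginalCond (PX : Measure (E d)) (f η : E d → ℝ) (ε₀ M₀ : ℝ) (l : ℝ → ℝ) : Prop where
  nonempty : (boundary η ∩ {x | 0 < f x}).Nonempty
  le_M₀ : ∀ x ∈ boundary η, f x ≤ M₀
  contDiffOn : ContDiffOn ℝ 2 f (nbhd η ε₀)
  grad_le : ∀ x ∈ boundary η, ‖fderiv ℝ f x‖ ≤ f x * l (f x)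
  hess_le : ∀ x ∈ boundary η, ∀ y ∈ Metric.ball x ε₀,
    ‖fderiv ℝ (fderiv ℝ f) y‖ ≤ f x * l (f x)
  minimal_mass : ∀ x, x ∉ nbhd η ε₀ → ∀ r, 0 < r → r ≤ ε₀ →
    ε₀ * volume.real (Metric.ball (0 : E d) 1) * r ^ d * f x ≤ PX.real (Metric.ball x r)

/-- Smoothness of the regression function near `𝓢` and separation from `1/2` elsewhere. In the last clause points with `f x = 0` are left out, where `ℓ` is not
defined; `etaOf` vanishes there. -/
structure RegressionCond (f η : E d → ℝ) (ε₀ M₀ : ℝ) (l g : ℝ → ℝ) : Prop where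
  differentiableAt : ∀ x ∈ nbhd η (2 * ε₀), DifferentiableAt ℝ η x
  differentiableAt_fderiv : ∀ x ∈ nbhd η (2 * ε₀), DifferentiableAt ℝ (fderiv ℝ η) x
  le_grad : ∀ x ∈ boundary η, ε₀ * M₀ ≤ ‖fderiv ℝ η x‖
  grad_le : ∀ x ∈ nbhd η (2 * ε₀), ‖fderiv ℝ η x‖ ≤ M₀
  hess_le : ∀ x ∈ nbhd η (2 * ε₀), ‖fderiv ℝ (fderiv ℝ η) x‖ ≤ M₀
  hess_modulus : ∀ ε ∈ Ioo (0 : ℝ) 1, ∀ x ∈ nbhd η (2 * ε₀), ∀ z ∈ nbhd η (2 * ε₀),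
    ‖z - x‖ ≤ g ε → ‖fderiv ℝ (fderiv ℝ η) z - fderiv ℝ (fderiv ℝ η) x‖ ≤ ε
  continuousOn : ContinuousOn η {x | 0 < f x}
  away : ∀ x, x ∉ nbhd η ε₀ → 0 < f x → 1 / l (f x) ≤ |η x - 1 / 2|

/-- Moment and tail condition. The volume on the hypersurface `𝓢` is the `(d-1)`-dimensional Hausdorff
measure, normalised to agree with Lebesgue measure in dimension `d - 1` (counting measure if
`d = 1`). -/
structure TailCond (PX : Measure (E d)) (f η : E d → ℝ) (M₀ ρ : ℝ) : Prop where
  moment : ∫⁻ x, ENNReal.ofReal (‖x‖ ^ ρ) ∂PX ≤ ENNReal.ofReal M₀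
  surface : ∫⁻ x in boundary η, ENNReal.ofReal (f x ^ ((d : ℝ) / (ρ + d))) ∂μHE[d - 1] ≤
    ENNReal.ofReal M₀

/-- The class `𝓟_{d,θ}`, `θ = (ε₀, M₀, ρ, ℓ, g)`. -/
def classP (d : ℕ) (ε₀ M₀ ρ : ℝ) (l g : ℝ → ℝ) : Set (Distr d) :=
  {P | ∃ f₀ f₁ : E d → ℝ, IsDensity (condLaw P 0) f₀ ∧ IsDensity (condLaw P 1) f₁ ∧
    DensityCond (margX P) (fbar P f₀ f₁) ∧
    MarginalCond (margX P) (fbar P f₀ f₁) (etaOf P f₀ f₁) ε₀ M₀ l ∧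
    RegressionCond (fbar P f₀ f₁) (etaOf P f₀ f₁) ε₀ M₀ l g ∧
    TailCond (margX P) (fbar P f₀ f₁) (etaOf P f₀ f₁) M₀ ρ}

/-! ### The class `𝓠_{d,γ,λ}` -/

/-- The smoothness requirement of order `γ ∈ (0,2]` with constant `lam`. -/
def IsHolder (γ lam : ℝ) (f : E d → ℝ) : Prop :=
  (γ ≤ 1 → ∀ x y, |f y - f x| ≤ lam * ‖y - x‖ ^ γ) ∧
  (1 < γ → Differentiable ℝ f ∧
    ∀ x y, ‖fderiv ℝ f y - fderiv ℝ f x‖ ≤ lam * ‖y - x‖ ^ (γ - 1))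

/-- The class `𝓠_{d,γ,λ}`. -/
def classQ (d : ℕ) (γ lam : ℝ) : Set (Distr d) :=
  {P | ∃ f : E d → ℝ, IsDensity (margX P) f ∧ (∀ x, f x ≤ lam) ∧ IsHolder γ lam f}

/-! ### Risks -/

/-- The regression function `x ↦ P(Y = 1 | X = x)`, through the regular conditional distribution
of `Y` given `X`. -/
def regression (P : Distr d) (x : E d) : ℝ :=
  ((P : Measure (E d × Fin 2)).condKernel x).real {1}

open scoped Classical in
/-- The Bayes classifier. -/
def bayes (P : Distr d) (x : E d) : Fin 2 := if 1 / 2 ≤ regression P x then 1 else 0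

/-- The risk of a fixed classifier. -/
def risk (P : Distr d) (C : E d → Fin 2) : ℝ :=
  (P : Measure (E d × Fin 2)).real {z | C z.1 ≠ z.2}

/-- A data-dependent classifier: a measurable map of the `n` labelled training pairs and the test
point. -/
abbrev DataClassifier (d n : ℕ) : Type :=
  {C : (Fin n → E d × Fin 2) × E d → Fin 2 // Measurable C}

/-- The risk of a data-dependent classifier: the probability of misclassifying a test pair when
the test pair and the `n` training pairs are independent with law `P`. -/
def dataRisk {n : ℕ} (P : Distr d) (C : DataClassifier d n) : ℝ :=
  ((Measure.pi fun _ : Fin n => (P : Measure (E d × Fin 2))).prod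
    (P : Measure (E d × Fin 2))).real {w | C.1 (w.1, w.2.1) ≠ w.2.2}

/-- The minimax excess risk over a class of distributions with `n` training pairs. -/
def minimaxExcess (d n : ℕ) (K : Set (Distr d)) : ℝ :=
  ⨅ C : DataClassifier d n, ⨆ P : K, (dataRisk P.1 C - risk P.1 (bayes P.1))

/-! ### The rate -/

/-- The number `4 + d + ν(ρ + d)`. -/
def rateDenom (d : ℕ) (ρ ν : ℝ) : ℝ := 4 + d + ν * (ρ + d)

/-- `q ∈ (1/‖g‖_∞, ∞)` solves `q^{4+d+ν(ρ+d)} / g⁻¹(1/q)^2 = n`. -/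
def SolvesRate (d n : ℕ) (ρ ν : ℝ) (g : ℝ → ℝ) (q : ℝ) : Prop :=
  1 / supNorm g < q ∧ q ^ rateDenom d ρ ν / gInv g (1 / q) ^ 2 = n

end NNLower

end

/-!
Part (i) holds because `q ↦ q ^ D / g⁻¹(1/q)²`, `D = 4 + d + ν(ρ + d)`, is continuous and strictly
increasing: `g⁻¹` is monotone, and it is continuous although `g` may jump, since `g` is strictly
increasing (`existsUnique_solvesRate`).

The lower bounds come from testing many signs at once (Assouad's method, `minimaxExcess_ge`). The
marginal density is a sum of disjoint smooth bumps with plateaus (`dens`): a bulk around the origin,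
where `η = 1`, and about `R ^ d` small ones, of height `δ ≈ R ^ (-(ρ + d))`, around the points of a
lattice cube of side of order `R`. The moment condition allows exactly this height, and then the
integral of the tail condition over the decision boundary stays bounded too. Around a lattice point
`z` the regression function is `‖x - z‖² + p x` with a small perturbation `p`, so that the decision
boundary consists of perturbed spheres of squared radius `1/2`, inside the plateaus. The
perturbation is a sum of disjoint bumps of radius of order `r` and height of order `g⁻¹(r) r²`, with
free signs, centred on these spheres (`bumpSum`). Their Hessians are of order `g⁻¹(r)` and have
Lipschitz constant of order `g⁻¹(r) / r`. The former bounds the modulus of continuity at the scales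
`ε ≥ g⁻¹(r)`, and the latter at the scales `ε < g⁻¹(r)`, where `g ε / ε` is at most a constant times
`r / g⁻¹(r)` because `r / g⁻¹(r)` is increasing near `0` (`IsClassG.exists_slope_bound`). So all
these distributions belong to both classes (`mem_classes`).

Changing one sign changes the joint law by a chi-square divergence of order
`δ (g⁻¹(r) r²)² r ^ d` (`exists_likelihoodRatio`). With `R = q ^ ν` and `r = 1/q` this is of order
`g⁻¹(1/q)² / q ^ D`, so at sample sizes `n ≤ q ^ D / g⁻¹(1/q)²` no sign can be estimated from the
sample. A wrong sign costs `δ g⁻¹(r) r²` times the volume of a cell of the radial width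
`g⁻¹(r) r²` of the perturbation; as a maximal separated set on each sphere provides cells of total
volume of order `g⁻¹(r) r²` (`exists_separated_cells`), the excess risk is at least of order
`R ^ d δ (g⁻¹(r) r²)² ≈ g⁻¹(1/q)² q ^ (-(4 + νρ))` (`exists_lower_bound`). For a solution `q` of the
rate equation this is (ii). For (iii), `q` is a multiple of `n ^ (1/D)`, and `g⁻¹(1/q)` is at least
a small power of `1/q`; a suitable `ν` brings the exponent `(4 + νρ)/D` close to
`min {4/(4 + d), ρ/(ρ + d)}`.
-/

set_option linter.unusedSectionVars false

noncomputable section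

namespace NNLower

/-! ### The inverse of the modulus -/

variable {g : ℝ → ℝ}

lemma IsClassG.pos (hg : IsClassG g) {t : ℝ} (ht : t ∈ Ioo (0 : ℝ) 1) : 0 < g t :=
  (hg.mapsTo ht).1

lemma IsClassG.lt_one (hg : IsClassG g) {t : ℝ} (ht : t ∈ Ioo (0 : ℝ) 1) : g t < 1 :=
  (hg.mapsTo ht).2

lemma IsClassG.le_supNorm (hg : IsClassG g) {t : ℝ} (ht : t ∈ Ioo (0 : ℝ) 1) :
    g t ≤ supNorm g := by
  refine (le_abs_self _).trans (le_csSup ⟨1, ?_⟩ (mem_image_of_mem _ ht))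
  rintro _ ⟨s, hs, rfl⟩
  simpa [abs_of_pos (hg.pos hs)] using (hg.lt_one hs).le

lemma IsClassG.lt_supNorm (hg : IsClassG g) {t : ℝ} (ht : t ∈ Ioo (0 : ℝ) 1) :
    g t < supNorm g := by
  have hs : (t + 1) / 2 ∈ Ioo (0 : ℝ) 1 := ⟨by linarith [ht.1], by linarith [ht.2]⟩
  exact (hg.strictMono ht hs (by linarith [ht.2])).trans_le (hg.le_supNorm hs)

lemma IsClassG.supNorm_pos (hg : IsClassG g) : 0 < supNorm g :=
  (hg.pos (t := 1 / 2) (by norm_num)).trans (hg.lt_supNorm (by norm_num))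

lemma IsClassG.supNorm_le_one (hg : IsClassG g) : supNorm g ≤ 1 := by
  refine csSup_le ⟨_, mem_image_of_mem _ (by norm_num : (1 / 2 : ℝ) ∈ Ioo (0 : ℝ) 1)⟩ ?_
  rintro _ ⟨s, hs, rfl⟩
  simpa [abs_of_pos (hg.pos hs)] using (hg.lt_one hs).le

lemma IsClassG.exists_lt (hg : IsClassG g) {r : ℝ} (hr : r < supNorm g) :
    ∃ t ∈ Ioo (0 : ℝ) 1, r < g t := by
  obtain ⟨_, ⟨t, ht, rfl⟩, h⟩ := exists_lt_of_lt_csSup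
    (⟨_, mem_image_of_mem _ (by norm_num : (1 / 2 : ℝ) ∈ Ioo (0 : ℝ) 1)⟩) hr
  exact ⟨t, ht, by simpa [abs_of_pos (hg.pos ht)] using h⟩

lemma bddAbove_sublevel (g : ℝ → ℝ) (r : ℝ) : BddAbove {t | t ∈ Ioo (0 : ℝ) 1 ∧ g t ≤ r} :=
  ⟨1, fun _ h => h.1.2.le⟩

lemma le_gInv {r t : ℝ} (ht : t ∈ Ioo (0 : ℝ) 1) (h : g t ≤ r) : t ≤ gInv g r :=
  le_csSup (bddAbove_sublevel g r) ⟨ht, h⟩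

lemma gInv_le_one (g : ℝ → ℝ) (r : ℝ) : gInv g r ≤ 1 :=
  Real.sSup_le (fun _ h => h.1.2.le) zero_le_one

/-- Below its inverse at `r`, the function stays below `r`. -/
lemma IsClassG.lt_of_lt_gInv (hg : IsClassG g) {r t : ℝ} (ht : t ∈ Ioo (0 : ℝ) 1)
    (h : t < gInv g r) : g t < r := by
  have hne : {t | t ∈ Ioo (0 : ℝ) 1 ∧ g t ≤ r}.Nonempty := by
    by_contra hne
    rw [not_nonempty_iff_eq_empty] at hne
    have : gInv g r = 0 := by rw [gInv, hne, Real.sSup_empty]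
    linarith [ht.1]
  obtain ⟨s, ⟨hs, hsr⟩, hts⟩ := exists_lt_of_lt_csSup hne h
  exact (hg.strictMono ht hs hts).trans_le hsr

lemma IsClassG.gInv_apply (hg : IsClassG g) {t : ℝ} (ht : t ∈ Ioo (0 : ℝ) 1) :
    gInv g (g t) = t := by
  refine le_antisymm ?_ (le_gInv ht le_rfl)
  refine csSup_le ⟨t, ht, le_rfl⟩ ?_
  rintro s ⟨hs, hst⟩
  exact (hg.strictMono.le_iff_le hs ht).1 hst

lemma IsClassG.exists_le_mul_rpow (hg : IsClassG g) {M : ℝ} (hM : 0 < M) :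
    ∃ K : ℝ, 1 ≤ K ∧ ∀ t ∈ Ioo (0 : ℝ) 1, g t ≤ K * t ^ M := by
  have h := (hg.isLittleO M hM).bound (zero_lt_one)
  rw [eventually_nhdsWithin_iff, Metric.eventually_nhds_iff] at h
  obtain ⟨e, he, h⟩ := h
  refine ⟨max 1 ((min e 1) ^ (-M)), le_max_left _ _, fun t ht => ?_⟩
  have hpos : 0 < t ^ M := Real.rpow_pos_of_pos ht.1 _
  rcases lt_or_ge t e with hlt | hge
  · have := h (by simpa [abs_of_pos ht.1] using hlt) ht.1
    rw [Real.norm_of_nonneg (hg.pos ht).le, Real.norm_of_nonneg hpos.le] at this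
    exact this.trans (by gcongr; exact le_max_left _ _)
  · have hm : 0 < min e 1 := lt_min he one_pos
    calc g t ≤ 1 := (hg.lt_one ht).le
      _ = (min e 1) ^ (-M) * (min e 1) ^ M := by rw [← Real.rpow_add hm]; simp
      _ ≤ max 1 ((min e 1) ^ (-M)) * t ^ M := by
        gcongr
        · exact le_max_right _ _
        · exact (min_le_left _ _).trans hge

/-- Positivity uses that `g` tends to `0` at `0`; for a general increasing function the supremum
could run over the empty set. -/
lemma IsClassG.gInv_pos (hg : IsClassG g) {r : ℝ} (hr : 0 < r) : 0 < gInv g r := by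
  obtain ⟨K, hK, h⟩ := hg.exists_le_mul_rpow one_pos
  have hK0 : 0 < K := by linarith
  have hm : 0 < min (1 / 2) (r / K) := lt_min (by norm_num) (by positivity)
  have ht : min (1 / 2) (r / K) ∈ Ioo (0 : ℝ) 1 :=
    ⟨hm, (min_le_left _ _).trans_lt (by norm_num)⟩
  refine hm.trans_le (le_gInv ht ((h _ ht).trans ?_))
  rw [Real.rpow_one]
  calc K * min (1 / 2) (r / K) ≤ K * (r / K) := by gcongr; exact min_le_right _ _
    _ = r := by field_simp

/-- As `g` vanishes at `0` faster than every power, its inverse exceeds every positive power. -/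
lemma IsClassG.exists_rpow_le_gInv (hg : IsClassG g) {τ : ℝ} (hτ : 0 < τ) :
    ∃ c : ℝ, 0 < c ∧ ∀ r ∈ Ioo (0 : ℝ) 1, c * r ^ τ ≤ gInv g r := by
  obtain ⟨K, hK, h⟩ := hg.exists_le_mul_rpow (M := 1 / τ) (by positivity)
  have hK0 : 0 < K := by linarith
  -- the factor `1 / 2` keeps the witness `(1 / 2) (r / K) ^ τ` below `1`
  refine ⟨1 / 2 * K ^ (-τ), by positivity, fun r hr => ?_⟩
  have h1 : K ^ (-τ) ≤ 1 := Real.rpow_le_one_of_one_le_of_nonpos hK (by linarith)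
  have h2 : r ^ τ ≤ 1 := Real.rpow_le_one hr.1.le hr.2.le hτ.le
  have h3 : 0 < r ^ τ := Real.rpow_pos_of_pos hr.1 _
  have h4 : 0 < K ^ (-τ) := by positivity
  have ht : 1 / 2 * K ^ (-τ) * r ^ τ ∈ Ioo (0 : ℝ) 1 := ⟨by positivity, by nlinarith⟩
  refine le_gInv ht ((h _ ht).trans ?_)
  have : (1 / 2 * K ^ (-τ) * r ^ τ) ^ (1 / τ) ≤ (K ^ (-τ) * r ^ τ) ^ (1 / τ) := by
    gcongr; nlinarith
  refine (mul_le_mul_of_nonneg_left this hK0.le).trans (le_of_eq ?_)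
  rw [Real.mul_rpow h4.le h3.le, ← Real.rpow_mul hK0.le, ← Real.rpow_mul hr.1.le]
  rw [show -τ * (1 / τ) = -1 by field_simp, show τ * (1 / τ) = 1 by field_simp, Real.rpow_one,
    Real.rpow_neg_one]
  field_simp

lemma gInv_monotoneOn (hg : IsClassG g) : MonotoneOn (gInv g) (Ioi 0) := by
  intro r hr s _ hrs
  refine le_of_forall_lt fun t ht => ?_
  rcases le_or_gt t 0 with h0 | h0
  · exact h0.trans_lt (hg.gInv_pos (lt_of_lt_of_le hr hrs))
  · have h1 : gInv g r ≤ 1 := gInv_le_one _ _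
    have hm : (t + gInv g r) / 2 ∈ Ioo (0 : ℝ) 1 := ⟨by linarith, by linarith⟩
    have := le_gInv hm (hg.lt_of_lt_gInv (r := r) hm (by linarith) |>.le.trans hrs)
    linarith

/-- The inverse of a strictly increasing function is continuous, even across jumps: it is monotone
and takes all values in `(0,1)`. -/
lemma continuousAt_gInv (hg : IsClassG g) {r : ℝ} (hr : 0 < r) (hr' : r < supNorm g) :
    ContinuousAt (gInv g) r := by
  have hlt : gInv g r < 1 := by
    obtain ⟨t, ht, h⟩ := hg.exists_lt hr'
    refine lt_of_le_of_lt ?_ ht.2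
    by_contra! hc
    exact absurd (hg.lt_of_lt_gInv ht hc) (not_lt.2 h.le)
  refine continuousAt_of_monotoneOn_of_exists_between (s := Ioi 0) (gInv_monotoneOn hg)
    (Ioi_mem_nhds hr) ?_ ?_
  · intro b hb
    have hm : max ((max b 0 + gInv g r) / 2) 0 ∈ Ioo (0 : ℝ) 1 := by
      have := hg.gInv_pos hr
      constructor
      · exact lt_max_of_lt_left (by linarith [le_max_right b 0])
      · exact max_lt (by linarith [max_lt hb this]) one_pos
    have hlt' : max ((max b 0 + gInv g r) / 2) 0 < gInv g r := by
      have := hg.gInv_pos hr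
      exact max_lt (by linarith [max_lt hb this]) this
    refine ⟨g (max ((max b 0 + gInv g r) / 2) 0), hg.pos hm, ?_⟩
    rw [hg.gInv_apply hm]
    refine ⟨lt_of_lt_of_le ?_ (le_max_left _ _), hlt'⟩
    have := max_lt hb (hg.gInv_pos hr)
    linarith [le_max_left b 0]
  · intro b hb
    have h0 := hg.gInv_pos hr
    have hm : (gInv g r + min b 1) / 2 ∈ Ioo (0 : ℝ) 1 := by
      have := lt_min hb hlt
      exact ⟨by linarith, by linarith [min_le_right b 1]⟩
    refine ⟨g ((gInv g r + min b 1) / 2), hg.pos hm, ?_⟩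
    rw [hg.gInv_apply hm]
    have := lt_min hb hlt
    exact ⟨by linarith, by linarith [min_le_left b 1]⟩

/-- Below `g⁻¹(r)` the slope of `g` is at most a constant multiple of `r / g⁻¹(r)`. For small `r`
this is the monotonicity of `r / g⁻¹(r)`; for the other `r` it only says that `g t / t` is
bounded. -/
lemma IsClassG.exists_slope_bound (hg : IsClassG g)
    (hmono : ∃ r₀ : ℝ, 0 < r₀ ∧ MonotoneOn (fun r => r / gInv g r) (Ioo 0 r₀)) :
    ∃ K : ℝ, 1 ≤ K ∧ ∀ r t : ℝ, 0 < r → t ∈ Ioo (0 : ℝ) 1 → t < gInv g r →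
      g t * gInv g r ≤ K * t * r := by
  obtain ⟨r₀, hr₀, hmono⟩ := hmono
  obtain ⟨K, hK, h⟩ := hg.exists_le_mul_rpow one_pos
  have hK0 : 0 < K := by linarith
  refine ⟨max 1 (K / r₀), le_max_left _ _, fun r t hr ht htr => ?_⟩
  have hgr := hg.lt_of_lt_gInv ht htr
  have hI := hg.gInv_pos hr
  have ht0 := ht.1
  rcases lt_or_ge r r₀ with hlt | hge
  · have := hmono ⟨hg.pos ht, hgr.trans hlt⟩ ⟨hr, hlt⟩ hgr.le
    simp only [hg.gInv_apply ht] at this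
    rw [div_le_div_iff₀ ht.1 hI] at this
    calc g t * gInv g r ≤ r * t := this
      _ = 1 * t * r := by ring
      _ ≤ max 1 (K / r₀) * t * r := by gcongr; exact le_max_left _ _
  · have h1 := h t ht
    rw [Real.rpow_one] at h1
    calc g t * gInv g r ≤ (K * t) * 1 := by
          gcongr
          exact gInv_le_one _ _
      _ = K / r₀ * t * r₀ := by field_simp
      _ ≤ max 1 (K / r₀) * t * r := by gcongr; exact le_max_right _ _

/-! ### The equation for `q` -/

lemma rateDenom_pos {d : ℕ} {ρ ν : ℝ} (hρ : 0 < ρ) (hν : 0 ≤ ν) : 0 < rateDenom d ρ ν := by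
  unfold rateDenom; positivity

lemma rate_strictMonoOn (hg : IsClassG g) {D : ℝ} (hD : 0 < D) :
    StrictMonoOn (fun q : ℝ => q ^ D / gInv g (1 / q) ^ 2) (Ioi 0) := by
  intro p hp q hq hpq
  have hp0 : (0 : ℝ) < p := hp
  have hq0 : (0 : ℝ) < q := hq
  have h1 : p ^ D < q ^ D := Real.rpow_lt_rpow hp0.le hpq hD
  have h2 : gInv g (1 / q) ≤ gInv g (1 / p) :=
    gInv_monotoneOn hg (one_div_pos.2 hq0) (one_div_pos.2 hp0)
      (one_div_le_one_div_of_le hp0 hpq.le)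
  have h3 := hg.gInv_pos (one_div_pos.2 hq0)
  have h4 : 0 < p ^ D := Real.rpow_pos_of_pos hp0 _
  calc p ^ D / gInv g (1 / p) ^ 2 ≤ p ^ D / gInv g (1 / q) ^ 2 := by gcongr
    _ < q ^ D / gInv g (1 / q) ^ 2 := by gcongr

lemma rate_continuousAt (hg : IsClassG g) (D : ℝ) {q : ℝ} (hq : 1 / supNorm g < q) :
    ContinuousAt (fun q : ℝ => q ^ D / gInv g (1 / q) ^ 2) q := by
  have hs := hg.supNorm_pos
  have hq0 : 0 < q := (one_div_pos.2 hs).trans hq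
  have h1 : 1 / q < supNorm g := by rwa [one_div_lt hq0 hs]
  have h2 : ContinuousAt (fun q : ℝ => gInv g (1 / q)) q := by
    have h3 : ContinuousAt (fun q : ℝ => 1 / q) q :=
      continuousAt_const.div continuousAt_id hq0.ne'
    exact ContinuousAt.comp (g := gInv g) (f := fun q : ℝ => 1 / q)
      (continuousAt_gInv hg (one_div_pos.2 hq0) h1) h3
  exact (Real.continuousAt_rpow_const _ _ (Or.inl hq0.ne')).div (h2.pow 2)
    (by have := hg.gInv_pos (one_div_pos.2 hq0); positivity)

theorem existsUnique_solvesRate (hg : IsClassG g) {d n : ℕ} {ρ ν : ℝ} (hρ : 0 < ρ) (hν : 0 ≤ ν)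
    (hn : supNorm g ^ (-rateDenom d ρ ν) < n) : ∃! q : ℝ, SolvesRate d n ρ ν g q := by
  set D := rateDenom d ρ ν with hDdef
  have hD : 0 < D := rateDenom_pos hρ hν
  have hs := hg.supNorm_pos
  have hpos : ∀ q, 1 / supNorm g < q → 0 < q := fun q h => (one_div_pos.2 hs).trans h
  -- as `q` decreases to `1 / ‖g‖_∞` the left-hand side tends to `‖g‖_∞ ^ (-D)`
  obtain ⟨a, ha, han⟩ : ∃ a, 1 / supNorm g < a ∧ a ^ D / gInv g (1 / a) ^ 2 ≤ n := by
    have hlim : Tendsto (fun t : ℝ => ((1 / g t) ^ D / t ^ 2)) (𝓝[<] 1)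
        (𝓝 ((1 / supNorm g) ^ D / 1 ^ 2)) := by
      have hgl : Tendsto g (𝓝[<] 1) (𝓝 (supNorm g)) := by
        refine tendsto_order.2 ⟨fun b hb => ?_, fun b hb => ?_⟩
        · obtain ⟨t, ht, hbt⟩ := hg.exists_lt hb
          filter_upwards [Ioo_mem_nhdsLT ht.2] with s hs'
          exact hbt.trans (hg.strictMono ht ⟨ht.1.trans hs'.1, hs'.2⟩ hs'.1)
        · filter_upwards [Ioo_mem_nhdsLT (zero_lt_one' ℝ)] with s hs'
          exact (hg.le_supNorm hs').trans_lt hb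
      refine Tendsto.div ?_ ((tendsto_nhdsWithin_of_tendsto_nhds tendsto_id).pow 2) (by norm_num)
      exact (tendsto_const_nhds.div hgl hs.ne').rpow_const (Or.inl (by positivity))
    have hlt : (1 / supNorm g) ^ D / 1 ^ 2 < n := by
      rwa [one_pow, div_one, one_div, Real.inv_rpow hs.le, ← Real.rpow_neg hs.le]
    obtain ⟨t, h1, h2⟩ := ((hlim.eventually (gt_mem_nhds hlt)).and
      (Ioo_mem_nhdsLT (zero_lt_one' ℝ))).exists
    refine ⟨1 / g t, one_div_lt_one_div_of_lt (hg.pos h2) (hg.lt_supNorm h2), ?_⟩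
    rw [one_div_one_div, hg.gInv_apply h2]
    exact h1.le
  obtain ⟨b, hab, hbn⟩ : ∃ b, a ≤ b ∧ (n : ℝ) ≤ b ^ D / gInv g (1 / b) ^ 2 := by
    obtain ⟨b, hb1, hb2⟩ := ((tendsto_rpow_atTop hD).eventually_ge_atTop (n : ℝ)).and
      (eventually_ge_atTop a) |>.exists
    have hb0 : 0 < b := (hpos a ha).trans_le hb2
    refine ⟨b, hb2, hb1.trans ?_⟩
    have h3 := hg.gInv_pos (one_div_pos.2 hb0)
    rw [le_div_iff₀ (by positivity)]
    have h4 : gInv g (1 / b) ^ 2 ≤ 1 := pow_le_one₀ h3.le (gInv_le_one _ _)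
    have : 0 < b ^ D := Real.rpow_pos_of_pos hb0 _
    nlinarith
  obtain ⟨q, hq, hqn⟩ := intermediate_value_Icc hab
    (fun q hq => (rate_continuousAt hg D (ha.trans_le hq.1)).continuousWithinAt) ⟨han, hbn⟩
  refine ⟨q, ⟨ha.trans_le hq.1, hqn⟩, fun q' hq' => ?_⟩
  exact (rate_strictMonoOn hg hD).injOn (hpos _ hq'.1) (hpos _ (ha.trans_le hq.1))
    (hq'.2.trans hqn.symm)

/-! ### The radial profile and sums of disjoint bumps -/

variable {H : Type*} [NormedAddCommGroup H] [InnerProductSpace ℝ H]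

/-- A smooth radially decreasing profile: `1` for `‖x‖² ≤ 3/4`, positive exactly on the open unit
ball. -/
def prof (x : H) : ℝ := Real.smoothTransition (4 * (1 - ‖x‖ ^ 2))

lemma prof_contDiff {n : ℕ∞} : ContDiff ℝ n (prof : H → ℝ) :=
  Real.smoothTransition.contDiff.comp (contDiff_const.mul (contDiff_const.sub (contDiff_norm_sq ℝ)))

lemma prof_continuous : Continuous (prof : H → ℝ) := (prof_contDiff (n := 0)).continuous

lemma prof_nonneg (x : H) : 0 ≤ prof x := Real.smoothTransition.nonneg _

lemma prof_le_one (x : H) : prof x ≤ 1 := Real.smoothTransition.le_one _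

lemma prof_eq_one {x : H} (hx : ‖x‖ ^ 2 ≤ 3 / 4) : prof x = 1 :=
  Real.smoothTransition.one_of_one_le (by linarith)

lemma prof_eq_zero {x : H} (hx : 1 ≤ ‖x‖) : prof x = 0 :=
  Real.smoothTransition.zero_of_nonpos (by nlinarith)

lemma prof_pos {x : H} (hx : ‖x‖ < 1) : 0 < prof x :=
  Real.smoothTransition.pos_of_pos (by nlinarith [norm_nonneg x])

lemma prof_anti {x y : H} (h : ‖x‖ ≤ ‖y‖) : prof y ≤ prof x :=
  Real.smoothTransition.monotone (by nlinarith [norm_nonneg x])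

lemma norm_lt_one_of_prof_ne_zero {x : H} (h : prof x ≠ 0) : ‖x‖ < 1 := by
  by_contra! hc
  exact h (prof_eq_zero hc)

lemma tsupport_prof : tsupport (prof : H → ℝ) ⊆ Metric.closedBall 0 1 :=
  closure_minimal (fun x hx => by simpa using (norm_lt_one_of_prof_ne_zero hx).le)
    Metric.isClosed_closedBall

lemma prof_hasCompactSupport [FiniteDimensional ℝ H] : HasCompactSupport (prof : H → ℝ) :=
  (isCompact_closedBall _ _).of_isClosed_subset (isClosed_tsupport _) tsupport_prof

lemma prof_integrable [FiniteDimensional ℝ H] [MeasureSpace H] [BorelSpace H]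
    [IsFiniteMeasureOnCompacts (volume : Measure H)] : Integrable (prof : H → ℝ) :=
  prof_continuous.integrable_of_hasCompactSupport prof_hasCompactSupport

lemma prof_integral_pos [FiniteDimensional ℝ H] [MeasureSpace H] [BorelSpace H]
    [IsFiniteMeasureOnCompacts (volume : Measure H)] [(volume : Measure H).IsOpenPosMeasure] :
    0 < ∫ x : H, prof x := by
  refine prof_continuous.integral_pos_of_hasCompactSupport_nonneg_nonzero prof_hasCompactSupport
    prof_nonneg (x := 0) ?_
  rw [prof_eq_one (by norm_num)]
  norm_num

lemma exists_bound_of_hasCompactSupport [FiniteDimensional ℝ H] {V : Type*} [NormedAddCommGroup V]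
    [NormedSpace ℝ V] {u : H → V} (hu : ContDiff ℝ 1 u) (hs : HasCompactSupport u) :
    ∃ B : ℝ, (∀ x, ‖u x‖ ≤ B) ∧ ∀ x y, ‖u y - u x‖ ≤ B * ‖y - x‖ := by
  obtain ⟨B, hB⟩ := hs.exists_bound_of_continuous hu.continuous
  obtain ⟨C, hC⟩ := hu.lipschitzWith_of_hasCompactSupport hs one_ne_zero
  refine ⟨max B C, fun x => (hB x).trans (le_max_left _ _), fun x y => ?_⟩
  refine (hC.norm_sub_le y x).trans ?_
  gcongr
  exact le_max_right _ _

/-- A common bound for the first three derivatives of the profile, the last one in the form of a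
Lipschitz condition. -/
structure IsProfBound (H : Type*) [NormedAddCommGroup H] [InnerProductSpace ℝ H] (B : ℝ) :
    Prop where
  one_le : 1 ≤ B
  norm_fderiv : ∀ x : H, ‖fderiv ℝ prof x‖ ≤ B
  norm_fderiv_fderiv : ∀ x : H, ‖fderiv ℝ (fderiv ℝ prof) x‖ ≤ B
  lipschitz : ∀ x y : H,
    ‖fderiv ℝ (fderiv ℝ prof) y - fderiv ℝ (fderiv ℝ prof) x‖ ≤ B * ‖y - x‖

lemma prof_contDiff_fderiv {n : ℕ} : ContDiff ℝ n (fderiv ℝ (prof : H → ℝ)) :=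
  (prof_contDiff (n := (n + 1 : ℕ))).fderiv_right (by norm_cast)

lemma exists_isProfBound (H : Type*) [NormedAddCommGroup H] [InnerProductSpace ℝ H]
    [FiniteDimensional ℝ H] : ∃ B : ℝ, IsProfBound H B := by
  have c1 : ContDiff ℝ (1 + 1) (fderiv ℝ (prof : H → ℝ)) := by
    have := prof_contDiff_fderiv (H := H) (n := 2)
    norm_num at this ⊢
    exact this
  have c2 : ContDiff ℝ 1 (fderiv ℝ (fderiv ℝ (prof : H → ℝ))) := c1.fderiv_right le_rfl
  have s1 := (prof_hasCompactSupport (H := H)).fderiv ℝ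
  obtain ⟨B1, h1, -⟩ := exists_bound_of_hasCompactSupport (prof_contDiff_fderiv (n := 1)) s1
  obtain ⟨B2, h2, h3⟩ := exists_bound_of_hasCompactSupport c2 (s1.fderiv ℝ)
  refine ⟨max 1 (max B1 B2), le_max_left _ _, fun x => (h1 x).trans ?_, fun x => (h2 x).trans ?_,
    fun x y => (h3 x y).trans ?_⟩
  · exact (le_max_left _ _).trans (le_max_right _ _)
  · exact (le_max_right _ _).trans (le_max_right _ _)
  · gcongr
    exact (le_max_right _ _).trans (le_max_right _ _)

section DisjointSum

variable {ι X V : Type*} [Fintype ι] [NormedAddCommGroup V]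

lemma norm_sum_le_of_disjoint {u : ι → X → V} {B : ℝ} (hB0 : 0 ≤ B) (hB : ∀ i x, ‖u i x‖ ≤ B)
    (hd : ∀ x i j, u i x ≠ 0 → u j x ≠ 0 → i = j) (x : X) : ‖∑ i, u i x‖ ≤ B := by
  classical
  by_cases h : ∃ i, u i x ≠ 0
  · obtain ⟨i, hi⟩ := h
    rw [Fintype.sum_eq_single i fun j hj => by_contra fun hne => hj (hd x _ _ hne hi)]
    exact hB i x
  · push Not at h
    simpa [h] using hB0

/-- At two points at most two terms of a sum of functions with disjoint supports are active, so a
common Lipschitz constant is lost by a factor `2` only. -/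
lemma norm_sum_sub_le_of_disjoint [NormedAddCommGroup X] {u : ι → X → V} {K : ℝ} (hK0 : 0 ≤ K)
    (hK : ∀ i x y, ‖u i y - u i x‖ ≤ K * ‖y - x‖)
    (hd : ∀ x i j, u i x ≠ 0 → u j x ≠ 0 → i = j) (x y : X) :
    ‖∑ i, u i y - ∑ i, u i x‖ ≤ 2 * K * ‖y - x‖ := by
  classical
  set T := (Finset.univ.filter fun i => u i x ≠ 0) ∪ Finset.univ.filter fun i => u i y ≠ 0
  have hcard : T.card ≤ 2 := by
    refine (Finset.card_union_le _ _).trans (add_le_add ?_ ?_ : _ ≤ 1 + 1) <;>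
    · rw [Finset.card_le_one]
      intro i hi j hj
      exact hd _ i j (Finset.mem_filter.1 hi).2 (Finset.mem_filter.1 hj).2
  have hsum : ∑ i ∈ T, (u i y - u i x) = ∑ i, (u i y - u i x) := by
    refine Finset.sum_subset (Finset.subset_univ _) fun i _ hi => ?_
    simp only [T, Finset.mem_union, Finset.mem_filter, Finset.mem_univ, true_and, not_or,
      not_not] at hi
    rw [hi.1, hi.2, sub_zero]
  rw [← Finset.sum_sub_distrib, ← hsum]
  calc ‖∑ i ∈ T, (u i y - u i x)‖ ≤ ∑ i ∈ T, K * ‖y - x‖ := norm_sum_le_of_le _ fun i _ => hK i x y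
    _ = T.card * (K * ‖y - x‖) := by rw [Finset.sum_const, nsmul_eq_mul]
    _ ≤ 2 * (K * ‖y - x‖) := by gcongr; exact_mod_cast hcard
    _ = 2 * K * ‖y - x‖ := by ring

end DisjointSum

/-- `∑ₖ sₖ φ((x - cₖ) / a)`, with `φ` the profile. -/
def bumpSum {ι : Type*} [Fintype ι] (s : ι → ℝ) (a : ℝ) (c : ι → H) (x : H) : ℝ :=
  ∑ k, s k * prof (a⁻¹ • (x - c k))

section BumpSum

variable {ι : Type*} [Fintype ι] {s : ι → ℝ} {a : ℝ} {c : ι → H}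

lemma bumpSum_contDiff {n : ℕ∞} : ContDiff ℝ n (bumpSum s a c) :=
  ContDiff.sum fun k _ => contDiff_const.mul
    (prof_contDiff.comp (by fun_prop : ContDiff ℝ n fun x => a⁻¹ • (x - c k)))

lemma hasFDerivAt_rescale {V : Type*} [NormedAddCommGroup V] [NormedSpace ℝ V] {F : H → V}
    (hF : Differentiable ℝ F) (a : ℝ) (c x : H) :
    HasFDerivAt (fun x => F (a⁻¹ • (x - c))) (a⁻¹ • fderiv ℝ F (a⁻¹ • (x - c))) x := by
  have h1 : HasFDerivAt (fun x : H => a⁻¹ • (x - c)) (a⁻¹ • ContinuousLinearMap.id ℝ H) x :=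
    ((hasFDerivAt_id x).sub_const c).const_smul a⁻¹
  have h := (hF (a⁻¹ • (x - c))).hasFDerivAt.comp x h1
  rwa [ContinuousLinearMap.comp_smul, ContinuousLinearMap.comp_id] at h

lemma fderiv_sum_rescale {V : Type*} [NormedAddCommGroup V] [NormedSpace ℝ V] {F : H → V}
    (hF : Differentiable ℝ F) (w : ι → ℝ) (a : ℝ) (c : ι → H) :
    fderiv ℝ (fun x => ∑ k, w k • F (a⁻¹ • (x - c k))) =
      fun x => ∑ k, (w k * a⁻¹) • fderiv ℝ F (a⁻¹ • (x - c k)) := by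
  ext1 x
  refine HasFDerivAt.fderiv ?_
  have := HasFDerivAt.fun_sum (u := Finset.univ) fun k _ =>
    (hasFDerivAt_rescale hF a (c k) x).const_smul (w k)
  simpa only [mul_smul, Pi.smul_apply] using this

lemma fderiv_bumpSum :
    fderiv ℝ (bumpSum s a c) = fun x => ∑ k, (s k * a⁻¹) • fderiv ℝ prof (a⁻¹ • (x - c k)) :=
  fderiv_sum_rescale ((prof_contDiff (H := H) (n := 1)).differentiable (by norm_num)) s a c

lemma fderiv_fderiv_bumpSum :
    fderiv ℝ (fderiv ℝ (bumpSum s a c)) =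
      fun x => ∑ k, (s k * a⁻¹ * a⁻¹) • fderiv ℝ (fderiv ℝ prof) (a⁻¹ • (x - c k)) := by
  rw [fderiv_bumpSum]
  exact fderiv_sum_rescale
    ((prof_contDiff_fderiv (H := H) (n := 1)).differentiable (by norm_num)) _ a c

/-- Bumps with centres more than `2a` apart have disjoint supports, and so have their
derivatives. -/
lemma eq_of_mem_tsupport_prof (ha : 0 < a) (hc : Pairwise fun k l => 2 * a < ‖c k - c l‖) {x : H}
    {k l : ι} (hk : a⁻¹ • (x - c k) ∈ tsupport (prof : H → ℝ))
    (hl : a⁻¹ • (x - c l) ∈ tsupport (prof : H → ℝ)) : k = l := by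
  by_contra hne
  have key : ∀ m, a⁻¹ • (x - c m) ∈ tsupport (prof : H → ℝ) → ‖x - c m‖ ≤ a := fun m hm => by
    have := tsupport_prof hm
    rw [mem_closedBall_zero_iff, norm_smul, norm_inv, Real.norm_of_nonneg ha.le,
      inv_mul_le_iff₀ ha, mul_one] at this
    exact this
  have h1 := norm_sub_le (x - c l) (x - c k)
  rw [sub_sub_sub_cancel_left] at h1
  linarith [hc hne, key k hk, key l hl]

lemma support_fderiv_prof :
    Function.support (fderiv ℝ (prof : H → ℝ)) ⊆ tsupport (prof : H → ℝ) :=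
  support_fderiv_subset ℝ

lemma support_fderiv_fderiv_prof :
    Function.support (fderiv ℝ (fderiv ℝ (prof : H → ℝ))) ⊆ tsupport (prof : H → ℝ) :=
  (support_fderiv_subset ℝ).trans (tsupport_fderiv_subset ℝ)

section Bounds

variable {V : Type*} [NormedAddCommGroup V] [NormedSpace ℝ V] {F : H → V} {w : ι → ℝ} {h B : ℝ}

lemma norm_sum_rescale_le (hF : Function.support F ⊆ tsupport (prof : H → ℝ)) (hB0 : 0 ≤ B)
    (hB : ∀ x, ‖F x‖ ≤ B) (ha : 0 < a) (hc : Pairwise fun k l => 2 * a < ‖c k - c l‖)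
    (hh : 0 ≤ h) (hw : ∀ k, |w k| ≤ h) (x : H) : ‖∑ k, w k • F (a⁻¹ • (x - c k))‖ ≤ h * B := by
  refine norm_sum_le_of_disjoint (u := fun k x => w k • F (a⁻¹ • (x - c k))) (by positivity)
    (fun k x => ?_) (fun x k l hk hl => eq_of_mem_tsupport_prof ha hc
      (hF (right_ne_zero_of_smul hk)) (hF (right_ne_zero_of_smul hl))) x
  rw [norm_smul]
  exact mul_le_mul (hw k) (hB _) (norm_nonneg _) hh

lemma norm_sum_rescale_sub_le (hF : Function.support F ⊆ tsupport (prof : H → ℝ)) (hB0 : 0 ≤ B)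
    (hB : ∀ x y, ‖F y - F x‖ ≤ B * ‖y - x‖) (ha : 0 < a)
    (hc : Pairwise fun k l => 2 * a < ‖c k - c l‖)
    (hh : 0 ≤ h) (hw : ∀ k, |w k| ≤ h) (x y : H) :
    ‖∑ k, w k • F (a⁻¹ • (y - c k)) - ∑ k, w k • F (a⁻¹ • (x - c k))‖ ≤
      2 * (h * a⁻¹ * B) * ‖y - x‖ := by
  refine norm_sum_sub_le_of_disjoint (u := fun k x => w k • F (a⁻¹ • (x - c k))) (by positivity)
    (fun k x y => ?_) (fun x k l hk hl => eq_of_mem_tsupport_prof ha hc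
      (hF (right_ne_zero_of_smul hk)) (hF (right_ne_zero_of_smul hl))) x y
  have h1 := hB (a⁻¹ • (x - c k)) (a⁻¹ • (y - c k))
  rw [← smul_sub, sub_sub_sub_cancel_right, norm_smul, norm_inv, Real.norm_of_nonneg ha.le] at h1
  rw [← smul_sub, norm_smul, Real.norm_eq_abs]
  calc |w k| * _ ≤ h * (B * (a⁻¹ * ‖y - x‖)) := mul_le_mul (hw k) h1 (norm_nonneg _) hh
    _ = h * a⁻¹ * B * ‖y - x‖ := by ring

end Bounds

variable {h B : ℝ}

lemma abs_bumpSum_le (ha : 0 < a) (hc : Pairwise fun k l => 2 * a < ‖c k - c l‖)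
    (hh : 0 ≤ h) (hs : ∀ k, |s k| ≤ h) (x : H) : |bumpSum s a c x| ≤ h := by
  have := norm_sum_rescale_le (F := (prof : H → ℝ)) (subset_tsupport _) zero_le_one
    (fun x => by simpa [abs_of_nonneg (prof_nonneg x)] using prof_le_one x) ha hc hh hs x
  simpa [bumpSum] using this

lemma abs_mul_inv_le (ha : 0 < a) (hs : ∀ k, |s k| ≤ h) (k : ι) : |s k * a⁻¹| ≤ h * a⁻¹ := by
  rw [abs_mul, abs_of_pos (inv_pos.2 ha)]
  gcongr
  exact hs k

lemma norm_fderiv_bumpSum_le (hB : IsProfBound H B) (ha : 0 < a)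
    (hc : Pairwise fun k l => 2 * a < ‖c k - c l‖) (hh : 0 ≤ h) (hs : ∀ k, |s k| ≤ h) (x : H) :
    ‖fderiv ℝ (bumpSum s a c) x‖ ≤ h * a⁻¹ * B := by
  rw [fderiv_bumpSum]
  exact norm_sum_rescale_le support_fderiv_prof (zero_le_one.trans hB.one_le) hB.norm_fderiv ha hc
    (by positivity) (abs_mul_inv_le ha hs) x

lemma norm_fderiv_fderiv_bumpSum_le (hB : IsProfBound H B) (ha : 0 < a)
    (hc : Pairwise fun k l => 2 * a < ‖c k - c l‖) (hh : 0 ≤ h) (hs : ∀ k, |s k| ≤ h) (x : H) :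
    ‖fderiv ℝ (fderiv ℝ (bumpSum s a c)) x‖ ≤ h * a⁻¹ * a⁻¹ * B := by
  rw [fderiv_fderiv_bumpSum]
  have h0 := norm_sum_rescale_le (V := H →L[ℝ] H →L[ℝ] ℝ) (w := fun k => s k * a⁻¹ * a⁻¹)
    (a := a) (c := c) (h := h * a⁻¹ * a⁻¹) (B := B) support_fderiv_fderiv_prof
    (zero_le_one.trans hB.one_le)
  exact h0 (fun x => hB.norm_fderiv_fderiv x) ha hc (by positivity)
    (abs_mul_inv_le ha (abs_mul_inv_le ha hs)) x

lemma norm_fderiv_fderiv_bumpSum_sub_le (hB : IsProfBound H B) (ha : 0 < a)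
    (hc : Pairwise fun k l => 2 * a < ‖c k - c l‖) (hh : 0 ≤ h) (hs : ∀ k, |s k| ≤ h) (x y : H) :
    ‖fderiv ℝ (fderiv ℝ (bumpSum s a c)) y - fderiv ℝ (fderiv ℝ (bumpSum s a c)) x‖ ≤
      2 * (h * a⁻¹ * a⁻¹ * a⁻¹ * B) * ‖y - x‖ := by
  rw [fderiv_fderiv_bumpSum]
  have h0 := norm_sum_rescale_sub_le (V := H →L[ℝ] H →L[ℝ] ℝ) (w := fun k => s k * a⁻¹ * a⁻¹)
    (a := a) (c := c) (h := h * a⁻¹ * a⁻¹) (B := B) support_fderiv_fderiv_prof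
    (zero_le_one.trans hB.one_le)
  exact h0 (fun x y => hB.lipschitz x y) ha hc (by positivity)
    (abs_mul_inv_le ha (abs_mul_inv_le ha hs)) x y

lemma exists_of_bumpSum_ne_zero (ha : 0 < a) {x : H} (hx : bumpSum s a c x ≠ 0) :
    ∃ k, ‖x - c k‖ < a := by
  obtain ⟨k, -, hk⟩ := Finset.exists_ne_zero_of_sum_ne_zero hx
  refine ⟨k, ?_⟩
  have := norm_lt_one_of_prof_ne_zero (right_ne_zero_of_mul hk)
  rwa [norm_smul, norm_inv, Real.norm_of_nonneg ha.le, inv_mul_lt_iff₀ ha, mul_one] at this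

/-- On the ball around `cₖ` only the `k`-th bump is active. -/
lemma bumpSum_eq_of_norm_lt (ha : 0 < a) (hc : Pairwise fun k l => 2 * a < ‖c k - c l‖) {x : H}
    {k : ι} (hk : ‖x - c k‖ < a) : bumpSum s a c x = s k * prof (a⁻¹ • (x - c k)) := by
  refine Fintype.sum_eq_single k fun l hl => ?_
  rw [prof_eq_zero, mul_zero]
  rw [norm_smul, norm_inv, Real.norm_of_nonneg ha.le, le_inv_mul_iff₀ ha, mul_one]
  have h1 := norm_sub_le (x - c l) (x - c k)
  rw [sub_sub_sub_cancel_left] at h1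
  linarith [hc hl.symm]

end BumpSum

/-- A function with values in `[0,λ]` whose first two derivatives are bounded by `λ/2` satisfies
the smoothness condition of every order `γ ∈ (0,2]`. -/
lemma isHolder_of_bounds {d : ℕ} {f : E d → ℝ} {γ lam : ℝ} (hγ : 0 < γ) (hγ2 : γ ≤ 2)
    (hf : ContDiff ℝ 2 f) (h0 : ∀ x, 0 ≤ f x) (hb : ∀ x, f x ≤ lam)
    (h1 : ∀ x, ‖fderiv ℝ f x‖ ≤ lam / 2) (h2 : ∀ x, ‖fderiv ℝ (fderiv ℝ f) x‖ ≤ lam) :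
    IsHolder γ lam f := by
  have hlam : 0 ≤ lam := (h0 0).trans (hb 0)
  have hd1 : Differentiable ℝ f := hf.differentiable (by norm_num)
  have hd2 : Differentiable ℝ (fderiv ℝ f) :=
    (hf.fderiv_right (m := 1) (by norm_num)).differentiable (by norm_num)
  -- a bounded Lipschitz function is Hölder of every order at most one
  have interp : ∀ {s α u : ℝ}, 0 ≤ s → 0 < α → α ≤ 1 → u ≤ lam * s → u ≤ lam →
      u ≤ lam * s ^ α := by
    intro s α u hs hα hα1 hu hu'
    rcases le_total s 1 with h | h
    · refine hu.trans (mul_le_mul_of_nonneg_left ?_ hlam)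
      rcases hs.eq_or_lt with rfl | hs
      · rw [Real.zero_rpow hα.ne']
      · simpa using Real.rpow_le_rpow_of_exponent_ge hs h hα1
    · refine hu'.trans ?_
      have := Real.one_le_rpow h hα.le
      nlinarith
  refine ⟨fun hγ1 x y => interp (norm_nonneg _) hγ hγ1 ?_ ?_, fun hγ1 => ⟨hd1, fun x y =>
    interp (norm_nonneg _) (by linarith) (by linarith) ?_ ?_⟩⟩
  · exact Convex.norm_image_sub_le_of_norm_fderiv_le (𝕜 := ℝ) (s := univ) (fun x _ => hd1 x)
      (fun x _ => (h1 x).trans (by linarith)) convex_univ (mem_univ _) (mem_univ _)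
  · rw [abs_le]
    constructor <;> linarith [h0 x, h0 y, hb x, hb y]
  · exact Convex.norm_image_sub_le_of_norm_fderiv_le (𝕜 := ℝ) (s := univ) (fun x _ => hd2 x)
      (fun x _ => h2 x) convex_univ (mem_univ _) (mem_univ _)
  · exact (norm_sub_le _ _).trans (by linarith [h1 x, h1 y])

/-! ### Distributions given by two subdensities -/

section Subdensity

variable {d : ℕ} {F : Fin 2 → E d → ℝ}

/-- `F r` is the Lebesgue density of `P(X ∈ ·, Y = r)` for some distribution `P`, both classes
having positive probability. -/
structure IsSubdensity (F : Fin 2 → E d → ℝ) : Prop where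
  continuous : ∀ r, Continuous (F r)
  nonneg : ∀ r x, 0 ≤ F r x
  exists_pos : ∀ r, ∃ x, 0 < F r x
  lintegral : ∫⁻ x, ENNReal.ofReal (F 0 x + F 1 x) = 1

/-- The law of `(X, Y)` for which `X` restricted to `Y = r` has density `F r`. -/
def jointLaw (F : Fin 2 → E d → ℝ) : Measure (E d × Fin 2) :=
  ((volume : Measure (E d)).prod Measure.count).withDensity fun w => ENNReal.ofReal (F w.2 w.1)

lemma measurable_uncurry_label {α β : Type*} [MeasurableSpace α] [MeasurableSpace β]
    {G : Fin 2 → α → β} (hG : ∀ r, Measurable (G r)) :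
    Measurable fun w : α × Fin 2 => G w.2 w.1 :=
  measurable_from_prod_countable_left fun r => hG r

lemma IsSubdensity.measurable_ofReal (hF : IsSubdensity F) (r : Fin 2) :
    Measurable fun x => ENNReal.ofReal (F r x) :=
  (hF.continuous r).measurable.ennreal_ofReal

lemma IsSubdensity.measurable_weight (hF : IsSubdensity F) :
    Measurable fun w : E d × Fin 2 => ENNReal.ofReal (F w.2 w.1) :=
  measurable_uncurry_label (G := fun r x => ENNReal.ofReal (F r x)) hF.measurable_ofReal

lemma lintegral_jointLaw (hF : IsSubdensity F) {φ : E d × Fin 2 → ℝ≥0∞} (hφ : Measurable φ) :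
    ∫⁻ w, φ w ∂jointLaw F =
      ∫⁻ x, (ENNReal.ofReal (F 0 x) * φ (x, 0) + ENNReal.ofReal (F 1 x) * φ (x, 1)) := by
  rw [jointLaw, lintegral_withDensity_eq_lintegral_mul _ hF.measurable_weight hφ,
    lintegral_prod _ (hF.measurable_weight.mul hφ).aemeasurable]
  refine lintegral_congr fun x => ?_
  rw [lintegral_count, tsum_fintype, Fin.sum_univ_two]
  simp

lemma jointLaw_apply (hF : IsSubdensity F) {S : Set (E d × Fin 2)} (hS : MeasurableSet S) :
    jointLaw F S = ∫⁻ x, (ENNReal.ofReal (F 0 x) * S.indicator 1 (x, 0) +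
      ENNReal.ofReal (F 1 x) * S.indicator 1 (x, 1)) := by
  rw [← lintegral_jointLaw hF (measurable_one.indicator hS), lintegral_indicator_one hS]

lemma IsSubdensity.isProbabilityMeasure (hF : IsSubdensity F) :
    IsProbabilityMeasure (jointLaw F) := by
  constructor
  rw [jointLaw_apply hF MeasurableSet.univ, ← hF.lintegral]
  refine lintegral_congr fun x => ?_
  simp [ENNReal.ofReal_add (hF.nonneg 0 x) (hF.nonneg 1 x)]

/-- The distribution with subdensities `F`. -/
def IsSubdensity.distr (hF : IsSubdensity F) : Distr d := ⟨jointLaw F, hF.isProbabilityMeasure⟩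

lemma IsSubdensity.coe_distr (hF : IsSubdensity F) :
    ((hF.distr : Distr d) : Measure (E d × Fin 2)) = jointLaw F := rfl

lemma IsSubdensity.margX_distr (hF : IsSubdensity F) :
    margX hF.distr = volume.withDensity fun x => ENNReal.ofReal (F 0 x + F 1 x) := by
  ext S hS
  rw [margX, Measure.map_apply measurable_fst hS, withDensity_apply _ hS, hF.coe_distr,
    jointLaw_apply hF (measurable_fst hS), ← lintegral_indicator hS]
  refine lintegral_congr fun x => ?_
  by_cases hx : x ∈ S <;> simp [hx, ENNReal.ofReal_add (hF.nonneg 0 x) (hF.nonneg 1 x)]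

lemma IsSubdensity.isDensity_margX (hF : IsSubdensity F) :
    IsDensity (margX hF.distr) fun x => F 0 x + F 1 x where
  measurable := ((hF.continuous 0).add (hF.continuous 1)).measurable
  nonneg x := add_nonneg (hF.nonneg 0 x) (hF.nonneg 1 x)
  eq_withDensity := hF.margX_distr

lemma measurableSet_label (r : Fin 2) : MeasurableSet {z : E d × Fin 2 | z.2 = r} :=
  measurable_snd (measurableSet_singleton r)

lemma jointLaw_inter_label (hF : IsSubdensity F) {S : Set (E d)} (hS : MeasurableSet S)
    (r : Fin 2) :
    jointLaw F ({z | z.2 = r} ∩ Prod.fst ⁻¹' S) = ∫⁻ x in S, ENNReal.ofReal (F r x) := by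
  rw [jointLaw_apply hF ((measurableSet_label r).inter (measurable_fst hS)),
    ← lintegral_indicator hS]
  refine lintegral_congr fun x => ?_
  fin_cases r <;> by_cases hx : x ∈ S <;> simp [hx]

lemma IsSubdensity.label_pos (hF : IsSubdensity F) (r : Fin 2) :
    0 < jointLaw F {z | z.2 = r} := by
  have h := jointLaw_inter_label hF MeasurableSet.univ r
  rw [preimage_univ, inter_univ, setLIntegral_univ] at h
  rw [h, lintegral_pos_iff_support (hF.measurable_ofReal r)]
  obtain ⟨x, hx⟩ := hF.exists_pos r
  refine IsOpen.measure_pos _ ?_ ⟨x, ?_⟩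
  · exact (ENNReal.continuous_ofReal.comp (hF.continuous r)).isOpen_support
  · simpa using hx

lemma IsSubdensity.classProb_pos (hF : IsSubdensity F) (r : Fin 2) :
    0 < classProb hF.distr r := by
  have := hF.isProbabilityMeasure
  exact ENNReal.toReal_pos (hF.label_pos r).ne' (measure_ne_top _ _)

lemma IsSubdensity.isDensity_condLaw (hF : IsSubdensity F) (r : Fin 2) :
    IsDensity (condLaw hF.distr r) fun x => (classProb hF.distr r)⁻¹ * F r x where
  measurable := ((hF.continuous r).measurable).const_mul _
  nonneg x := mul_nonneg (inv_nonneg.2 (hF.classProb_pos r).le) (hF.nonneg r x)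
  eq_withDensity := by
    have := hF.isProbabilityMeasure
    ext S hS
    rw [condLaw, Measure.map_apply measurable_fst hS, withDensity_apply _ hS, hF.coe_distr,
      ProbabilityTheory.cond_apply (measurableSet_label r), jointLaw_inter_label hF hS]
    simp_rw [ENNReal.ofReal_mul (inv_nonneg.2 (hF.classProb_pos r).le)]
    rw [lintegral_const_mul _ (hF.measurable_ofReal r),
      ENNReal.ofReal_inv_of_pos (hF.classProb_pos r)]
    congr 2
    exact (ENNReal.ofReal_toReal (measure_ne_top (jointLaw F) _)).symm

lemma IsSubdensity.classProb_mul (hF : IsSubdensity F) (r : Fin 2) (x : E d) :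
    classProb hF.distr r * ((classProb hF.distr r)⁻¹ * F r x) = F r x :=
  mul_inv_cancel_left₀ (hF.classProb_pos r).ne' _

/-- Membership in `𝓟_{d,θ}` in terms of the subdensities. -/
lemma IsSubdensity.mem_classP (hF : IsSubdensity F) {ε₀ M₀ ρ : ℝ} {l g : ℝ → ℝ} {f η : E d → ℝ}
    (hf : ∀ x, F 0 x + F 1 x = f x) (hη : ∀ x, F 1 x / f x = η x)
    (h2 : MarginalCond (margX hF.distr) f η ε₀ M₀ l) (h3 : RegressionCond f η ε₀ M₀ l g)
    (h4 : TailCond (margX hF.distr) f η M₀ ρ) : hF.distr ∈ classP d ε₀ M₀ ρ l g := by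
  have e1 : fbar hF.distr (fun x => (classProb hF.distr 0)⁻¹ * F 0 x)
      (fun x => (classProb hF.distr 1)⁻¹ * F 1 x) = f := by
    ext x
    rw [fbar, hF.classProb_mul, hF.classProb_mul, hf]
  have e2 : etaOf hF.distr (fun x => (classProb hF.distr 0)⁻¹ * F 0 x)
      (fun x => (classProb hF.distr 1)⁻¹ * F 1 x) = η := by
    ext x
    rw [etaOf, e1, hF.classProb_mul, hη]
  have hcont : Continuous f := by
    have := (hF.continuous 0).add (hF.continuous 1)
    rwa [show F 0 + F 1 = f from funext hf] at this
  refine ⟨_, _, hF.isDensity_condLaw 0, hF.isDensity_condLaw 1, ?_⟩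
  rw [e1, e2]
  refine ⟨⟨ae_of_all _ fun x => hcont.continuousAt, ?_⟩, h2, h3, h4⟩
  simp [hcont.continuousAt]

end Subdensity

/-! ### The Bayes classifier is optimal -/

section Bayes

variable {d : ℕ}

lemma measurable_regression (P : Distr d) : Measurable (regression P) :=
  (ProbabilityTheory.Kernel.measurable_coe _ (measurableSet_singleton 1)).ennreal_toReal

lemma measurable_bayes (P : Distr d) : Measurable (bayes P) := by
  classical
  exact Measurable.ite (measurableSet_le measurable_const (measurable_regression P))
    measurable_const measurable_const

lemma measurableSet_ne {C : E d → Fin 2} (hC : Measurable C) :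
    MeasurableSet {z : E d × Fin 2 | C z.1 ≠ z.2} :=
  (measurableSet_eq_fun (hC.comp measurable_fst) measurable_snd).compl

lemma measure_ne_eq_lintegral (P : Distr d) {C : E d → Fin 2} (hC : Measurable C) :
    (P : Measure (E d × Fin 2)) {z | C z.1 ≠ z.2} =
      ∫⁻ x, (P : Measure (E d × Fin 2)).condKernel x {y | C x ≠ y}
        ∂(P : Measure (E d × Fin 2)).fst := by
  conv_lhs => rw [← (P : Measure (E d × Fin 2)).disintegrate
    (P : Measure (E d × Fin 2)).condKernel]
  rw [Measure.compProd_apply (measurableSet_ne hC)]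
  rfl

lemma measure_bayes_ne_le (P : Distr d) {C : E d → Fin 2} (hC : Measurable C) :
    (P : Measure (E d × Fin 2)) {z | bayes P z.1 ≠ z.2} ≤
      (P : Measure (E d × Fin 2)) {z | C z.1 ≠ z.2} := by
  rw [measure_ne_eq_lintegral P (measurable_bayes P), measure_ne_eq_lintegral P hC]
  refine lintegral_mono fun x => ?_
  set κ := (P : Measure (E d × Fin 2)).condKernel x with hκ
  have hsum : κ {0} + κ {1} = 1 := by
    rw [← measure_union (by simp) (measurableSet_singleton _), ← measure_univ (μ := κ)]
    congr 1
    ext y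
    fin_cases y <;> simp
  have h0 : {y : Fin 2 | (0 : Fin 2) ≠ y} = {1} := by ext y; fin_cases y <;> simp
  have h1 : {y : Fin 2 | (1 : Fin 2) ≠ y} = {0} := by ext y; fin_cases y <;> simp
  have hsum' : κ.real {0} + κ.real {1} = 1 := by
    rw [Measure.real, Measure.real, ← ENNReal.toReal_add (measure_ne_top _ _) (measure_ne_top _ _),
      hsum, ENNReal.toReal_one]
  have key : κ {y | bayes P x ≠ y} ≤ min (κ {0}) (κ {1}) := by
    unfold bayes
    split_ifs with h
    · rw [h1, le_min_iff]
      refine ⟨le_rfl, ?_⟩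
      rw [← ENNReal.toReal_le_toReal (measure_ne_top _ _) (measure_ne_top _ _)]
      change 1 / 2 ≤ κ.real {1} at h
      change κ.real {0} ≤ κ.real {1}
      linarith
    · rw [h0, le_min_iff]
      refine ⟨?_, le_rfl⟩
      rw [← ENNReal.toReal_le_toReal (measure_ne_top _ _) (measure_ne_top _ _)]
      change ¬ 1 / 2 ≤ κ.real {1} at h
      change κ.real {1} ≤ κ.real {0}
      linarith
  refine key.trans ?_
  rcases Fin.eq_zero_or_eq_succ (C x) with h | ⟨j, h⟩
  · rw [h, h0]; exact min_le_right _ _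
  · have : C x = 1 := by rw [h]; fin_cases j; rfl
    rw [this, h1]; exact min_le_left _ _

end Bayes

/-! ### Testing two product measures -/

lemma lintegral_pi_prod {Z : Type*} [MeasurableSpace Z] {n : ℕ} (μ : Measure Z) [SigmaFinite μ]
    {f : Fin n → Z → ℝ≥0∞} (hf : ∀ i, Measurable (f i)) :
    ∫⁻ D : Fin n → Z, ∏ i, f i (D i) ∂Measure.pi (fun _ => μ) = ∏ i, ∫⁻ z, f i z ∂μ := by
  induction n with
  | zero => simp
  | succ n ih =>
    have hm : Measurable fun x : Fin n → Z => ∏ i : Fin n, f (Fin.succ i) (x i) :=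
      Finset.measurable_prod _ fun i _ => (hf i.succ).comp (measurable_pi_apply i)
    calc
      _ = ∫⁻ x : Z × (Fin n → Z), f 0 x.1 * ∏ i : Fin n, f (Fin.succ i) (x.2 i)
            ∂(μ.prod (Measure.pi fun _ => μ)) := by
          rw [← ((measurePreserving_piFinSuccAbove (fun _ : Fin (n + 1) => μ) 0).symm).lintegral_comp_emb
            (MeasurableEquiv.measurableEmbedding _)]
          simp_rw [MeasurableEquiv.piFinSuccAbove_symm_apply, Fin.insertNthEquiv,
            Fin.prod_univ_succ, Fin.insertNth_zero, Equiv.coe_fn_mk, Fin.cons_succ,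
            Fin.cons_zero]
          rfl
      _ = _ := by
          rw [lintegral_prod_mul (hf 0).aemeasurable hm.aemeasurable,
            ih fun i => hf i.succ, Fin.prod_univ_succ]

lemma pi_withDensity {Z : Type*} [MeasurableSpace Z] {n : ℕ} (μ : Measure Z) [SigmaFinite μ]
    {L : Z → ℝ≥0∞} (hL : Measurable L) [SigmaFinite (μ.withDensity L)] :
    Measure.pi (fun _ : Fin n => μ.withDensity L) =
      (Measure.pi fun _ : Fin n => μ).withDensity fun D => ∏ i, L (D i) := by
  refine Measure.pi_eq fun s hs => ?_
  rw [withDensity_apply _ (MeasurableSet.univ_pi hs), ← lintegral_indicator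
    (MeasurableSet.univ_pi hs)]
  have : (univ.pi s).indicator (fun D : Fin n → Z => ∏ i, L (D i)) =
      fun D => ∏ i, (s i).indicator L (D i) := by
    ext D
    by_cases h : D ∈ univ.pi s
    · rw [indicator_of_mem h]
      exact Finset.prod_congr rfl fun i _ => (indicator_of_mem (h i (mem_univ i)) _).symm
    · rw [indicator_of_notMem h]
      simp only [mem_univ_pi, not_forall] at h
      obtain ⟨i, hi⟩ := h
      exact (Finset.prod_eq_zero (Finset.mem_univ i) (indicator_of_notMem hi _)).symm
  rw [this, lintegral_pi_prod μ fun i => hL.indicator (hs i)]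
  refine Finset.prod_congr rfl fun i _ => ?_
  rw [lintegral_indicator (hs i), withDensity_apply _ (hs i)]

lemma ENNReal.le_one_add_quarter_sq (L : ℝ≥0∞) : L ≤ 1 + 4⁻¹ * L ^ 2 := by
  induction L with
  | top => simp
  | coe x =>
    have h4 : (4⁻¹ : ℝ≥0∞) = ((4⁻¹ : NNReal) : ℝ≥0∞) := by
      rw [ENNReal.coe_inv (by norm_num)]; norm_num
    rw [h4]
    norm_cast
    rw [← NNReal.coe_le_coe]
    push_cast
    nlinarith [sq_nonneg ((x : ℝ) / 2 - 1)]

/-- If the likelihood ratio of two laws has a second moment so close to `1` that its `n`-th power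
is at most `2`, then no test based on `n` independent observations has a sum of error
probabilities below `1/2`. This follows from `L ≤ 1 + L² / 4`. -/
lemma half_le_sum_errors {Z : Type*} [MeasurableSpace Z] {n : ℕ} {μ ν : Measure Z}
    [IsProbabilityMeasure μ] [IsProbabilityMeasure ν] {L : Z → ℝ≥0∞} (hL : Measurable L)
    (hν : ν = μ.withDensity L) (h2 : (∫⁻ z, L z ^ 2 ∂μ) ^ n ≤ 2) {B : Set (Fin n → Z)}
    (hB : MeasurableSet B) :
    1 / 2 ≤ Measure.pi (fun _ => μ) B + Measure.pi (fun _ => ν) Bᶜ := by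
  have : SigmaFinite (μ.withDensity L) := hν ▸ inferInstance
  have hm : Measurable fun D : Fin n → Z => ∏ i, L (D i) :=
    Finset.measurable_prod _ fun i _ => hL.comp (measurable_pi_apply i)
  have h3 : Measure.pi (fun _ => ν) B ≤ Measure.pi (fun _ => μ) B + 1 / 2 := by
    subst hν
    rw [pi_withDensity μ hL, withDensity_apply _ hB]
    calc ∫⁻ D in B, ∏ i, L (D i) ∂Measure.pi (fun _ => μ)
        ≤ ∫⁻ D in B, (1 + 4⁻¹ * (∏ i, L (D i)) ^ 2) ∂Measure.pi (fun _ => μ) :=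
          lintegral_mono fun D => ENNReal.le_one_add_quarter_sq _
      _ = Measure.pi (fun _ => μ) B +
            ∫⁻ D in B, 4⁻¹ * (∏ i, L (D i)) ^ 2 ∂Measure.pi (fun _ => μ) := by
          rw [lintegral_add_left measurable_const, setLIntegral_one]
      _ ≤ Measure.pi (fun _ => μ) B +
            ∫⁻ D, 4⁻¹ * (∏ i, L (D i)) ^ 2 ∂Measure.pi (fun _ => μ) := by
          exact add_le_add_right (setLIntegral_le_lintegral _ _) _
      _ ≤ Measure.pi (fun _ => μ) B + 1 / 2 := by
          gcongr
          rw [lintegral_const_mul _ (hm.pow_const 2)]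
          simp_rw [← Finset.prod_pow]
          rw [lintegral_pi_prod μ (f := fun _ z => L z ^ 2) fun _ => hL.pow_const 2,
            Finset.prod_const, Finset.card_univ, Fintype.card_fin]
          refine (mul_le_mul_right h2 _).trans (le_of_eq ?_)
          rw [show (4 : ℝ≥0∞) = 2 * 2 by norm_num, ENNReal.mul_inv (by simp) (by simp), mul_assoc,
            ENNReal.inv_mul_cancel (by simp) (by simp), mul_one, one_div]
  have h4 : Measure.pi (fun _ => ν) B + Measure.pi (fun _ => ν) Bᶜ = 1 := prob_add_prob_compl hB
  have h6 : 1 / 2 + 1 / 2 ≤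
      (Measure.pi (fun _ => μ) B + Measure.pi (fun _ => ν) Bᶜ) + 1 / 2 := by
    calc (1 / 2 + 1 / 2 : ℝ≥0∞) = 1 := ENNReal.add_halves 1
      _ = Measure.pi (fun _ => ν) B + Measure.pi (fun _ => ν) Bᶜ := h4.symm
      _ ≤ (Measure.pi (fun _ => μ) B + 1 / 2) + Measure.pi (fun _ => ν) Bᶜ := by gcongr
      _ = _ := add_right_comm _ _ _
  exact (ENNReal.add_le_add_iff_right (by simp)).1 h6

/-! ### Excess risk over a hypercube of distributions -/

section Assouad

variable {d n : ℕ}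

lemma fin_two_eq_or (c r : Fin 2) : c = r ∨ c = 1 - r := by
  fin_cases c <;> fin_cases r <;> simp

lemma one_sub_ne (c : Fin 2) : 1 - c ≠ c := by fin_cases c <;> simp

lemma jointLaw_ne {F : Fin 2 → E d → ℝ} (hF : IsSubdensity F) {C : E d → Fin 2}
    (hC : Measurable C) :
    jointLaw F {z | C z.1 ≠ z.2} = ∫⁻ x, ENNReal.ofReal (F (1 - C x) x) := by
  rw [jointLaw_apply hF (measurableSet_ne hC)]
  refine lintegral_congr fun x => ?_
  rcases fin_two_eq_or (C x) 0 with h | h <;> simp [indicator, h]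

/-- If, on each of finitely many disjoint cells, one label is better by the margin `w`, then the
excess error of a data-dependent classifier over the pointwise best classifier is at least `w`
times the integrated probability of choosing the other label. -/
lemma error_add_le_dataError {F : Fin 2 → E d → ℝ} (hF : IsSubdensity F) {κ : Type*} [Fintype κ]
    {A : κ → Set (E d)} (hA : ∀ k, MeasurableSet (A k))
    (hdisj : ∀ x k l, x ∈ A k → x ∈ A l → k = l) {w : ℝ} (hw0 : 0 ≤ w) (σ : κ → Fin 2)
    (hw : ∀ k, ∀ x ∈ A k, w + F (1 - σ k) x ≤ F (σ k) x) (C : DataClassifier d n) :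
    ∃ Cs : E d → Fin 2, Measurable Cs ∧ (hF.distr : Measure (E d × Fin 2)) {z | Cs z.1 ≠ z.2} +
      ∑ k, ENNReal.ofReal w * ∫⁻ x in A k,
        Measure.pi (fun _ : Fin n => (hF.distr : Measure (E d × Fin 2))) {D | C.1 (D, x) ≠ σ k} ≤
      ((Measure.pi fun _ : Fin n => (hF.distr : Measure (E d × Fin 2))).prod
        (hF.distr : Measure (E d × Fin 2))) {u | C.1 (u.1, u.2.1) ≠ u.2.2} := by
  classical
  have hprob := hF.isProbabilityMeasure
  set Pn := Measure.pi fun _ : Fin n => jointLaw F with hPn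
  -- the best classifier for known subdensities
  let Cs : E d → Fin 2 := fun x => if F 0 x ≤ F 1 x then 1 else 0
  have hCs : Measurable Cs := Measurable.ite
    (measurableSet_le (hF.continuous 0).measurable (hF.continuous 1).measurable)
    measurable_const measurable_const
  have hmin : ∀ x c, F (1 - Cs x) x ≤ F c x := by
    intro x c
    by_cases h : F 0 x ≤ F 1 x
    · have : Cs x = 1 := if_pos h
      rcases fin_two_eq_or c 0 with rfl | rfl <;> simp [this, h]
    · have : Cs x = 0 := if_neg h
      rcases fin_two_eq_or c 0 with rfl | rfl <;> simp [this, (not_le.1 h).le]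
  refine ⟨Cs, hCs, ?_⟩
  rw [hF.coe_distr, jointLaw_ne hF hCs, ← hPn]
  have hslice : ∀ D, Measurable fun x => C.1 (D, x) := fun D => C.2.comp measurable_prodMk_left
  have hbad : MeasurableSet {u : (Fin n → E d × Fin 2) × E d × Fin 2 | C.1 (u.1, u.2.1) ≠ u.2.2} :=
    (measurableSet_eq_fun (C.2.comp (by fun_prop)) (by fun_prop)).compl
  have hset : ∀ k, MeasurableSet {v : (Fin n → E d × Fin 2) × E d | C.1 v ≠ σ k} := fun k =>
    (measurableSet_eq_fun C.2 measurable_const).compl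
  have hmeas : ∀ k, Measurable fun x => Pn {D | C.1 (D, x) ≠ σ k} := fun k =>
    measurable_measure_prodMk_right (hset k)
  have hjoint : Measurable fun v : (Fin n → E d × Fin 2) × E d =>
      ENNReal.ofReal (F (1 - C.1 v) v.2) := by
    have h1 : Measurable fun w : E d × Fin 2 => ENNReal.ofReal (F (1 - w.2) w.1) :=
      measurable_uncurry_label (G := fun r x => ENNReal.ofReal (F (1 - r) x))
        fun r => hF.measurable_ofReal (1 - r)
    exact h1.comp (measurable_snd.prodMk C.2)
  rw [Measure.prod_apply hbad]
  have h1 : ∀ D, jointLaw F (Prod.mk D ⁻¹' {u | C.1 (u.1, u.2.1) ≠ u.2.2}) =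
      ∫⁻ x, ENNReal.ofReal (F (1 - C.1 (D, x)) x) := fun D => jointLaw_ne hF (hslice D)
  simp_rw [h1]
  -- integrate over the sample inside: then the inequality holds pointwise in the test point `x`
  rw [lintegral_lintegral_swap hjoint.aemeasurable]
  have h2 : ∀ k, ENNReal.ofReal w * ∫⁻ x in A k, Pn {D | C.1 (D, x) ≠ σ k} =
      ∫⁻ x, (A k).indicator (fun x => ENNReal.ofReal w * Pn {D | C.1 (D, x) ≠ σ k}) x := fun k => by
    rw [lintegral_indicator (hA k), lintegral_const_mul _ (hmeas k)]
  simp_rw [h2]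
  rw [← lintegral_finsetSum _ fun k _ => ((hmeas k).const_mul _).indicator (hA k),
    ← lintegral_add_right _ (Finset.measurable_sum _ fun k _ =>
      ((hmeas k).const_mul _).indicator (hA k))]
  refine lintegral_mono fun x => ?_
  have hx : ∀ D, ENNReal.ofReal (F (1 - Cs x) x) ≤ ENNReal.ofReal (F (1 - C.1 (D, x)) x) :=
    fun D => ENNReal.ofReal_le_ofReal (hmin x _)
  by_cases hcell : ∃ k, x ∈ A k
  · obtain ⟨k, hk⟩ := hcell
    rw [Finset.sum_eq_single k (fun l _ hl => indicator_of_notMem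
      (fun hxl => hl (hdisj x l k hxl hk)) _) (by simp), indicator_of_mem hk]
    have hsk : MeasurableSet {D | C.1 (D, x) ≠ σ k} :=
      (measurable_prodMk_right (y := x)) (hset k)
    calc ENNReal.ofReal (F (1 - Cs x) x) + ENNReal.ofReal w * Pn {D | C.1 (D, x) ≠ σ k}
        = ∫⁻ D, (ENNReal.ofReal (F (1 - Cs x) x) +
            {D | C.1 (D, x) ≠ σ k}.indicator (fun _ => ENNReal.ofReal w) D) ∂Pn := by
          rw [lintegral_add_left measurable_const, lintegral_const, measure_univ, mul_one,
            lintegral_indicator_const hsk]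
      _ ≤ ∫⁻ D, ENNReal.ofReal (F (1 - C.1 (D, x)) x) ∂Pn := by
          refine lintegral_mono fun D => ?_
          by_cases hD : C.1 (D, x) = σ k
          · rw [indicator_of_notMem (by simpa using hD), add_zero]
            exact hx D
          · rw [indicator_of_mem (show D ∈ {D | C.1 (D, x) ≠ σ k} from hD)]
            have hc : C.1 (D, x) = 1 - σ k := (fin_two_eq_or _ _).resolve_left hD
            rw [← ENNReal.ofReal_add (hF.nonneg _ _) hw0, hc, sub_sub_cancel]
            exact ENNReal.ofReal_le_ofReal (by linarith [hw k x hk, hmin x (1 - σ k)])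
  · push Not at hcell
    rw [Finset.sum_eq_zero fun k _ => indicator_of_notMem (hcell k) _, add_zero]
    calc ENNReal.ofReal (F (1 - Cs x) x) = ∫⁻ _, ENNReal.ofReal (F (1 - Cs x) x) ∂Pn := by
          rw [lintegral_const, measure_univ, mul_one]
      _ ≤ _ := lintegral_mono fun D => hx D

/-- Averaging over the hypercube: if flipping one coordinate of the parameter cannot be detected
reliably, then for some parameter the wrong labels are chosen on the cells with integrated
probability at least a quarter of their volume. -/
lemma exists_param_error {Z : Type*} [MeasurableSpace Z] {κ : Type*} [Fintype κ] [DecidableEq κ]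
    (Q : (κ → Fin 2) → Measure Z) (A : κ → Set (E d)) (T : E d → Z → Fin 2)
    (hT : ∀ σ k, Measurable fun x => Q σ {D | T x D ≠ σ k})
    (hQ : ∀ σ k x, 1 / 2 ≤ Q σ {D | T x D ≠ σ k} +
      Q (Function.update σ k (1 - σ k)) {D | T x D ≠ 1 - σ k}) :
    ∃ σ, 4⁻¹ * ∑ k, volume (A k) ≤ ∑ k, ∫⁻ x in A k, Q σ {D | T x D ≠ σ k} := by
  set a : (κ → Fin 2) → κ → ℝ≥0∞ := fun σ k => ∫⁻ x in A k, Q σ {D | T x D ≠ σ k} with ha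
  have hpair : ∀ σ k, volume (A k) / 2 ≤ a σ k + a (Function.update σ k (1 - σ k)) k := by
    intro σ k
    have hm := hT (Function.update σ k (1 - σ k)) k
    simp only [ha]
    simp only [Function.update_self] at hm ⊢
    rw [← lintegral_add_left (hT σ k)]
    calc volume (A k) / 2 = ∫⁻ _ in A k, 1 / 2 := by
          rw [setLIntegral_const, mul_comm, ← mul_div_assoc, mul_one]
      _ ≤ _ := lintegral_mono fun x => hQ σ k x
  have hinv : ∀ k, Function.Involutive fun σ : κ → Fin 2 => Function.update σ k (1 - σ k) := by
    intro k σ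
    ext l
    by_cases h : l = k
    · subst h; simp
    · simp [h]
  have hflip : ∀ k, ∑ σ, a (Function.update σ k (1 - σ k)) k = ∑ σ, a σ k := fun k =>
    Equiv.sum_comp (hinv k).toPerm fun σ => a σ k
  have hk : ∀ k, ∑ _σ : κ → Fin 2, 4⁻¹ * volume (A k) ≤ ∑ σ, a σ k := by
    intro k
    have h1 : ∑ _σ : κ → Fin 2, volume (A k) / 2 ≤ 2 * ∑ σ, a σ k := by
      calc ∑ _σ : κ → Fin 2, volume (A k) / 2
          ≤ ∑ σ, (a σ k + a (Function.update σ k (1 - σ k)) k) :=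
            Finset.sum_le_sum fun σ _ => hpair σ k
        _ = 2 * ∑ σ, a σ k := by rw [Finset.sum_add_distrib, hflip, two_mul]
    have h4 : (4⁻¹ : ℝ≥0∞) = 2⁻¹ * 2⁻¹ := by
      rw [show (4 : ℝ≥0∞) = 2 * 2 by norm_num, ENNReal.mul_inv (by simp) (by simp)]
    calc ∑ _σ : κ → Fin 2, 4⁻¹ * volume (A k) = 2⁻¹ * ∑ _σ : κ → Fin 2, volume (A k) / 2 := by
          rw [Finset.mul_sum]
          refine Finset.sum_congr rfl fun _ _ => ?_
          rw [h4, div_eq_mul_inv]; ring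
      _ ≤ 2⁻¹ * (2 * ∑ σ, a σ k) := by gcongr
      _ = ∑ σ, a σ k := by
          rw [← mul_assoc, ENNReal.inv_mul_cancel (by simp) (by simp), one_mul]
  have htot : ∑ _σ : κ → Fin 2, 4⁻¹ * ∑ k, volume (A k) ≤ ∑ σ, ∑ k, a σ k := by
    rw [Finset.sum_comm]
    refine le_trans (le_of_eq ?_) (Finset.sum_le_sum fun k _ => hk k)
    rw [Finset.sum_comm]
    simp_rw [Finset.mul_sum]
  by_contra! hlt
  exact absurd htot (not_le.2 (ENNReal.sum_lt_sum_of_nonempty Finset.univ_nonempty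
    fun σ _ => hlt σ))

lemma bddAbove_excess (K : Set (Distr d)) (C : DataClassifier d n) :
    BddAbove (range fun P : K => dataRisk P.1 C - risk P.1 (bayes P.1)) := by
  refine ⟨1, ?_⟩
  rintro _ ⟨P, rfl⟩
  have h1 : dataRisk P.1 C ≤ 1 := measureReal_le_one
  have h2 : 0 ≤ risk P.1 (bayes P.1) := measureReal_nonneg
  linarith

/-- Lower bound for the minimax excess risk from a hypercube of subdensities `F σ` in the class.
On the `k`-th cell the label `σ k` is better by `w`, and the likelihood ratio of two neighbours of
the hypercube has second moment so small that `n` observations do not tell them apart. -/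
theorem minimaxExcess_ge {κ : Type*} [Fintype κ] [DecidableEq κ] {K : Set (Distr d)}
    {F : (κ → Fin 2) → Fin 2 → E d → ℝ} (hF : ∀ σ, IsSubdensity (F σ))
    (hK : ∀ σ, (hF σ).distr ∈ K) {A : κ → Set (E d)} (hA : ∀ k, MeasurableSet (A k))
    (hfin : ∀ k, volume (A k) ≠ ∞)
    (hdisj : ∀ x k l, x ∈ A k → x ∈ A l → k = l) {w : ℝ} (hw0 : 0 ≤ w)
    (hw : ∀ σ k, ∀ x ∈ A k, w + F σ (1 - σ k) x ≤ F σ (σ k) x)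
    (hL : ∀ σ k, ∃ L : E d × Fin 2 → ℝ≥0∞, Measurable L ∧
      jointLaw (F (Function.update σ k (1 - σ k))) = (jointLaw (F σ)).withDensity L ∧
      (∫⁻ z, L z ^ 2 ∂jointLaw (F σ)) ^ n ≤ 2) :
    w / 4 * ∑ k, volume.real (A k) ≤ minimaxExcess d n K := by
  have : Nonempty (DataClassifier d n) := ⟨⟨fun _ => 0, measurable_const⟩⟩
  refine le_ciInf fun C => ?_
  have hprob := fun σ => (hF σ).isProbabilityMeasure
  have hset : ∀ r : Fin 2, MeasurableSet {v : (Fin n → E d × Fin 2) × E d | C.1 v ≠ r} := fun k =>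
    (measurableSet_eq_fun C.2 measurable_const).compl
  have hslice : ∀ (r : Fin 2) x, MeasurableSet {D | C.1 (D, x) ≠ r} := fun r x =>
    (measurable_prodMk_right (y := x)) (hset r)
  obtain ⟨σ, hσ⟩ := exists_param_error (fun σ => Measure.pi fun _ : Fin n => jointLaw (F σ)) A
    (fun x D => C.1 (D, x)) (fun σ k => measurable_measure_prodMk_right (hset (σ k)))
    (fun σ k x => by
      obtain ⟨L, hLm, hLd, hL2⟩ := hL σ k
      have h := half_le_sum_errors hLm hLd hL2 (hslice (σ k) x)
      refine h.trans (le_of_eq ?_)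
      congr 2
      ext D
      simp only [mem_compl_iff, mem_ofPred_eq, not_not]
      rcases fin_two_eq_or (C.1 (D, x)) (σ k) with h | h <;> rw [h]
      · simpa using (one_sub_ne (σ k)).symm
      · simpa using one_sub_ne (σ k))
  refine le_trans ?_ (le_ciSup (bddAbove_excess K C) ⟨_, hK σ⟩)
  obtain ⟨Cs, hCs, hle⟩ := error_add_le_dataError (hF σ) hA hdisj hw0 σ (hw σ) C
  have hbayes := measure_bayes_ne_le (hF σ).distr hCs
  set P : Measure (E d × Fin 2) := ((hF σ).distr : Measure (E d × Fin 2)) with hP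
  have h1 : P {z | bayes (hF σ).distr z.1 ≠ z.2} +
      ENNReal.ofReal w * (4⁻¹ * ∑ k, volume (A k)) ≤
      ((Measure.pi fun _ : Fin n => P).prod P) {u | C.1 (u.1, u.2.1) ≠ u.2.2} := by
    refine le_trans (add_le_add hbayes ?_) hle
    rw [← Finset.mul_sum]
    exact mul_le_mul_right hσ _
  have h2 := ENNReal.toReal_mono (measure_ne_top _ _) h1
  have hsumfin : ∑ k, volume (A k) ≠ ∞ := ENNReal.sum_ne_top.2 fun k _ => hfin k
  rw [ENNReal.toReal_add (measure_ne_top _ _) (ENNReal.mul_ne_top (by simp)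
    (ENNReal.mul_ne_top (by simp) hsumfin)), ENNReal.toReal_mul, ENNReal.toReal_mul,
    ENNReal.toReal_ofReal hw0, ENNReal.toReal_sum fun k _ => hfin k] at h2
  simp only [ENNReal.toReal_inv, ENNReal.toReal_ofNat] at h2
  change (P.real {z | bayes (hF σ).distr z.1 ≠ z.2} +
    w * (4⁻¹ * ∑ k, volume.real (A k)) ≤ dataRisk (hF σ).distr C) at h2
  change _ ≤ dataRisk (hF σ).distr C - P.real {z | bayes (hF σ).distr z.1 ≠ z.2}
  linarith

end Assouad

/-! ### Separated points on the sphere and the cells around them -/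

lemma exists_maximal_separated {X : Type*} [MetricSpace X] {S : Set X} (hS : IsCompact S) {a : ℝ}
    (ha : 0 < a) : ∃ Y : Finset X, (↑Y ⊆ S) ∧ (∀ x ∈ Y, ∀ y ∈ Y, x ≠ y → a < dist x y) ∧
      ∀ x ∈ S, ∃ y ∈ Y, dist x y ≤ a := by
  lift a to NNReal using ha.le
  have ha' : a ≠ 0 := by rintro rfl; simp at ha
  obtain ⟨N, hNS, hN, hcov⟩ := Metric.exists_finite_isCover_of_isCompact
    (ε := a / 2) (by positivity) hS
  have hfin : Metric.packingNumber a S ≠ ⊤ := by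
    have h1 := Metric.packingNumber_two_mul_le_externalCoveringNumber (a / 2) S
    rw [mul_div_cancel₀ _ (two_ne_zero)] at h1
    have h2 := hcov.externalCoveringNumber_le_encard
    exact ((h1.trans h2).trans_lt hN.encard_lt_top).ne
  have hYfin : (Metric.maximalSeparatedSet a S).Finite := by
    rw [← encard_ne_top_iff, Metric.encard_maximalSeparatedSet hfin]
    exact hfin
  refine ⟨hYfin.toFinset, ?_, ?_, ?_⟩
  · simpa using Metric.maximalSeparatedSet_subset
  · intro x hx y hy hxy
    have := Metric.isSeparated_maximalSeparatedSet (ε := a) (A := S) (by simpa using hx)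
      (by simpa using hy) hxy
    simp only [edist_nndist] at this
    exact_mod_cast this
  · intro x hx
    obtain ⟨y, hy, hxy⟩ := Metric.isCover_maximalSeparatedSet hfin hx
    refine ⟨y, by simpa using hy, ?_⟩
    have hxy' : edist x y ≤ a := hxy
    rw [edist_nndist] at hxy'
    exact_mod_cast hxy'

section Cells

variable {d : ℕ}

/-- The part near `y` of the shell in which `‖x‖²` differs from `1/2` by at most `h / 2`. -/
def cell (a h : ℝ) (y : E d) : Set (E d) :=
  {x | ‖x - y‖ ^ 2 ≤ 3 / 4 * a ^ 2 ∧ |‖x‖ ^ 2 - 1 / 2| ≤ h / 2}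

lemma isClosed_cell (a h : ℝ) (y : E d) : IsClosed (cell a h y) := by
  have h1 : IsClosed {x : E d | ‖x - y‖ ^ 2 ≤ 3 / 4 * a ^ 2} :=
    isClosed_le (by fun_prop) continuous_const
  have h2 : IsClosed {x : E d | |‖x‖ ^ 2 - 1 / 2| ≤ h / 2} :=
    isClosed_le (by fun_prop) continuous_const
  exact h1.inter h2

lemma cell_subset {a h : ℝ} (ha : 0 < a) (y : E d) : cell a h y ⊆ Metric.ball y a := by
  intro x hx
  rw [mem_ball_iff_norm]
  nlinarith [hx.1, norm_nonneg (x - y)]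

lemma volume_cell_ne_top {a h : ℝ} (ha : 0 < a) (y : E d) : volume (cell a h y) ≠ ∞ :=
  measure_ne_top_of_subset (cell_subset ha y) measure_ball_lt_top.ne

/-- The ball of radius `a / 4` around a point of the sphere is covered by about `a / h` radial
translates of the cell, which bounds the volume of the cell from below. -/
lemma volume_ball_le_cell {a h : ℝ} (ha : 0 < a) (ha1 : a ≤ 1 / 100) (hh : 0 < h)
    (hha : h ≤ a / 10) {y : E d} (hy : ‖y‖ ^ 2 = 1 / 2) :
    volume.real (Metric.ball y (a / 4)) ≤ 3 * (a / h) * volume.real (cell a h y) := by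
  obtain ⟨u, hu, hyu⟩ : ∃ u : E d, ‖u‖ = 1 ∧ y = ‖y‖ • u := by
    have hy0 : ‖y‖ ≠ 0 := by rintro h; norm_num [h] at hy
    exact ⟨‖y‖⁻¹ • y, by rw [norm_smul, norm_inv, norm_norm, inv_mul_cancel₀ hy0],
      by rw [smul_smul, mul_inv_cancel₀ hy0, one_smul]⟩
  have hylo : 0.7 < ‖y‖ := by nlinarith [norm_nonneg y]
  have hyhi : ‖y‖ < 0.71 := by nlinarith [norm_nonneg y]
  set m : ℕ := ⌈a / h⌉₊ + 1 with hm
  set T : Finset ℤ := Finset.Icc (-(m : ℤ)) m with hT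
  have hcover : Metric.ball y (a / 4) ⊆
      ⋃ j ∈ T, (fun x => x + (j * (h / 2) : ℝ) • u) ⁻¹' cell a h y := by
    intro x hx
    rw [mem_ball_iff_norm] at hx
    set b : ℝ := inner ℝ x u with hb
    have hQ : ∀ s : ℝ, ‖x + s • u‖ ^ 2 = ‖x‖ ^ 2 + 2 * s * b + s ^ 2 := by
      intro s
      rw [norm_add_sq_real, inner_smul_right, norm_smul, hu, mul_one, Real.norm_eq_abs, sq_abs]
      ring
    have hyb : inner ℝ y u = ‖y‖ := by
      nth_rewrite 1 [hyu]
      rw [real_inner_smul_left, real_inner_self_eq_norm_sq, hu]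
      norm_num
    have hb1 : |b - ‖y‖| ≤ a / 4 := by
      rw [← hyb, hb, ← inner_sub_left]
      refine (abs_real_inner_le_norm _ _).trans ?_
      rw [hu, mul_one]
      exact hx.le
    have hx1 : |‖x‖ - ‖y‖| ≤ a / 4 := (abs_norm_sub_norm_le x y).trans hx.le
    rw [abs_le] at hb1 hx1
    have hsq : ‖x‖ ^ 2 - 1 / 2 = (‖x‖ - ‖y‖) * (‖x‖ + ‖y‖) := by rw [← hy]; ring
    have hsum : 0 ≤ ‖x‖ + ‖y‖ := by positivity
    obtain ⟨s, hs, hsQ⟩ : ∃ s ∈ Icc (-(a / 2)) (a / 2), ‖x + s • u‖ ^ 2 = 1 / 2 := by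
      refine intermediate_value_Icc (f := fun s : ℝ => ‖x + s • u‖ ^ 2) (by linarith)
        (by fun_prop) ⟨?_, ?_⟩
      · simp only [hQ]
        nlinarith
      · simp only [hQ]
        nlinarith
    set j : ℤ := round (s / (h / 2)) with hj
    have hround := abs_sub_round (s / (h / 2))
    have hδ : |(j * (h / 2) : ℝ) - s| ≤ h / 4 := by
      have : (j * (h / 2) : ℝ) - s = -((s / (h / 2) - j) * (h / 2)) := by field_simp; ring
      rw [this, abs_neg, abs_mul, abs_of_pos (by positivity : 0 < h / 2)]
      calc |s / (h / 2) - j| * (h / 2) ≤ 1 / 2 * (h / 2) := by gcongr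
        _ = h / 4 := by ring
    set t : ℝ := (j * (h / 2) : ℝ) with ht
    have hδ' := abs_le.1 hδ
    have htabs : |t| ≤ a / 2 + h / 4 := by
      rw [abs_le]; constructor <;> linarith [hs.1, hs.2]
    simp only [mem_iUnion, mem_preimage]
    refine ⟨j, ?_, ?_, ?_⟩
    · have h1 : |(j : ℝ)| ≤ a / h + 1 / 2 := by
        have : |(j : ℝ)| * (h / 2) ≤ a / 2 + h / 4 := by
          rw [ht, abs_mul, abs_of_pos (by positivity : 0 < h / 2)] at htabs
          exact htabs
        rw [← le_div_iff₀ (by positivity)] at this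
        refine this.trans (le_of_eq ?_)
        field_simp
        ring
      have h2 : |(j : ℝ)| ≤ m := by
        rw [hm]
        push_cast
        linarith [Nat.le_ceil (a / h)]
      rw [hT, Finset.mem_Icc, ← abs_le]
      exact_mod_cast h2
    · have : ‖x + t • u - y‖ ≤ 0.8 * a := by
        calc ‖x + t • u - y‖ = ‖(x - y) + t • u‖ := by congr 1; abel
          _ ≤ ‖x - y‖ + |t| := by
            refine (norm_add_le _ _).trans ?_
            rw [norm_smul, hu, mul_one, Real.norm_eq_abs]
          _ ≤ 0.8 * a := by linarith
      nlinarith [norm_nonneg (x + t • u - y)]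
    · have : ‖x + t • u‖ ^ 2 - 1 / 2 = (t - s) * (2 * b + t + s) := by
        rw [← hsQ, hQ, hQ]; ring
      rw [this, abs_mul]
      have h1 : |2 * b + t + s| ≤ 2 := by
        have := abs_le.1 htabs
        rw [abs_le]; constructor <;> linarith [hs.1, hs.2]
      calc |t - s| * |2 * b + t + s| ≤ h / 4 * 2 := by gcongr
        _ = h / 2 := by ring
  have hvol : volume (Metric.ball y (a / 4)) ≤ T.card * volume (cell a h y) := by
    calc volume (Metric.ball y (a / 4))
        ≤ ∑ j ∈ T, volume ((fun x => x + (j * (h / 2) : ℝ) • u) ⁻¹' cell a h y) :=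
          (measure_mono hcover).trans (measure_biUnion_finset_le _ _)
      _ = T.card * volume (cell a h y) := by
          simp_rw [measure_preimage_add_right]
          rw [Finset.sum_const, nsmul_eq_mul]
  have hcard : (T.card : ℝ) ≤ 3 * (a / h) := by
    have h10 : 10 ≤ a / h := by rw [le_div_iff₀ hh]; linarith
    have : (T.card : ℝ) = 2 * m + 1 := by
      rw [hT, Int.card_Icc]
      have : ((m : ℤ) + 1 - -(m : ℤ)).toNat = 2 * m + 1 := by omega
      rw [this]; push_cast; ring
    rw [this, hm]
    push_cast
    linarith [Nat.ceil_lt_add_one (by positivity : 0 ≤ a / h)]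
  have h2 := ENNReal.toReal_mono
    (ENNReal.mul_ne_top (by simp) (volume_cell_ne_top (h := h) ha y)) hvol
  rw [ENNReal.toReal_mul, ENNReal.toReal_natCast] at h2
  refine h2.trans ?_
  gcongr
  exact le_rfl

/-- A maximal `2a`-separated subset of the sphere has so many points that the cells around them
have total volume of the order of the volume of the whole shell. -/
lemma exists_separated_cells (hd : 1 ≤ d) {a h : ℝ} (ha : 0 < a) (ha1 : a ≤ 1 / 100) (hh : 0 < h)
    (hha : h ≤ a / 10) : ∃ Y : Finset (E d), (∀ y ∈ Y, ‖y‖ ^ 2 = 1 / 2) ∧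
      (∀ x ∈ Y, ∀ y ∈ Y, x ≠ y → 2 * a < ‖x - y‖) ∧
      volume.real (Metric.ball (0 : E d) 1) / (3 * 32 ^ d) * h ≤
        ∑ y ∈ Y, volume.real (cell a h y) := by
  have : Nonempty (Fin d) := ⟨⟨0, hd⟩⟩
  set R : ℝ := √(1 / 2) with hR
  have hR2 : R ^ 2 = 1 / 2 := Real.sq_sqrt (by norm_num)
  have hR0 : 0 < R := Real.sqrt_pos.2 (by norm_num)
  have hRlo : 1 / 2 ≤ R := by nlinarith
  have hRhi : R ≤ 1 := by nlinarith
  set ω := volume.real (Metric.ball (0 : E d) 1) with hω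
  have hω0 : 0 ≤ ω := measureReal_nonneg
  obtain ⟨Y, hYS, hYsep, hYcov⟩ := exists_maximal_separated
    (isCompact_sphere (0 : E d) R) (a := 2 * a) (by positivity)
  have hYn : ∀ y ∈ Y, ‖y‖ ^ 2 = 1 / 2 := fun y hy => by
    have := hYS hy
    rw [mem_sphere_zero_iff_norm] at this
    rw [this, hR2]
  refine ⟨Y, hYn, fun x hx y hy hxy => by simpa [dist_eq_norm] using hYsep x hx y hy hxy, ?_⟩
  have hball : ∀ (x : E d) (r : ℝ), 0 < r → volume.real (Metric.ball x r) = r ^ d * ω := by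
    intro x r hr
    rw [Measure.real, Measure.addHaar_ball_of_pos _ _ hr, ENNReal.toReal_mul,
      ENNReal.toReal_ofReal (by positivity), finrank_euclideanSpace, Fintype.card_fin]
    rfl
  -- the balls of radius `4a` cover the outer shell of width `a`, which counts the points from below
  have hshell : Metric.ball (0 : E d) (R + a) ⊆
      Metric.ball 0 R ∪ ⋃ y ∈ Y, Metric.ball y (4 * a) := by
    intro x hx
    rw [mem_ball_zero_iff] at hx
    rcases lt_or_ge ‖x‖ R with h | h
    · exact Or.inl (by simpa using h)
    · right
      have hx0 : ‖x‖ ≠ 0 := by linarith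
      obtain ⟨y, hy, hxy⟩ := hYcov ((R / ‖x‖) • x) (by
        rw [mem_sphere_zero_iff_norm, norm_smul, Real.norm_of_nonneg (by positivity),
          div_mul_cancel₀ _ hx0])
      simp only [mem_iUnion]
      refine ⟨y, hy, ?_⟩
      rw [Metric.mem_ball]
      have h1 : dist x ((R / ‖x‖) • x) = ‖x‖ - R := by
        have : x - (R / ‖x‖) • x = (1 - R / ‖x‖) • x := by rw [sub_smul, one_smul]
        rw [dist_eq_norm, this, norm_smul, Real.norm_of_nonneg]
        · field_simp
        · rw [sub_nonneg, div_le_one (by linarith)]; exact h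
      linarith [dist_triangle x ((R / ‖x‖) • x) y]
  have h1 : (R + a) ^ d * ω ≤ R ^ d * ω + Y.card * ((4 * a) ^ d * ω) := by
    rw [← hball 0 R hR0, ← hball 0 (R + a) (by positivity)]
    have hbound : volume.real (⋃ y ∈ Y, Metric.ball y (4 * a)) ≤ Y.card * ((4 * a) ^ d * ω) := by
      refine (measureReal_biUnion_finset_le _ _).trans (le_of_eq ?_)
      rw [Finset.sum_congr rfl fun y _ => hball y (4 * a) (by positivity), Finset.sum_const,
        nsmul_eq_mul]
    have hfin : volume (Metric.ball (0 : E d) R ∪ ⋃ y ∈ Y, Metric.ball y (4 * a)) ≠ ∞ := by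
      refine ((measure_union_le _ _).trans_lt (ENNReal.add_lt_top.2 ⟨measure_ball_lt_top, ?_⟩)).ne
      refine (measure_biUnion_finset_le _ _).trans_lt ?_
      exact ENNReal.sum_lt_top.2 fun y _ => measure_ball_lt_top
    exact (measureReal_mono hshell hfin).trans ((measureReal_union_le _ _).trans (by gcongr))
  have h2 : R ^ d + R ^ d * a ≤ (R + a) ^ d := by
    have hb := one_add_mul_le_pow (a := a / R) (by have : 0 < a / R := by positivity
                                                   linarith) d
    have h3 : (R + a) ^ d = R ^ d * (1 + a / R) ^ d := by
      rw [← mul_pow]; congr 1; field_simp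
    have h4 : a ≤ d * (a / R) := by
      have hd' : (1 : ℝ) ≤ d := by exact_mod_cast hd
      have : a ≤ a / R := by rw [le_div_iff₀ hR0]; nlinarith
      nlinarith [div_pos ha hR0]
    rw [h3]
    have := pow_pos hR0 d
    nlinarith
  have h5 : (1 / 2) ^ d * a * ω ≤ Y.card * ((4 * a) ^ d * ω) := by
    have h6 : (1 / 2 : ℝ) ^ d ≤ R ^ d := by gcongr
    have h7 := mul_le_mul_of_nonneg_right h2 hω0
    have h8 := mul_le_mul_of_nonneg_right (mul_le_mul_of_nonneg_right h6 ha.le) hω0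
    linarith
  have h6 : (Y.card : ℝ) * ((a / 4) ^ d * ω) ≤
      3 * (a / h) * ∑ y ∈ Y, volume.real (cell a h y) := by
    rw [Finset.mul_sum, ← nsmul_eq_mul, ← Finset.sum_const]
    refine Finset.sum_le_sum fun y hy => ?_
    rw [← hball y (a / 4) (by positivity)]
    exact volume_ball_le_cell ha ha1 hh hha (hYn y hy)
  have h7 : (Y.card : ℝ) * ((a / 4) ^ d * ω) = (1 / 16) ^ d * (Y.card * ((4 * a) ^ d * ω)) := by
    have : (a / 4) ^ d = (1 / 16) ^ d * (4 * a) ^ d := by rw [← mul_pow]; congr 1; ring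
    rw [this]; ring
  have h8 : (1 / 16 : ℝ) ^ d * ((1 / 2) ^ d * a * ω) ≤
      3 * (a / h) * ∑ y ∈ Y, volume.real (cell a h y) :=
    (mul_le_mul_of_nonneg_left h5 (by positivity)).trans (h7 ▸ h6)
  have h9 : (1 / 16 : ℝ) ^ d * (1 / 2) ^ d = 1 / 32 ^ d := by
    rw [← mul_pow, ← one_div_pow]; norm_num
  calc ω / (3 * 32 ^ d) * h = (h / (3 * a)) * ((1 / 16 : ℝ) ^ d * ((1 / 2) ^ d * a * ω)) := by
        rw [← mul_assoc ((1 / 16 : ℝ) ^ d), ← mul_assoc ((1 / 16 : ℝ) ^ d), h9]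
        field_simp
    _ ≤ (h / (3 * a)) * (3 * (a / h) * ∑ y ∈ Y, volume.real (cell a h y)) := by gcongr
    _ = _ := by field_simp

end Cells

/-! ### The surface measure of a perturbed sphere -/

section Surface

open Submodule

/-- A part of a perturbed sphere that faces a unit vector `e` is mapped by the orthogonal projection
along `e` to a unit ball, and distances shrink by a bounded factor only. -/
lemma euclideanHausdorffMeasure_cap_le {H : Type*} [NormedAddCommGroup H] [InnerProductSpace ℝ H]
    [MeasurableSpace H] [BorelSpace H] [FiniteDimensional ℝ H]
    {e z : H} (he : ‖e‖ = 1) {p : H → ℝ} {θ : ℝ} (hθ0 : 0 < θ) (hθ1 : θ ≤ 1)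
    (hp : ∀ x y, |p y - p x| ≤ θ * ‖y - x‖) {S : Set H}
    (hS : ∀ x ∈ S, ‖x - z‖ ^ 2 + p x = 1 / 2 ∧ ‖x - z‖ ≤ 1 ∧ θ ≤ inner ℝ (x - z) e) (m : ℕ) :
    μHE[m] S ≤ ENNReal.ofReal (3 / θ + 1) ^ m *
      μHE[m] (Metric.closedBall (0 : (ℝ ∙ e)ᗮ) 1) := by
  set f : S → (ℝ ∙ e)ᗮ := fun x => (ℝ ∙ e)ᗮ.orthogonalProjectionOnto (x.1 - z) with hf
  have hdecomp : ∀ v : H, v = (inner ℝ e v : ℝ) • e + (ℝ ∙ e)ᗮ.starProjection v := fun v => by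
    have := (ℝ ∙ e).starProjection_add_starProjection_orthogonal v
    rw [starProjection_unit_singleton ℝ he] at this
    exact this.symm
  have hanti : AntilipschitzWith (Real.toNNReal (3 / θ + 1)) f := by
    refine AntilipschitzWith.of_le_mul_dist fun x y => ?_
    rw [Real.coe_toNNReal _ (by positivity), dist_comm, dist_comm (f x), Subtype.dist_eq,
      dist_eq_norm, dist_eq_norm]
    obtain ⟨hx1, hx2, hx3⟩ := hS x.1 x.2
    obtain ⟨hy1, hy2, hy3⟩ := hS y.1 y.2
    set X := x.1 - z
    set Y := y.1 - z
    -- the component `c` of a chord along `e` is controlled by its orthogonal component `w`, because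
    -- `‖· - z‖² + p` takes the same value at both ends
    set w : H := (ℝ ∙ e)ᗮ.starProjection (y.1 - x.1) with hw
    set c : ℝ := inner ℝ e (y.1 - x.1) with hc
    have hv : y.1 - x.1 = c • e + w := hdecomp _
    have hfw : ‖f y - f x‖ = ‖w‖ := by
      have : f y - f x = (ℝ ∙ e)ᗮ.orthogonalProjectionOnto (y.1 - x.1) := by
        rw [hf, ← map_sub]
        congr 1
        exact sub_sub_sub_cancel_right _ _ _
      rw [this]
      rfl
    have hvn : ‖y.1 - x.1‖ ≤ |c| + ‖w‖ := by
      rw [hv]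
      refine (norm_add_le _ _).trans ?_
      rw [norm_smul, he, mul_one, Real.norm_eq_abs]
    have hid : ‖Y‖ ^ 2 - ‖X‖ ^ 2 = c * (inner ℝ X e + inner ℝ Y e) + inner ℝ w (X + Y) := by
      have h1 : Y - X = c • e + w := by rw [← hv]; exact sub_sub_sub_cancel_right _ _ _
      have h2 : (inner ℝ (Y - X) (X + Y) : ℝ) = ‖Y‖ ^ 2 - ‖X‖ ^ 2 := by
        rw [inner_sub_left, inner_add_right, inner_add_right, real_inner_self_eq_norm_sq,
          real_inner_self_eq_norm_sq, real_inner_comm X Y]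
        ring
      rw [← h2, h1, inner_add_left, real_inner_smul_left, inner_add_right, real_inner_comm X e,
        real_inner_comm Y e]
    have hw2 : |(inner ℝ w (X + Y) : ℝ)| ≤ 2 * ‖w‖ := by
      refine (abs_real_inner_le_norm _ _).trans ?_
      have := norm_add_le X Y
      nlinarith [norm_nonneg w]
    have hpxy := hp x.1 y.1
    have hkey : |c| * (2 * θ) ≤ 2 * ‖w‖ + θ * (|c| + ‖w‖) := by
      calc |c| * (2 * θ) ≤ |c| * (inner ℝ X e + inner ℝ Y e) := by gcongr; linarith
        _ = |c * (inner ℝ X e + inner ℝ Y e)| := by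
          rw [abs_mul, abs_of_nonneg (by linarith : (0 : ℝ) ≤ inner ℝ X e + inner ℝ Y e)]
        _ = |-(p y - p x) - inner ℝ w (X + Y)| := by congr 1; linarith
        _ ≤ |p y - p x| + |(inner ℝ w (X + Y) : ℝ)| := by
          refine (abs_sub _ _).trans ?_
          rw [abs_neg]
        _ ≤ θ * ‖y.1 - x.1‖ + 2 * ‖w‖ := add_le_add hpxy hw2
        _ ≤ 2 * ‖w‖ + θ * (|c| + ‖w‖) := by
          have := mul_le_mul_of_nonneg_left hvn hθ0.le
          linarith
    rw [hfw]
    have hcw : |c| ≤ 3 / θ * ‖w‖ := by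
      rw [div_mul_eq_mul_div, le_div_iff₀ hθ0]
      nlinarith [norm_nonneg w]
    linarith
  have himage : f '' univ ⊆ Metric.closedBall (0 : (ℝ ∙ e)ᗮ) 1 := by
    rintro _ ⟨x, -, rfl⟩
    rw [mem_closedBall_zero_iff]
    exact ((ℝ ∙ e)ᗮ.norm_orthogonalProjectionOnto_apply_le _).trans (hS x.1 x.2).2.1
  have h1 : μHE[m] S = μHE[m] (univ : Set S) := by
    have hiso : Isometry (Subtype.val : S → H) := isometry_subtype_coe
    rw [← hiso.euclideanHausdorffMeasure_image, image_univ, Subtype.range_coe]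
  rw [h1, Measure.euclideanHausdorffMeasure_def, Measure.euclideanHausdorffMeasure_def,
    Measure.smul_apply, Measure.smul_apply, mul_smul_comm]
  gcongr
  have h2 := hanti.le_hausdorffMeasure_image (Nat.cast_nonneg m) univ
  rw [ENNReal.rpow_natCast] at h2
  exact h2.trans (by gcongr; rfl)

/-- The surface measure of a small perturbation of a sphere is bounded by a constant that depends
only on the dimension. -/
lemma exists_surface_bound {d : ℕ} (hd : 1 ≤ d) : ∃ c : ℝ, 0 < c ∧ ∀ (z : E d) (p : E d → ℝ)
    (S : Set (E d)), (∀ x y, |p y - p x| ≤ 1 / (2 * d) * ‖y - x‖) →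
      (∀ x ∈ S, ‖x - z‖ ^ 2 + p x = 1 / 2 ∧ 9 / 20 ≤ ‖x - z‖ ^ 2 ∧ ‖x - z‖ ≤ 1) →
      μHE[d - 1] S ≤ ENNReal.ofReal c := by
  set θ : ℝ := 1 / (2 * d) with hθ
  have hd0 : (1 : ℝ) ≤ d := by exact_mod_cast hd
  have hθ0 : 0 < θ := by positivity
  have hθ1 : θ ≤ 1 := by rw [hθ, div_le_one (by positivity)]; linarith
  let e : Fin d × Bool → E d := fun ib =>
    (if ib.2 then (1 : ℝ) else -1) • EuclideanSpace.single ib.1 (1 : ℝ)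
  have he : ∀ ib, ‖e ib‖ = 1 := by
    rintro ⟨i, b⟩
    cases b <;> simp [e]
  set Ctot : ℝ≥0∞ := ∑ ib, ENNReal.ofReal (3 / θ + 1) ^ (d - 1) *
    μHE[d - 1] (Metric.closedBall (0 : (ℝ ∙ e ib)ᗮ) 1) with hCtot
  have hfin : Ctot ≠ ∞ := by
    refine ENNReal.sum_ne_top.2 fun ib _ => ENNReal.mul_ne_top (by simp) ?_
    have hrank : Module.finrank ℝ (ℝ ∙ e ib)ᗮ = d - 1 := by
      obtain ⟨m, rfl⟩ : ∃ m, d = m + 1 := ⟨d - 1, by omega⟩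
      have : Fact (Module.finrank ℝ (E (m + 1)) = m + 1) := ⟨by simp⟩
      rw [finrank_orthogonal_span_singleton (n := m) (by
        intro h0; have := he ib; rw [h0, norm_zero] at this; norm_num at this)]
      simp
    rw [← hrank]
    exact (isCompact_closedBall _ _).measure_lt_top.ne
  refine ⟨Ctot.toReal + 1, by positivity, fun z p S hp hS => ?_⟩
  -- a point of `S` is far from the centre, so one coordinate is at least `θ` in absolute value
  have hcover : S ⊆ ⋃ ib, {x ∈ S | θ ≤ inner ℝ (x - z) (e ib)} := by
    intro x hx
    by_contra hcon
    simp only [mem_iUnion, not_exists] at hcon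
    have hsmall : ∀ i, (x - z) i ^ 2 ≤ θ ^ 2 := by
      intro i
      have h1 : ¬ θ ≤ inner ℝ (x - z) (e (i, true)) := fun h => hcon (i, true) ⟨hx, h⟩
      have h2 : ¬ θ ≤ inner ℝ (x - z) (e (i, false)) := fun h => hcon (i, false) ⟨hx, h⟩
      simp only [e, inner_smul_right, EuclideanSpace.inner_single_right] at h1 h2
      simp at h1 h2
      refine sq_le_sq' ?_ ?_ <;> simp <;> linarith
    have h3 : ‖x - z‖ ^ 2 ≤ d * θ ^ 2 := by
      rw [EuclideanSpace.norm_sq_eq]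
      calc ∑ i, ‖(x - z) i‖ ^ 2 ≤ ∑ _i : Fin d, θ ^ 2 :=
            Finset.sum_le_sum fun i _ => by simpa using hsmall i
        _ = d * θ ^ 2 := by simp
    have h4 : (d : ℝ) * θ ^ 2 ≤ 1 / 4 := by
      have : (d : ℝ) * θ = 1 / 2 := by rw [hθ]; field_simp
      have h5 : θ ≤ 1 / 2 := by rw [hθ]; gcongr; linarith
      nlinarith
    linarith [(hS x hx).2.1]
  calc μHE[d - 1] S ≤ ∑ ib, μHE[d - 1] {x ∈ S | θ ≤ inner ℝ (x - z) (e ib)} :=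
        (measure_mono hcover).trans (measure_iUnion_fintype_le _ _)
    _ ≤ Ctot := Finset.sum_le_sum fun ib _ => euclideanHausdorffMeasure_cap_le (he ib) hθ0 hθ1 hp
        (fun x hx => ⟨(hS x hx.1).1, (hS x hx.1).2.2, hx.2⟩) (d - 1)
    _ ≤ ENNReal.ofReal (Ctot.toReal + 1) :=
        (ENNReal.le_ofReal_iff_toReal_le hfin (by positivity)).2 (by linarith)

end Surface

/-! ### The regression function near a perturbed sphere -/

section Quadratic

variable {H : Type*} [NormedAddCommGroup H] [InnerProductSpace ℝ H] {p : H → ℝ} {c : H}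

lemma hasFDerivAt_norm_sub_sq_add (hp : Differentiable ℝ p) (x : H) :
    HasFDerivAt (fun x => ‖x - c‖ ^ 2 + p x)
      ((2 : ℝ) • innerSL ℝ (x - c) + fderiv ℝ p x) x := by
  have h1 : HasFDerivAt (fun x : H => ‖x - c‖ ^ 2) ((2 : ℝ) • innerSL ℝ (x - c)) x := by
    have := ((hasFDerivAt_id x).sub_const c).norm_sq
    simpa [ContinuousLinearMap.comp_id, two_smul] using this
  exact h1.add (hp x).hasFDerivAt

lemma fderiv_norm_sub_sq_add (hp : Differentiable ℝ p) :
    fderiv ℝ (fun x => ‖x - c‖ ^ 2 + p x) =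
      fun x => (2 : ℝ) • innerSL ℝ (x - c) + fderiv ℝ p x :=
  funext fun x => (hasFDerivAt_norm_sub_sq_add hp x).fderiv

/-- The inner product of a real inner product space as a bilinear map. -/
def innerMap (H : Type*) [NormedAddCommGroup H] [InnerProductSpace ℝ H] : H →L[ℝ] H →L[ℝ] ℝ :=
  innerSL ℝ

lemma norm_innerMap_le : ‖innerMap H‖ ≤ 1 :=
  ContinuousLinearMap.opNorm_le_bound _ zero_le_one fun x => by
    rw [one_mul]
    exact (innerSL_apply_norm ℝ x).le

lemma hasFDerivAt_fderiv_norm_sub_sq_add (hp : Differentiable ℝ p)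
    (hp' : Differentiable ℝ (fderiv ℝ p)) (x : H) :
    HasFDerivAt (fderiv ℝ fun x => ‖x - c‖ ^ 2 + p x)
      ((2 : ℝ) • innerMap H + fderiv ℝ (fderiv ℝ p) x) x := by
  rw [fderiv_norm_sub_sq_add hp]
  have h1 : HasFDerivAt (fun x : H => innerMap H (x - c)) (innerMap H) x := by
    have h3 := (innerMap H).hasFDerivAt.comp x ((hasFDerivAt_id x).sub_const c)
    rwa [ContinuousLinearMap.comp_id] at h3
  exact (h1.const_smul (2 : ℝ)).add (hp' x).hasFDerivAt

lemma norm_fderiv_norm_sub_sq_add_sub_le (hp : Differentiable ℝ p) (x : H) :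
    |‖fderiv ℝ (fun x => ‖x - c‖ ^ 2 + p x) x‖ - 2 * ‖x - c‖| ≤ ‖fderiv ℝ p x‖ := by
  rw [fderiv_norm_sub_sq_add hp]
  have h1 : ‖(2 : ℝ) • innerSL ℝ (x - c)‖ = 2 * ‖x - c‖ := by
    rw [norm_smul, innerSL_apply_norm, Real.norm_ofNat]
  rw [← h1]
  refine (abs_norm_sub_norm_le _ _).trans ?_
  rw [add_sub_cancel_left]

lemma norm_fderiv_fderiv_norm_sub_sq_add_le (hp : Differentiable ℝ p)
    (hp' : Differentiable ℝ (fderiv ℝ p)) (x : H) :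
    ‖fderiv ℝ (fderiv ℝ fun x => ‖x - c‖ ^ 2 + p x) x‖ ≤ 2 + ‖fderiv ℝ (fderiv ℝ p) x‖ := by
  rw [(hasFDerivAt_fderiv_norm_sub_sq_add hp hp' x).fderiv]
  refine (ContinuousLinearMap.opNorm_add_le _ _).trans ?_
  gcongr
  refine (ContinuousLinearMap.opNorm_smul_le _ _).trans ?_
  rw [Real.norm_ofNat]
  linarith [norm_innerMap_le (H := H)]

/-- Near a point at which `‖x - c‖² + p x` is almost `1/2` there is a point on the radial line at
which it equals `1/2`. -/
lemma exists_radial_solution {ε : ℝ} (hε : 0 < ε) (hε1 : ε ≤ 1 / 100) (hp0 : ∀ x, |p x| ≤ 1 / 100)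
    (hp1 : ∀ x y, |p y - p x| ≤ 1 / 100 * ‖y - x‖) {x : H}
    (hx : |‖x - c‖ ^ 2 + p x - 1 / 2| < ε / 2) :
    ∃ y, ‖y - x‖ < ε ∧ ‖y - c‖ < 1 ∧ ‖y - c‖ ^ 2 + p y = 1 / 2 := by
  have hcont : Continuous p := by
    refine (LipschitzWith.of_dist_le_mul (K := 1 / 100) fun x y => ?_).continuous
    rw [dist_eq_norm, dist_eq_norm]
    simpa using hp1 y x
  set X := x - c with hX
  have h0 := abs_le.1 (hp0 x)
  have hx' := abs_lt.1 hx
  have hlo : 0.68 < ‖X‖ := by nlinarith [norm_nonneg X]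
  have hhi : ‖X‖ < 0.74 := by nlinarith [norm_nonneg X]
  set u : H := ‖X‖⁻¹ • X with hu
  have hXu : X = ‖X‖ • u := by rw [hu, smul_smul, mul_inv_cancel₀ (by linarith), one_smul]
  have hun : ‖u‖ = 1 := by
    rw [hu, norm_smul, norm_inv, norm_norm, inv_mul_cancel₀ (by linarith)]
  have hnorm : ∀ s, |s| ≤ ε / 2 → ‖x + s • u - c‖ = ‖X‖ + s := by
    intro s hs
    have h1 : x + s • u - c = (‖X‖ + s) • u := by
      rw [add_smul, ← hXu, hX]; abel
    rw [h1, norm_smul, hun, mul_one, Real.norm_of_nonneg]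
    linarith [(abs_le.1 hs).1]
  have hpd : ∀ s, |p (x + s • u) - p x| ≤ 1 / 100 * |s| := by
    intro s
    have := hp1 x (x + s • u)
    rwa [add_sub_cancel_left, norm_smul, hun, mul_one, Real.norm_eq_abs] at this
  obtain ⟨s, hs, hsol⟩ : ∃ s ∈ Icc (-(ε / 2)) (ε / 2),
      ‖x + s • u - c‖ ^ 2 + p (x + s • u) = 1 / 2 := by
    have e1 : |-(ε / 2)| = ε / 2 := by rw [abs_neg, abs_of_pos (by positivity)]
    have e2 : |ε / 2| = ε / 2 := abs_of_pos (by positivity)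
    refine intermediate_value_Icc (f := fun s : ℝ => ‖x + s • u - c‖ ^ 2 + p (x + s • u))
      (by linarith) (by fun_prop) ⟨?_, ?_⟩
    · have h2 := hpd (-(ε / 2))
      rw [e1] at h2
      have h3 := abs_le.1 h2
      rw [hnorm _ e1.le]
      nlinarith
    · have h2 := hpd (ε / 2)
      rw [e2] at h2
      have h3 := abs_le.1 h2
      rw [hnorm _ e2.le]
      nlinarith
  have hs' : |s| ≤ ε / 2 := abs_le.2 hs
  refine ⟨x + s • u, ?_, ?_, hsol⟩
  · rw [add_sub_cancel_left, norm_smul, hun, mul_one, Real.norm_eq_abs]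
    linarith
  · rw [hnorm s hs']
    linarith [hs.2]

end Quadratic

/-! ### The arrangement of bumps -/

section Arrangement

variable {d : ℕ} {J : Type*} [Fintype J] {z : J → E d} {A δ : ℝ} {p : E d → ℝ} {g : ℝ → ℝ}

/-- The centres of the bumps of the marginal density: the origin for the bulk and the points
`z j`. -/
def centre (z : J → E d) (k : Option J) : E d := k.elim 0 z

/-- The heights of the bumps of the marginal density: `A` for the bulk and `δ` at the points
`z j`. -/
def height (J : Type*) (A δ : ℝ) (k : Option J) : ℝ := k.elim A fun _ => δ

/-- The marginal density. -/
def dens (z : J → E d) (A δ : ℝ) : E d → ℝ := bumpSum (height J A δ) 1 (centre z)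

/-- The regression function on the ball around the `k`-th centre: `1` in the bulk, and
`‖x - z j‖² + p x` near `z j`. -/
def localReg (z : J → E d) (p : E d → ℝ) (k : Option J) (x : E d) : ℝ :=
  k.elim 1 fun j => ‖x - z j‖ ^ 2 + p x

/-- The subdensities with marginal density `dens` and regression function `localReg`. -/
def subdens (z : J → E d) (A δ : ℝ) (p : E d → ℝ) (r : Fin 2) (x : E d) : ℝ :=
  ∑ k, height J A δ k * prof (x - centre z k) *
    (if r = 1 then localReg z p k x else 1 - localReg z p k x)

/-- The regression function, `0` outside the support of the marginal density. -/
def regFun (z : J → E d) (A δ : ℝ) (p : E d → ℝ) (x : E d) : ℝ :=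
  subdens z A δ p 1 x / dens z A δ x

/-- The bumps are well separated and have total mass one. -/
structure IsArrangement (z : J → E d) (A δ : ℝ) : Prop where
  far : ∀ j, 4 ≤ ‖z j‖
  sep : Pairwise fun j j' => 4 ≤ ‖z j - z j'‖
  A_pos : 0 < A
  δ_pos : 0 < δ
  mass : (A + Fintype.card J * δ) * ∫ x : E d, prof x = 1

/-- A small smooth perturbation of the squared distance to the centres, supported near the spheres
of squared radius `1/2`, whose Hessian has the modulus of continuity prescribed by `g`. -/
structure IsPerturbation (z : J → E d) (g : ℝ → ℝ) (p : E d → ℝ) : Prop where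
  contDiff : ContDiff ℝ 2 p
  abs_apply_le : ∀ x, |p x| ≤ 1 / 100
  norm_fderiv_le : ∀ x, ‖fderiv ℝ p x‖ ≤ 1 / (100 * d)
  norm_fderiv_fderiv_le : ∀ x, ‖fderiv ℝ (fderiv ℝ p) x‖ ≤ 1 / 2
  modulus : ∀ ε ∈ Ioo (0 : ℝ) 1, ∀ x y, ‖y - x‖ ≤ g ε →
    ‖fderiv ℝ (fderiv ℝ p) y - fderiv ℝ (fderiv ℝ p) x‖ ≤ ε
  support : ∀ x, p x ≠ 0 → ∃ j, |‖x - z j‖ ^ 2 - 1 / 2| ≤ 1 / 25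

lemma dens_eq (x : E d) :
    dens z A δ x = ∑ k, height J A δ k * prof (x - centre z k) := by
  simp [dens, bumpSum]

lemma subdens_zero_add_one (x : E d) :
    subdens z A δ p 0 x + subdens z A δ p 1 x = dens z A δ x := by
  rw [dens_eq, subdens, subdens, ← Finset.sum_add_distrib]
  refine Finset.sum_congr rfl fun k _ => ?_
  simp only [zero_ne_one, if_false, if_true]
  ring

lemma exists_of_dens_ne_zero {x : E d} (hx : dens z A δ x ≠ 0) :
    ∃ k, ‖x - centre z k‖ < 1 := by
  obtain ⟨k, hk⟩ := exists_of_bumpSum_ne_zero one_pos hx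
  exact ⟨k, hk⟩

lemma contDiff_dens {n : ℕ∞} : ContDiff ℝ n (dens z A δ) := bumpSum_contDiff

lemma continuous_dens : Continuous (dens z A δ) := (contDiff_dens (n := 0)).continuous

namespace IsArrangement

lemma norm_centre_sub (h : IsArrangement z A δ) :
    Pairwise fun k l => 4 ≤ ‖centre z k - centre z l‖ := by
  intro k l hkl
  cases k <;> cases l
  · exact absurd rfl hkl
  · simpa [centre] using h.far _
  · simpa [centre] using h.far _
  · exact h.sep fun hj => hkl (by rw [hj])

lemma eq_of_norm_lt (h : IsArrangement z A δ) {x y : E d} {k l : Option J}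
    (hk : ‖x - centre z k‖ < 3 / 2) (hl : ‖y - centre z l‖ < 3 / 2) (hxy : ‖x - y‖ < 1) :
    k = l := by
  by_contra hne
  have h1 : 4 ≤ ‖centre z k - centre z l‖ := h.norm_centre_sub hne
  have h2 : centre z k - centre z l = (x - y) - (x - centre z k) + (y - centre z l) := by abel
  have h3 := norm_add_le ((x - y) - (x - centre z k)) (y - centre z l)
  have h4 := norm_sub_le (x - y) (x - centre z k)
  rw [h2] at h1
  linarith

lemma height_pos (h : IsArrangement z A δ) (k : Option J) : 0 < height J A δ k := by
  cases k
  exacts [h.A_pos, h.δ_pos]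

lemma sum_eq_of_norm_lt (h : IsArrangement z A δ) {x : E d} {k : Option J}
    (hk : ‖x - centre z k‖ < 1) (G : Option J → ℝ) :
    ∑ l, height J A δ l * prof (x - centre z l) * G l =
      height J A δ k * prof (x - centre z k) * G k := by
  refine Fintype.sum_eq_single k fun l hl => ?_
  rw [prof_eq_zero, mul_zero, zero_mul]
  by_contra! hlt
  exact hl (h.eq_of_norm_lt (by linarith) (by linarith) (by simp : ‖x - x‖ < 1))

lemma dens_eq_of_norm_lt (h : IsArrangement z A δ) {x : E d} {k : Option J}
    (hk : ‖x - centre z k‖ < 1) :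
    dens z A δ x = height J A δ k * prof (x - centre z k) := by
  have := h.sum_eq_of_norm_lt hk fun _ => 1
  simpa [dens_eq] using this

lemma dens_nonneg (h : IsArrangement z A δ) (x : E d) : 0 ≤ dens z A δ x := by
  rw [dens_eq]
  exact Finset.sum_nonneg fun k _ => mul_nonneg (h.height_pos k).le (prof_nonneg _)

lemma regFun_eq_localReg (h : IsArrangement z A δ) {x : E d} {k : Option J}
    (hk : ‖x - centre z k‖ < 1) : regFun z A δ p x = localReg z p k x := by
  rw [regFun, h.dens_eq_of_norm_lt hk, subdens, h.sum_eq_of_norm_lt hk]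
  rw [if_pos rfl, mul_div_cancel_left₀]
  exact (mul_pos (h.height_pos k) (prof_pos hk)).ne'

lemma regFun_eq (h : IsArrangement z A δ) {x : E d} {j : J} (hj : ‖x - z j‖ < 1) :
    regFun z A δ p x = ‖x - z j‖ ^ 2 + p x :=
  h.regFun_eq_localReg (k := some j) hj

/-- Around `z j` the marginal density has a plateau of height `δ`. -/
lemma dens_eq_δ (h : IsArrangement z A δ) {x : E d} {j : J} (hj : ‖x - z j‖ ^ 2 ≤ 3 / 4) :
    dens z A δ x = δ := by
  have h1 : ‖x - z j‖ < 1 := by nlinarith [norm_nonneg (x - z j)]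
  rw [h.dens_eq_of_norm_lt (k := some j) h1]
  change δ * prof (x - z j) = δ
  rw [prof_eq_one hj, mul_one]

end IsArrangement

namespace IsPerturbation

lemma differentiable (hp : IsPerturbation z g p) : Differentiable ℝ p :=
  hp.contDiff.differentiable (by norm_num)

lemma differentiable_fderiv (hp : IsPerturbation z g p) : Differentiable ℝ (fderiv ℝ p) :=
  (hp.contDiff.fderiv_right (m := 1) (by norm_num)).differentiable (by norm_num)

lemma lipschitz (hp : IsPerturbation z g p) (x y : E d) :
    |p y - p x| ≤ 1 / (100 * d) * ‖y - x‖ :=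
  Convex.norm_image_sub_le_of_norm_fderiv_le (𝕜 := ℝ) (s := univ)
    (fun x _ => hp.differentiable x) (fun x _ => hp.norm_fderiv_le x) convex_univ (mem_univ _)
    (mem_univ _)

lemma lipschitz' (hp : IsPerturbation z g p) (hd : 1 ≤ d) (x y : E d) :
    |p y - p x| ≤ 1 / 100 * ‖y - x‖ := by
  refine (hp.lipschitz x y).trans ?_
  gcongr
  have : (1 : ℝ) ≤ d := by exact_mod_cast hd
  linarith

lemma norm_fderiv_le' (hp : IsPerturbation z g p) (hd : 1 ≤ d) (x : E d) :
    ‖fderiv ℝ p x‖ ≤ 1 / 100 := by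
  refine (hp.norm_fderiv_le x).trans ?_
  gcongr
  have : (1 : ℝ) ≤ d := by exact_mod_cast hd
  linarith

/-- The values of the regression function are probabilities. -/
lemma localReg_mem (hp : IsPerturbation z g p) (h : IsArrangement z A δ) {x : E d} {k : Option J}
    (hk : ‖x - centre z k‖ < 1) : localReg z p k x ∈ Icc (0 : ℝ) 1 := by
  cases k with
  | none => simp [localReg]
  | some j =>
    change ‖x - z j‖ < 1 at hk
    change ‖x - z j‖ ^ 2 + p x ∈ Icc (0 : ℝ) 1
    by_cases hpx : p x = 0
    · rw [hpx, add_zero]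
      exact ⟨by positivity, by nlinarith [norm_nonneg (x - z j)]⟩
    · obtain ⟨j', hj'⟩ := hp.support x hpx
      have h1 := abs_le.1 hj'
      have h2 : ‖x - z j'‖ < 1 := by nlinarith [norm_nonneg (x - z j')]
      have h3 : some j = some j' := h.eq_of_norm_lt (x := x) (y := x) (k := some j)
        (l := some j') (show ‖x - z j‖ < 3 / 2 by linarith)
        (show ‖x - z j'‖ < 3 / 2 by linarith) (by simp)
      rw [Option.some_inj.1 h3]
      have h4 := abs_le.1 (hp.abs_apply_le x)
      exact ⟨by linarith, by linarith⟩

end IsPerturbation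

lemma lintegral_height_prof (h : IsArrangement z A δ) (R : Option J → ℝ) (hR : ∀ k, 0 ≤ R k) :
    ∫⁻ x, ENNReal.ofReal (∑ k, height J A δ k * prof (x - centre z k) * R k) =
      ENNReal.ofReal (∑ k, height J A δ k * R k * ∫ x : E d, prof x) := by
  have hint : ∀ k, Integrable fun x : E d => height J A δ k * prof (x - centre z k) * R k :=
    fun k => ((prof_integrable.comp_sub_right (centre z k)).const_mul _).mul_const _
  rw [← ofReal_integral_eq_lintegral_ofReal (integrable_finsetSum _ fun k _ => hint k)
    (ae_of_all _ fun x => Finset.sum_nonneg fun k _ =>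
      mul_nonneg (mul_nonneg (h.height_pos k).le (prof_nonneg _)) (hR k)),
    integral_finsetSum _ fun k _ => hint k]
  congr 1
  refine Finset.sum_congr rfl fun k _ => ?_
  rw [integral_mul_const, integral_const_mul, integral_sub_right_eq_self (prof : E d → ℝ)]
  ring

/-- The subdensities of the construction define a distribution. -/
lemma isSubdensity (hd : 1 ≤ d) [Nonempty J] (h : IsArrangement z A δ)
    (hp : IsPerturbation z g p) : IsSubdensity (subdens z A δ p) where
  continuous r := by
    have hpc := hp.contDiff.continuous
    refine continuous_finsetSum _ fun k _ => ?_
    have h1 : Continuous fun x => localReg z p k x := by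
      cases k with
      | none => exact continuous_const
      | some j =>
        change Continuous fun x => ‖x - z j‖ ^ 2 + p x
        fun_prop
    have h2 : Continuous fun x : E d => prof (x - centre z k) :=
      prof_continuous.comp (by fun_prop)
    split_ifs
    · exact (continuous_const.mul h2).mul h1
    · exact (continuous_const.mul h2).mul (continuous_const.sub h1)
  nonneg r x := by
    refine Finset.sum_nonneg fun k _ => ?_
    rcases lt_or_ge ‖x - centre z k‖ 1 with hk | hk
    · have h1 := hp.localReg_mem h hk
      refine mul_nonneg (mul_nonneg (h.height_pos k).le (prof_nonneg _)) ?_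
      split_ifs
      · exact h1.1
      · linarith [h1.2]
    · rw [prof_eq_zero hk]; simp
  exists_pos r := by
    obtain ⟨j⟩ := ‹Nonempty J›
    have hx : ‖z j + EuclideanSpace.single (⟨0, hd⟩ : Fin d) (1 / 2 : ℝ) - z j‖ = 1 / 2 := by
      simp
    refine ⟨z j + EuclideanSpace.single (⟨0, hd⟩ : Fin d) (1 / 2 : ℝ), ?_⟩
    set x := z j + EuclideanSpace.single (⟨0, hd⟩ : Fin d) (1 / 2 : ℝ)
    have hk : ‖x - centre z (some j)‖ < 1 := by
      change ‖x - z j‖ < 1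
      rw [hx]; norm_num
    rw [subdens, h.sum_eq_of_norm_lt hk]
    refine mul_pos (mul_pos (h.height_pos _) (prof_pos hk)) ?_
    have h1 := abs_le.1 (hp.abs_apply_le x)
    have h2 : localReg z p (some j) x = 1 / 4 + p x := by
      change ‖x - z j‖ ^ 2 + p x = _
      rw [hx]; norm_num
    rw [h2]
    split_ifs <;> linarith
  lintegral := by
    simp_rw [subdens_zero_add_one, dens_eq]
    have := lintegral_height_prof h (fun _ => 1) fun _ => zero_le_one
    simp only [mul_one] at this
    rw [this, ← Finset.sum_mul, Fintype.sum_option]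
    simp only [height, Option.elim, Finset.sum_const, Finset.card_univ, nsmul_eq_mul]
    rw [h.mass, ENNReal.ofReal_one]

end Arrangement

/-! ### Membership in the classes of distributions -/

section Membership

variable {d : ℕ} {J : Type*} [Fintype J] {z : J → E d} {A δ : ℝ} {p : E d → ℝ} {g : ℝ → ℝ}

lemma regFun_eq_zero (x : E d) (hx : dens z A δ x = 0) : regFun z A δ p x = 0 := by
  rw [regFun, hx, div_zero]

lemma regFun_eq_one (h : IsArrangement z A δ) {x : E d} (hx : ‖x‖ < 1) :
    regFun z A δ p x = 1 :=
  h.regFun_eq_localReg (k := none) (by simpa [centre] using hx)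

lemma mem_boundary_iff (h : IsArrangement z A δ) {x : E d} :
    x ∈ boundary (regFun z A δ p) ↔ ∃ j, ‖x - z j‖ < 1 ∧ ‖x - z j‖ ^ 2 + p x = 1 / 2 := by
  constructor
  · intro hx
    change regFun z A δ p x = 1 / 2 at hx
    have hne : dens z A δ x ≠ 0 := by
      intro h0
      rw [regFun_eq_zero x h0] at hx
      norm_num at hx
    obtain ⟨k, hk⟩ := exists_of_dens_ne_zero hne
    rw [h.regFun_eq_localReg hk] at hx
    cases k with
    | none => norm_num [localReg] at hx
    | some j => exact ⟨j, hk, hx⟩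
  · rintro ⟨j, hj, hx⟩
    change regFun z A δ p x = 1 / 2
    rw [h.regFun_eq hj, hx]

lemma exists_of_mem_boundary (h : IsArrangement z A δ) (hp : IsPerturbation z g p) {x : E d}
    (hx : x ∈ boundary (regFun z A δ p)) :
    ∃ j, ‖x - z j‖ ^ 2 + p x = 1 / 2 ∧ 7 / 10 ≤ ‖x - z j‖ ∧ ‖x - z j‖ ≤ 143 / 200 := by
  obtain ⟨j, -, hj⟩ := (mem_boundary_iff h).1 hx
  have h1 := abs_le.1 (hp.abs_apply_le x)
  refine ⟨j, hj, ?_, ?_⟩ <;> nlinarith [norm_nonneg (x - z j)]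

lemma exists_of_mem_nbhd (h : IsArrangement z A δ) (hp : IsPerturbation z g p) {x : E d} {ε : ℝ}
    (hε : ε ≤ 1 / 50) (hx : x ∈ nbhd (regFun z A δ p) ε) :
    ∃ j, 17 / 25 ≤ ‖x - z j‖ ∧ ‖x - z j‖ ≤ 147 / 200 := by
  obtain ⟨y, hy, hxy⟩ := Metric.mem_thickening_iff.1 hx
  obtain ⟨j, -, h1, h2⟩ := exists_of_mem_boundary h hp hy
  rw [dist_eq_norm] at hxy
  have h3 : x - z j = (x - y) + (y - z j) := by abel
  have h4 : y - z j = (x - z j) - (x - y) := by abel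
  have h5 := norm_add_le (x - y) (y - z j)
  have h6 := norm_sub_le (x - z j) (x - y)
  rw [← h3] at h5
  rw [← h4] at h6
  exact ⟨j, by linarith, by linarith⟩

lemma eventually_norm_sub_lt {c x : E d} {r : ℝ} (h : ‖x - c‖ < r) : ∀ᶠ y in 𝓝 x, ‖y - c‖ < r :=
  (continuous_id.sub continuous_const).norm.continuousAt.eventually_lt_const h

lemma dens_eventuallyEq (h : IsArrangement z A δ) {x : E d} {j : J}
    (hj : ‖x - z j‖ ≤ 4 / 5) : dens z A δ =ᶠ[𝓝 x] fun _ => δ := by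
  filter_upwards [eventually_norm_sub_lt (show ‖x - z j‖ < 17 / 20 by linarith)] with y hy
  exact h.dens_eq_δ (j := j) (by nlinarith [norm_nonneg (y - z j)])

lemma regFun_eventuallyEq (h : IsArrangement z A δ) {x : E d} {j : J} (hj : ‖x - z j‖ < 1) :
    regFun z A δ p =ᶠ[𝓝 x] fun y => ‖y - z j‖ ^ 2 + p y := by
  filter_upwards [eventually_norm_sub_lt hj] with y hy
  exact h.regFun_eq hy

lemma boundary_nonempty (hd : 1 ≤ d) [Nonempty J] (h : IsArrangement z A δ)
    (hp : IsPerturbation z g p) :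
    (boundary (regFun z A δ p) ∩ {x | 0 < dens z A δ x}).Nonempty := by
  obtain ⟨j⟩ := ‹Nonempty J›
  set e : E d := EuclideanSpace.single (⟨0, hd⟩ : Fin d) (1 : ℝ) with he
  have hn : ∀ s : ℝ, 0 ≤ s → ‖z j + s • e - z j‖ = s := by
    intro s hs
    rw [add_sub_cancel_left, norm_smul, he, PiLp.norm_single, norm_one, mul_one,
      Real.norm_of_nonneg hs]
  have hpc := hp.contDiff.continuous
  have hc : ContinuousOn (fun s : ℝ => ‖z j + s • e - z j‖ ^ 2 + p (z j + s • e))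
      (Icc (1 / 2) (4 / 5)) := by
    apply Continuous.continuousOn
    fun_prop
  have hmem : (1 / 2 : ℝ) ∈ Icc (‖z j + (1 / 2 : ℝ) • e - z j‖ ^ 2 + p (z j + (1 / 2 : ℝ) • e))
      (‖z j + (4 / 5 : ℝ) • e - z j‖ ^ 2 + p (z j + (4 / 5 : ℝ) • e)) := by
    have h1 := abs_le.1 (hp.abs_apply_le (z j + (1 / 2 : ℝ) • e))
    have h2 := abs_le.1 (hp.abs_apply_le (z j + (4 / 5 : ℝ) • e))
    rw [hn _ (by norm_num), hn _ (by norm_num)]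
    constructor <;> linarith
  obtain ⟨s, hs, hs'⟩ := intermediate_value_Icc (by norm_num) hc hmem
  have hs0 : ‖z j + s • e - z j‖ = s := hn s (by linarith [hs.1])
  refine ⟨z j + s • e, (mem_boundary_iff h).2 ⟨j, ?_, hs'⟩, ?_⟩
  · rw [hs0]; linarith [hs.2]
  · change 0 < dens z A δ (z j + s • e)
    rw [h.dens_eq_δ (j := j)]
    · exact h.δ_pos
    · rw [hs0]; nlinarith [hs.1, hs.2]

lemma le_dens (h : IsArrangement z A δ) (k : Option J) (x : E d) :
    height J A δ k * prof (x - centre z k) ≤ dens z A δ x := by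
  rw [dens_eq]
  exact Finset.single_le_sum (f := fun k => height J A δ k * prof (x - centre z k))
    (fun k _ => mul_nonneg (h.height_pos k).le (prof_nonneg _)) (Finset.mem_univ k)

/-- Every ball contains a ball of half the radius on which the marginal density is at least its
value at the centre, as the bumps are radially decreasing. -/
lemma exists_ball_dens_le (h : IsArrangement z A δ) {x : E d} (hx : dens z A δ x ≠ 0) {r : ℝ}
    (hr : 0 < r) (hr1 : r ≤ 1 / 100) :
    ∃ w, Metric.ball w (r / 2) ⊆ Metric.ball x r ∧
      ∀ y ∈ Metric.ball w (r / 2), dens z A δ x ≤ dens z A δ y := by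
  obtain ⟨k, hk⟩ := exists_of_dens_ne_zero hx
  have hxd := h.dens_eq_of_norm_lt hk
  rcases le_or_gt (r / 2) ‖x - centre z k‖ with hc | hc
  · set v := x - centre z k with hv
    have hv0 : 0 < ‖v‖ := by linarith
    set s : ℝ := r / 2 / ‖v‖ with hs
    have hs0 : 0 ≤ s := by positivity
    have hs1 : s ≤ 1 := (div_le_one hv0).2 hc
    have hsv : s * ‖v‖ = r / 2 := div_mul_cancel₀ _ hv0.ne'
    refine ⟨x - s • v, ?_, fun y hy => ?_⟩
    · apply Metric.ball_subset_ball'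
      rw [dist_eq_norm, sub_sub_cancel_left, norm_neg, norm_smul, Real.norm_of_nonneg hs0, hsv]
      linarith
    · rw [Metric.mem_ball, dist_eq_norm] at hy
      have h1 : y - centre z k = (y - (x - s • v)) + (1 - s) • v := by
        rw [sub_smul, one_smul, hv]; abel
      have h2 : ‖y - centre z k‖ ≤ ‖v‖ := by
        rw [h1]
        refine (norm_add_le _ _).trans ?_
        rw [norm_smul, Real.norm_of_nonneg (by linarith : (0 : ℝ) ≤ 1 - s)]
        nlinarith
      rw [hxd]
      exact (mul_le_mul_of_nonneg_left (prof_anti h2) (h.height_pos k).le).trans (le_dens h k y)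
  · refine ⟨x, Metric.ball_subset_ball (by linarith), fun y hy => ?_⟩
    rw [Metric.mem_ball, dist_eq_norm] at hy
    have h1 : y - centre z k = (y - x) + (x - centre z k) := by abel
    have h2 : ‖y - centre z k‖ ≤ r := by
      rw [h1]
      exact (norm_add_le _ _).trans (by linarith)
    rw [hxd]
    refine (mul_le_mul_of_nonneg_left ?_ (h.height_pos k).le).trans (le_dens h k y)
    rw [prof_eq_one (x := y - centre z k) (by nlinarith [norm_nonneg (y - centre z k)])]
    exact prof_le_one _

lemma minimal_mass (h : IsArrangement z A δ) {μ : Measure (E d)} [IsFiniteMeasure μ]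
    (hμ : μ = volume.withDensity fun x => ENNReal.ofReal (dens z A δ x)) {ε₀ : ℝ}
    (hε : ε₀ ≤ 1 / 100) (hε2 : ε₀ ≤ (1 / 2) ^ d) (x : E d) {r : ℝ} (hr : 0 < r) (hr1 : r ≤ ε₀) :
    ε₀ * volume.real (Metric.ball (0 : E d) 1) * r ^ d * dens z A δ x ≤
      μ.real (Metric.ball x r) := by
  by_cases hx : dens z A δ x = 0
  · rw [hx, mul_zero]; exact measureReal_nonneg
  obtain ⟨w, hw, hwd⟩ := exists_ball_dens_le h hx hr (hr1.trans hε)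
  refine le_trans ?_ (measureReal_mono hw)
  have h1 : ENNReal.ofReal (dens z A δ x) * volume (Metric.ball w (r / 2)) ≤
      μ (Metric.ball w (r / 2)) := by
    rw [hμ, withDensity_apply _ measurableSet_ball, ← setLIntegral_const]
    exact setLIntegral_mono' measurableSet_ball fun y hy => ENNReal.ofReal_le_ofReal (hwd y hy)
  have h2 := ENNReal.toReal_mono (measure_ne_top _ _) h1
  rw [ENNReal.toReal_mul, ENNReal.toReal_ofReal (h.dens_nonneg x)] at h2
  refine le_trans ?_ h2
  have hv : (volume (Metric.ball w (r / 2))).toReal =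
      r ^ d / 2 ^ d * volume.real (Metric.ball (0 : E d) 1) := by
    rw [Measure.addHaar_ball_of_pos _ _ (by positivity), ENNReal.toReal_mul,
      ENNReal.toReal_ofReal (by positivity), finrank_euclideanSpace_fin, div_pow, measureReal_def]
  rw [hv]
  have h3 : 0 ≤ volume.real (Metric.ball (0 : E d) 1) * r ^ d * dens z A δ x :=
    mul_nonneg (mul_nonneg measureReal_nonneg (by positivity)) (h.dens_nonneg x)
  calc _ = ε₀ * (volume.real (Metric.ball (0 : E d) 1) * r ^ d * dens z A δ x) := by ring
    _ ≤ (1 / 2) ^ d * (volume.real (Metric.ball (0 : E d) 1) * r ^ d * dens z A δ x) :=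
        mul_le_mul_of_nonneg_right hε2 h3
    _ = _ := by rw [div_pow, one_pow]; ring

lemma marginalCond (hd : 1 ≤ d) [Nonempty J] (h : IsArrangement z A δ)
    (hp : IsPerturbation z g p) {μ : Measure (E d)} [IsFiniteMeasure μ]
    (hμ : μ = volume.withDensity fun x => ENNReal.ofReal (dens z A δ x)) {ε₀ M₀ : ℝ} {l : ℝ → ℝ}
    (hε : ε₀ ≤ 1 / 100) (hε2 : ε₀ ≤ (1 / 2) ^ d) (hδ : δ ≤ M₀) (hl : 0 ≤ l δ) :
    MarginalCond μ (dens z A δ) (regFun z A δ p) ε₀ M₀ l := by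
  have hS : ∀ x ∈ boundary (regFun z A δ p), ∃ j, dens z A δ x = δ ∧ ‖x - z j‖ ≤ 143 / 200 := by
    intro x hx
    obtain ⟨j, -, -, hj⟩ := exists_of_mem_boundary h hp hx
    exact ⟨j, h.dens_eq_δ (j := j) (by nlinarith [norm_nonneg (x - z j)]), hj⟩
  refine ⟨boundary_nonempty hd h hp, fun x hx => ?_, ?_, fun x hx => ?_, fun x hx y hy => ?_,
    fun x _ r hr hr1 => minimal_mass h hμ hε hε2 x hr hr1⟩
  · obtain ⟨j, hj, -⟩ := hS x hx
    rwa [hj]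
  · exact (contDiff_dens (n := 2)).contDiffOn
  · obtain ⟨j, hj, hj'⟩ := hS x hx
    rw [hj, (dens_eventuallyEq h (j := j) (by linarith)).fderiv_eq, fderiv_const_apply, norm_zero]
    exact mul_nonneg h.δ_pos.le hl
  · obtain ⟨j, hj, hj'⟩ := hS x hx
    rw [Metric.mem_ball, dist_eq_norm] at hy
    have hy1 : ‖y - z j‖ ≤ 4 / 5 := by
      rw [show y - z j = (y - x) + (x - z j) by abel]
      exact (norm_add_le _ _).trans (by linarith)
    rw [hj, (dens_eventuallyEq h (j := j) hy1).fderiv.fderiv_eq]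
    have : fderiv ℝ (fderiv ℝ fun _ : E d => δ) y = 0 := by
      rw [show (fderiv ℝ fun _ : E d => δ) = fun _ => 0 from
        funext fun _ => fderiv_const_apply _]
      exact fderiv_const_apply _
    rw [this]
    refine (ContinuousLinearMap.opNorm_zero).le.trans ?_
    exact mul_nonneg h.δ_pos.le hl

lemma regressionCond (hd : 1 ≤ d) (h : IsArrangement z A δ) (hp : IsPerturbation z g p)
    (hg : IsClassG g) {ε₀ M₀ : ℝ} {l : ℝ → ℝ} (hε0 : 0 < ε₀) (hε : ε₀ ≤ 1 / 100)
    (hεM : ε₀ * M₀ ≤ 1 / 4) (hM : 3 ≤ M₀) (hl : ∀ δ, 0 < δ → 2 / ε₀ ≤ l δ) :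
    RegressionCond (dens z A δ) (regFun z A δ p) ε₀ M₀ l g := by
  have hN : ∀ x ∈ nbhd (regFun z A δ p) (2 * ε₀), ∃ j, 17 / 25 ≤ ‖x - z j‖ ∧
      ‖x - z j‖ ≤ 147 / 200 := fun x hx => exists_of_mem_nbhd h hp (by linarith) hx
  have hd1 := hp.differentiable
  have hd2 := hp.differentiable_fderiv
  have hE : ∀ {x : E d} {j : J}, ‖x - z j‖ ≤ 147 / 200 →
      regFun z A δ p =ᶠ[𝓝 x] fun y => ‖y - z j‖ ^ 2 + p y := fun hj =>
    regFun_eventuallyEq h (by linarith)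
  have hgrad : ∀ {x : E d} {j : J}, ‖x - z j‖ ≤ 147 / 200 →
      |‖fderiv ℝ (regFun z A δ p) x‖ - 2 * ‖x - z j‖| ≤ 1 / 100 := fun {x} {j} hj => by
    rw [(hE hj).fderiv_eq]
    exact (norm_fderiv_norm_sub_sq_add_sub_le hd1 x).trans (hp.norm_fderiv_le' hd x)
  refine ⟨fun x hx => ?_, fun x hx => ?_, fun x hx => ?_, fun x hx => ?_, fun x hx => ?_,
    fun ε hε x hx y hy hxy => ?_, ?_, fun x hx hfx => ?_⟩
  · obtain ⟨j, -, hj⟩ := hN x hx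
    exact (hE hj).differentiableAt_iff.2 (hasFDerivAt_norm_sub_sq_add hd1 x).differentiableAt
  · obtain ⟨j, -, hj⟩ := hN x hx
    exact (hE hj).fderiv.differentiableAt_iff.2
      (hasFDerivAt_fderiv_norm_sub_sq_add hd1 hd2 x).differentiableAt
  · obtain ⟨j, -, hj1, hj2⟩ := exists_of_mem_boundary h hp hx
    have := abs_le.1 (hgrad (x := x) (j := j) (by linarith))
    linarith
  · obtain ⟨j, -, hj⟩ := hN x hx
    have := abs_le.1 (hgrad hj)
    linarith
  · obtain ⟨j, -, hj⟩ := hN x hx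
    rw [(hE hj).fderiv.fderiv_eq]
    refine (norm_fderiv_fderiv_norm_sub_sq_add_le hd1 hd2 x).trans ?_
    linarith [hp.norm_fderiv_fderiv_le x]
  · obtain ⟨j, -, hj⟩ := hN x hx
    obtain ⟨j', -, hj'⟩ := hN y hy
    have hgε := hg.lt_one hε
    -- `g ε < 1`, so both points lie near the same centre
    have hjj : (some j' : Option J) = some j := h.eq_of_norm_lt (x := y) (y := x)
      (show ‖y - z j'‖ < 3 / 2 by linarith) (show ‖x - z j‖ < 3 / 2 by linarith) (by linarith)
    rw [Option.some_inj.1 hjj] at hj'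
    rw [(hE hj).fderiv.fderiv_eq, (hE hj').fderiv.fderiv_eq,
      (hasFDerivAt_fderiv_norm_sub_sq_add hd1 hd2 x).fderiv,
      (hasFDerivAt_fderiv_norm_sub_sq_add hd1 hd2 y).fderiv, add_sub_add_left_eq_sub]
    exact hp.modulus ε hε x y hxy
  · intro x hx
    obtain ⟨k, hk⟩ := exists_of_dens_ne_zero (ne_of_gt hx)
    have h2 : regFun z A δ p =ᶠ[𝓝 x] localReg z p k := by
      filter_upwards [eventually_norm_sub_lt hk] with y hy
      exact h.regFun_eq_localReg hy
    have h3 : ContinuousAt (localReg z p k) x := by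
      cases k with
      | none => exact continuousAt_const
      | some j => exact (hasFDerivAt_norm_sub_sq_add hd1 x).continuousAt
    exact (h3.congr h2.symm).continuousWithinAt
  · have hl1 : 1 / l (dens z A δ x) ≤ ε₀ / 2 := by
      have h1 := hl _ hfx
      rw [div_le_iff₀ hε0] at h1
      have h2 : 0 < l (dens z A δ x) := lt_of_lt_of_le (by positivity) (hl _ hfx)
      rw [div_le_iff₀ h2]
      linarith
    refine hl1.trans ?_
    obtain ⟨k, hk⟩ := exists_of_dens_ne_zero hfx.ne'
    cases k with
    | none =>
      rw [regFun_eq_one h (by simpa [centre] using hk)]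
      norm_num [abs_of_pos]
      linarith
    | some j =>
      -- a value within `ε₀ / 2` of `1/2` forces a point of the decision boundary at distance
      -- below `ε₀`, as the regression function grows with slope above one in radial direction
      by_contra! hlt
      rw [h.regFun_eq hk] at hlt
      obtain ⟨y, hy, hy1, hy2⟩ := exists_radial_solution hε0 hε hp.abs_apply_le
        (hp.lipschitz' hd) hlt
      refine hx (Metric.mem_thickening_iff.2 ⟨y, (mem_boundary_iff h).2 ⟨j, hy1, hy2⟩, ?_⟩)
      rwa [dist_comm, dist_eq_norm]

lemma moment_le (h : IsArrangement z A δ) {μ : Measure (E d)}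
    (hμ : μ = volume.withDensity fun x => ENNReal.ofReal (dens z A δ x)) {ρ M₀ R : ℝ}
    (hρ : 0 < ρ) (hR0 : 0 ≤ R) (hR : ∀ j, ‖z j‖ + 1 ≤ R)
    (hM : (A + Fintype.card J * (δ * R ^ ρ)) * ∫ x : E d, prof x ≤ M₀) :
    ∫⁻ x, ENNReal.ofReal (‖x‖ ^ ρ) ∂μ ≤ ENNReal.ofReal M₀ := by
  have hcont : Continuous fun x : E d => ‖x‖ ^ ρ :=
    continuous_norm.rpow_const fun _ => Or.inr hρ.le
  rw [hμ, lintegral_withDensity_eq_lintegral_mul _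
    continuous_dens.measurable.ennreal_ofReal hcont.measurable.ennreal_ofReal]
  have hR' : ∀ k : Option J, 0 ≤ k.elim 1 fun _ => R ^ ρ := by
    intro k
    cases k
    exacts [zero_le_one, Real.rpow_nonneg hR0 _]
  have hle := lintegral_height_prof h (fun k => k.elim 1 fun _ => R ^ ρ) hR'
  have hsum : ∑ k, height J A δ k * (k.elim 1 fun _ => R ^ ρ) * ∫ x : E d, prof x =
      (A + Fintype.card J * (δ * R ^ ρ)) * ∫ x : E d, prof x := by
    rw [← Finset.sum_mul, Fintype.sum_option]
    simp [height]
  rw [hsum] at hle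
  refine le_trans (lintegral_mono fun x => ?_) (hle.le.trans (ENNReal.ofReal_le_ofReal hM))
  change ENNReal.ofReal (dens z A δ x) * ENNReal.ofReal (‖x‖ ^ ρ) ≤ _
  rw [← ENNReal.ofReal_mul (h.dens_nonneg x), dens_eq, Finset.sum_mul]
  refine ENNReal.ofReal_le_ofReal (Finset.sum_le_sum fun k _ => ?_)
  by_cases hk : prof (x - centre z k) = 0
  · simp [hk]
  · have hk1 := norm_lt_one_of_prof_ne_zero hk
    refine mul_le_mul_of_nonneg_left ?_ (mul_nonneg (h.height_pos k).le (prof_nonneg _))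
    cases k with
    | none =>
      have : ‖x‖ < 1 := by simpa [centre] using hk1
      exact Real.rpow_le_one (norm_nonneg _) this.le hρ.le
    | some j =>
      refine Real.rpow_le_rpow (norm_nonneg _) ?_ hρ.le
      have h1 := norm_add_le (x - z j) (z j)
      rw [sub_add_cancel] at h1
      have h2 : ‖x - z j‖ < 1 := hk1
      linarith [hR j]

lemma surface_le (h : IsArrangement z A δ) (hp : IsPerturbation z g p)
    {c M₀ ρ : ℝ} (hc : ∀ j, ∀ S : Set (E d),
      (∀ x ∈ S, ‖x - z j‖ ^ 2 + p x = 1 / 2 ∧ 9 / 20 ≤ ‖x - z j‖ ^ 2 ∧ ‖x - z j‖ ≤ 1) →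
      μHE[d - 1] S ≤ ENNReal.ofReal c)
    (hM : δ ^ ((d : ℝ) / (ρ + d)) * (Fintype.card J * c) ≤ M₀) :
    ∫⁻ x in boundary (regFun z A δ p),
      ENNReal.ofReal (dens z A δ x ^ ((d : ℝ) / (ρ + d))) ∂μHE[d - 1] ≤ ENNReal.ofReal M₀ := by
  set S := boundary (regFun z A δ p) with hS
  set T : J → Set (E d) := fun j =>
    {x | ‖x - z j‖ ^ 2 + p x = 1 / 2 ∧ 7 / 10 ≤ ‖x - z j‖ ∧ ‖x - z j‖ ≤ 143 / 200} with hT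
  set D : ℝ := δ ^ ((d : ℝ) / (ρ + d)) with hD
  have hD0 : 0 ≤ D := Real.rpow_nonneg h.δ_pos.le _
  have hsub : S ⊆ ⋃ j, T j := fun x hx => mem_iUnion.2 (exists_of_mem_boundary h hp hx)
  have hTm : MeasurableSet (⋃ j, T j) := by
    refine MeasurableSet.iUnion fun j => ?_
    have hpc := hp.contDiff.continuous
    refine IsClosed.measurableSet ?_
    have hn : Continuous fun x : E d => ‖x - z j‖ := by fun_prop
    exact (isClosed_eq ((hn.pow 2).add hpc) continuous_const).inter
      ((isClosed_le continuous_const hn).inter (isClosed_le hn continuous_const))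
  calc ∫⁻ x in S, ENNReal.ofReal (dens z A δ x ^ ((d : ℝ) / (ρ + d))) ∂μHE[d - 1]
      ≤ ∫⁻ x in ⋃ j, T j, ENNReal.ofReal (dens z A δ x ^ ((d : ℝ) / (ρ + d))) ∂μHE[d - 1] :=
        lintegral_mono_set hsub
    _ = ∫⁻ x in ⋃ j, T j, ENNReal.ofReal D ∂μHE[d - 1] := by
        refine setLIntegral_congr_fun hTm fun x hx => ?_
        obtain ⟨j, -, -, hj⟩ := mem_iUnion.1 hx
        rw [h.dens_eq_δ (j := j) (by nlinarith [norm_nonneg (x - z j)])]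
    _ = ENNReal.ofReal D * μHE[d - 1] (⋃ j, T j) := setLIntegral_const _ _
    _ ≤ ENNReal.ofReal D * ∑ j, μHE[d - 1] (T j) := by
        gcongr
        exact measure_iUnion_fintype_le _ _
    _ ≤ ENNReal.ofReal D * ∑ _j : J, ENNReal.ofReal c := by
        gcongr with j
        exact hc j _ fun x hx => ⟨hx.1, by nlinarith [hx.2.1], by linarith [hx.2.2]⟩
    _ = ENNReal.ofReal (D * (Fintype.card J * c)) := by
        rw [Finset.sum_const, Finset.card_univ, nsmul_eq_mul, ENNReal.ofReal_mul hD0,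
          ENNReal.ofReal_mul (Nat.cast_nonneg _), ENNReal.ofReal_natCast]
    _ ≤ _ := ENNReal.ofReal_le_ofReal hM

/-- The bulk and the plateaus have heights at most `W`; the smoothness of the marginal density
only involves `W` and the profile. -/
lemma mem_classQ {F : Fin 2 → E d → ℝ} (hF : IsSubdensity F)
    (hFd : ∀ x, F 0 x + F 1 x = dens z A δ x) (h : IsArrangement z A δ) {B W lam γ : ℝ}
    (hB : IsProfBound (E d) B) (hA : A ≤ W) (hδ : δ ≤ W) (hlam : 2 * (B * W) ≤ lam)
    (hγ : 0 < γ) (hγ2 : γ ≤ 2) : hF.distr ∈ classQ d γ lam := by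
  have hW : 0 ≤ W := h.A_pos.le.trans hA
  have hBW : W ≤ B * W := le_mul_of_one_le_left hW hB.one_le
  have hs : ∀ k, |height J A δ k| ≤ W := by
    intro k
    rw [abs_of_pos (h.height_pos k)]
    cases k
    exacts [hA, hδ]
  have hsep : Pairwise fun k l => 2 * (1 : ℝ) < ‖centre z k - centre z l‖ :=
    h.norm_centre_sub.mono fun k l hkl => by linarith
  have hden := hF.isDensity_margX
  have hfun : (fun x => F 0 x + F 1 x) = dens z A δ := funext hFd
  rw [hfun] at hden
  have hb : ∀ x, dens z A δ x ≤ W := fun x =>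
    (le_abs_self _).trans (abs_bumpSum_le one_pos hsep hW hs x)
  refine ⟨dens z A δ, hden, fun x => (hb x).trans (by linarith), ?_⟩
  refine isHolder_of_bounds hγ hγ2 (contDiff_dens (n := 2)) h.dens_nonneg
    (fun x => (hb x).trans (by linarith)) (fun x => ?_) (fun x => ?_)
  · have := norm_fderiv_bumpSum_le hB one_pos hsep hW hs x
    change ‖fderiv ℝ (dens z A δ) x‖ ≤ _ at this
    rw [inv_one, mul_one] at this
    linarith
  · have := norm_fderiv_fderiv_bumpSum_le hB one_pos hsep hW hs x
    change ‖fderiv ℝ (fderiv ℝ (dens z A δ)) x‖ ≤ _ at this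
    rw [inv_one, mul_one, mul_one] at this
    linarith

end Membership

/-! ### The family of perturbed distributions -/

section LikelihoodRatio

variable {d : ℕ} {J : Type*} [Fintype J] {z : J → E d} {A δ : ℝ} {p p' : E d → ℝ} {g : ℝ → ℝ}

lemma IsArrangement.subdens_one_eq (h : IsArrangement z A δ) {x : E d} {j : J}
    (hj : ‖x - z j‖ ^ 2 ≤ 3 / 4) : subdens z A δ p 1 x = δ * (‖x - z j‖ ^ 2 + p x) := by
  have h1 : ‖x - z j‖ < 1 := by nlinarith [norm_nonneg (x - z j)]
  rw [← h.regFun_eq h1, regFun, h.dens_eq_δ hj, mul_div_cancel₀ _ h.δ_pos.ne']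

lemma IsArrangement.subdens_zero_eq (h : IsArrangement z A δ) {x : E d} {j : J}
    (hj : ‖x - z j‖ ^ 2 ≤ 3 / 4) : subdens z A δ p 0 x = δ * (1 - (‖x - z j‖ ^ 2 + p x)) := by
  have h1 := subdens_zero_add_one (z := z) (A := A) (δ := δ) (p := p) x
  rw [h.subdens_one_eq hj, h.dens_eq_δ hj] at h1
  linarith

lemma subdens_congr {x : E d} (hx : p' x = p x) (r : Fin 2) :
    subdens z A δ p' r x = subdens z A δ p r x := by
  refine Finset.sum_congr rfl fun k _ => ?_
  cases k <;> simp [localReg, hx]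

/-- The chi-square divergence of two perturbations with the same marginal: it is
`∫ f (η' - η)² / (η (1 - η))`. -/
lemma exists_likelihoodRatio (h : IsArrangement z A δ) (hF : IsSubdensity (subdens z A δ p))
    (hF' : IsSubdensity (subdens z A δ p')) (hp : ∀ x, |p x| ≤ 1 / 100) {b : E d} {j : J}
    {a e : ℝ} (ha : a ≤ 1 / 100) (hb : ‖b - z j‖ ^ 2 = 1 / 2)
    (hpp : ∀ x, a ≤ ‖x - b‖ → p' x = p x) (hpe : ∀ x, |p' x - p x| ≤ 2 * e) :
    ∃ L : E d × Fin 2 → ℝ≥0∞, Measurable L ∧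
      jointLaw (subdens z A δ p') = (jointLaw (subdens z A δ p)).withDensity L ∧
      ∫⁻ w, L w ^ 2 ∂jointLaw (subdens z A δ p) ≤
        ENNReal.ofReal (1 + 20 * δ * e ^ 2 * volume.real (Metric.ball b a)) := by
  set F := subdens z A δ p with hFdef
  set F' := subdens z A δ p' with hFdef'
  set G : Fin 2 → E d → ℝ := fun r x => F' r x / F r x with hG
  have hGm : ∀ r, Measurable fun x => ENNReal.ofReal (G r x) := fun r =>
    ((hF'.continuous r).measurable.div (hF.continuous r).measurable).ennreal_ofReal
  have hLm : Measurable fun w : E d × Fin 2 => ENNReal.ofReal (G w.2 w.1) :=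
    measurable_uncurry_label (G := fun r x => ENNReal.ofReal (G r x)) hGm
  have hout : ∀ x, a ≤ ‖x - b‖ → ∀ r, F' r x = F r x := fun x hx r => subdens_congr (hpp x hx) r
  -- inside the ball the regression function is close to `1/2`
  have hin : ∀ x, ‖x - b‖ < a → ‖x - z j‖ ^ 2 ≤ 3 / 4 ∧ 23 / 50 ≤ ‖x - z j‖ ^ 2 + p x ∧
      ‖x - z j‖ ^ 2 + p x ≤ 27 / 50 := by
    intro x hx
    have h1 := abs_le.1 (hp x)
    have h2 : x - z j = (x - b) + (b - z j) := by abel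
    have h3 : b - z j = (x - z j) - (x - b) := by abel
    have h4 := norm_add_le (x - b) (b - z j)
    have h5 := norm_sub_le (x - z j) (x - b)
    rw [← h2] at h4
    rw [← h3] at h5
    have h6 : 7 / 10 ≤ ‖b - z j‖ := by nlinarith [norm_nonneg (b - z j)]
    have h7 : ‖b - z j‖ ≤ 71 / 100 := by nlinarith [norm_nonneg (b - z j)]
    have h8 := norm_nonneg (x - z j)
    exact ⟨by nlinarith, by nlinarith, by nlinarith⟩
  have hmul : ∀ r x, F r x * G r x = F' r x := by
    intro r x
    rcases lt_or_ge ‖x - b‖ a with hx | hx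
    · obtain ⟨h1, h2, h3⟩ := hin x hx
      refine mul_div_cancel₀ _ (ne_of_gt ?_)
      rcases fin_two_eq_or r 1 with rfl | rfl
      · rw [hFdef, h.subdens_one_eq h1]
        exact mul_pos h.δ_pos (by linarith)
      · rw [sub_self, hFdef, h.subdens_zero_eq h1]
        exact mul_pos h.δ_pos (by linarith)
    · simp only [hG, hout x hx]
      exact mul_div_cancel_of_imp' fun h0 => by rw [h0]
  refine ⟨fun w => ENNReal.ofReal (G w.2 w.1), hLm, ?_, ?_⟩
  · rw [jointLaw, jointLaw, ← withDensity_mul _ hF.measurable_weight hLm]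
    congr 1
    ext w
    rw [Pi.mul_apply, ← ENNReal.ofReal_mul (hF.nonneg _ _), hmul]
  · rw [lintegral_jointLaw hF (hLm.pow_const 2)]
    have hGn : ∀ r x, 0 ≤ G r x := fun r x => div_nonneg (hF'.nonneg r x) (hF.nonneg r x)
    have hpt : ∀ x, F 0 x * G 0 x ^ 2 + F 1 x * G 1 x ^ 2 ≤
        (F 0 x + F 1 x) + (Metric.ball b a).indicator (fun _ => 20 * δ * e ^ 2) x := by
      intro x
      have hG2 : ∀ r, F r x * G r x ^ 2 = F' r x * G r x := fun r => by rw [← hmul]; ring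
      rw [hG2, hG2]
      rcases lt_or_ge ‖x - b‖ a with hx | hx
      · rw [indicator_of_mem (mem_ball_iff_norm.2 hx)]
        obtain ⟨h1, h2, h3⟩ := hin x hx
        simp only [hG, hFdef, hFdef', h.subdens_one_eq h1, h.subdens_zero_eq h1]
        set η := ‖x - z j‖ ^ 2 + p x with hη
        have hη' : ‖x - z j‖ ^ 2 + p' x = η + (p' x - p x) := by rw [hη]; ring
        rw [hη']
        have hu := abs_le.1 (hpe x)
        set u := p' x - p x with hu'
        have hu2 : u ^ 2 ≤ 4 * e ^ 2 := by nlinarith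
        have hδ := h.δ_pos
        have e1 : δ * (1 - (η + u)) * (δ * (1 - (η + u)) / (δ * (1 - η))) +
            δ * (η + u) * (δ * (η + u) / (δ * η)) =
            δ + δ * (u ^ 2 / (η * (1 - η))) := by
          have h4 : (1 - η) ≠ 0 := by linarith
          have h5 : η ≠ 0 := by linarith
          field_simp
          ring
        rw [e1]
        -- `η' - η = u` with `|u| ≤ 2e`, and `η (1 - η) ≥ 1/5` turns `4e²` into `20e²`
        have h6 : (1 : ℝ) / 5 ≤ η * (1 - η) := by nlinarith
        have h7 : u ^ 2 / (η * (1 - η)) ≤ 20 * e ^ 2 := by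
          rw [div_le_iff₀ (by linarith)]
          nlinarith [sq_nonneg e]
        nlinarith
      · rw [indicator_of_notMem (by rw [mem_ball_iff_norm]; exact not_lt.2 hx), add_zero]
        have h1 : ∀ r, F' r x * G r x = F r x := fun r => by rw [hout x hx, hmul, hout x hx]
        rw [h1, h1]
    calc ∫⁻ x, (ENNReal.ofReal (F 0 x) * ENNReal.ofReal (G 0 x) ^ 2 +
            ENNReal.ofReal (F 1 x) * ENNReal.ofReal (G 1 x) ^ 2)
        ≤ ∫⁻ x, (ENNReal.ofReal (F 0 x + F 1 x) +
            (Metric.ball b a).indicator (fun _ => ENNReal.ofReal (20 * δ * e ^ 2)) x) := by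
          refine lintegral_mono fun x => ?_
          have h1 : ∀ r, ENNReal.ofReal (F r x) * ENNReal.ofReal (G r x) ^ 2 =
              ENNReal.ofReal (F r x * G r x ^ 2) := fun r => by
            rw [← ENNReal.ofReal_pow (hGn r x), ← ENNReal.ofReal_mul (hF.nonneg r x)]
          have hs : (Metric.ball b a).indicator (fun _ => ENNReal.ofReal (20 * δ * e ^ 2)) x =
              ENNReal.ofReal ((Metric.ball b a).indicator (fun _ => 20 * δ * e ^ 2) x) := by
            by_cases hx : x ∈ Metric.ball b a <;> simp [hx]
          have hi : 0 ≤ (Metric.ball b a).indicator (fun _ => 20 * δ * e ^ 2) x :=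
            indicator_nonneg (fun _ _ => by have := h.δ_pos; positivity) x
          dsimp only
          rw [h1, h1, hs, ← ENNReal.ofReal_add
            (mul_nonneg (hF.nonneg 0 x) (sq_nonneg _)) (mul_nonneg (hF.nonneg 1 x) (sq_nonneg _)),
            ← ENNReal.ofReal_add (add_nonneg (hF.nonneg 0 x) (hF.nonneg 1 x)) hi]
          exact ENNReal.ofReal_le_ofReal (hpt x)
      _ = ENNReal.ofReal (1 + 20 * δ * e ^ 2 * volume.real (Metric.ball b a)) := by
          have hδ := h.δ_pos
          rw [lintegral_add_right _ (measurable_const.indicator measurableSet_ball), hF.lintegral,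
            lintegral_indicator_const measurableSet_ball, ENNReal.ofReal_add zero_le_one
              (by positivity), ENNReal.ofReal_one,
            ENNReal.ofReal_mul (p := 20 * δ * e ^ 2) (by positivity),
            ofReal_measureReal measure_ball_lt_top.ne]

end LikelihoodRatio

section BumpFamily

variable {d : ℕ} {J κ : Type*} [Fintype J] [Fintype κ] {z : J → E d} {A δ a e : ℝ} {g : ℝ → ℝ}

/-- The signs of the perturbation: the regression function is raised where `σ k = 1`. -/
def signs (e : ℝ) (σ : κ → Fin 2) (k : κ) : ℝ := if σ k = 1 then e else -e

lemma abs_signs_le (he : 0 ≤ e) (σ : κ → Fin 2) (k : κ) : |signs e σ k| ≤ e := by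
  rw [signs]
  split_ifs
  · rw [abs_of_nonneg he]
  · rw [abs_neg, abs_of_nonneg he]

/-- Well-separated points on the spheres of squared radius `1/2` about the points `z j`, with a
radius `a` and a height `e` for the perturbations placed there. -/
structure IsBumpFamily (z : J → E d) (g : ℝ → ℝ) (i : κ → J) (c : κ → E d) (a e : ℝ) : Prop where
  a_pos : 0 < a
  a_le : a ≤ 1 / 100
  e_pos : 0 < e
  e_le : e ≤ 1 / 100
  sep : Pairwise fun k l => 2 * a < ‖c k - c l‖
  norm_sq : ∀ k, ‖c k - z (i k)‖ ^ 2 = 1 / 2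
  isPerturbation : ∀ σ : κ → Fin 2, IsPerturbation z g (bumpSum (signs e σ) a c)

variable {i : κ → J} {c : κ → E d}

/-- Two criteria control the modulus of continuity of the Hessian: at the scale `ε` either the
Hessian is at most `ε / 2`, or its Lipschitz constant is at most `ε / g ε`. -/
lemma isBumpFamily_of_bounds {B : ℝ} (hB : IsProfBound (E d) B) (ha : 0 < a) (ha1 : a ≤ 1 / 100)
    (he : 0 < e) (he1 : e ≤ 1 / 100) (hsep : Pairwise fun k l => 2 * a < ‖c k - c l‖)
    (hc : ∀ k, ‖c k - z (i k)‖ ^ 2 = 1 / 2) (h1 : e * a⁻¹ * B ≤ 1 / (100 * d))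
    (h2 : e * a⁻¹ * a⁻¹ * B ≤ 1 / 2)
    (h3 : ∀ ε ∈ Ioo (0 : ℝ) 1, 2 * (e * a⁻¹ * a⁻¹ * B) ≤ ε ∨
      2 * (e * a⁻¹ * a⁻¹ * a⁻¹ * B) * g ε ≤ ε) :
    IsBumpFamily z g i c a e := by
  have hB0 : 0 < B := zero_lt_one.trans_le hB.one_le
  refine ⟨ha, ha1, he, he1, hsep, hc, fun σ => ⟨bumpSum_contDiff (n := 2), fun x => ?_,
    fun x => ?_, fun x => ?_, fun ε hε x y hxy => ?_, fun x hx => ?_⟩⟩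
  · exact (abs_bumpSum_le ha hsep he.le (abs_signs_le he.le σ) x).trans he1
  · exact (norm_fderiv_bumpSum_le hB ha hsep he.le (abs_signs_le he.le σ) x).trans h1
  · exact (norm_fderiv_fderiv_bumpSum_le hB ha hsep he.le (abs_signs_le he.le σ) x).trans h2
  · rcases h3 ε hε with h4 | h4
    · refine le_trans ?_ h4
      have hx := norm_fderiv_fderiv_bumpSum_le hB ha hsep he.le (abs_signs_le he.le σ) x
      have hy := norm_fderiv_fderiv_bumpSum_le hB ha hsep he.le (abs_signs_le he.le σ) y
      refine (norm_sub_le (E := E d →L[ℝ] E d →L[ℝ] ℝ) _ _).trans ?_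
      linarith
    · refine (norm_fderiv_fderiv_bumpSum_sub_le hB ha hsep he.le
        (abs_signs_le he.le σ) x y).trans (le_trans ?_ h4)
      gcongr
  · obtain ⟨k, hk⟩ := exists_of_bumpSum_ne_zero ha hx
    refine ⟨i k, ?_⟩
    have h4 : x - z (i k) = (x - c k) + (c k - z (i k)) := by abel
    have h5 : c k - z (i k) = (x - z (i k)) - (x - c k) := by abel
    have h6 := norm_add_le (x - c k) (c k - z (i k))
    have h7 := norm_sub_le (x - z (i k)) (x - c k)
    rw [← h4] at h6
    rw [← h5] at h7
    have h8 := hc k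
    have h9 : 7 / 10 ≤ ‖c k - z (i k)‖ := by nlinarith [norm_nonneg (c k - z (i k))]
    have h10 : ‖c k - z (i k)‖ ≤ 71 / 100 := by nlinarith [norm_nonneg (c k - z (i k))]
    rw [abs_le]
    constructor <;> nlinarith [norm_nonneg (x - z (i k))]

/-- The region around `c k` on which the sign `σ k` decides the Bayes classifier. -/
def region (z : J → E d) (i : κ → J) (c : κ → E d) (a e : ℝ) (k : κ) : Set (E d) :=
  (fun x => x - z (i k)) ⁻¹' cell a e (c k - z (i k))

lemma volume_region (k : κ) :
    volume (region z i c a e k) = volume (cell a e (c k - z (i k))) :=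
  (measurePreserving_sub_right volume (z (i k))).measure_preimage
    (isClosed_cell _ _ _).measurableSet.nullMeasurableSet

lemma norm_sub_sq_le_of_mem_region {x : E d} {k : κ} (hx : x ∈ region z i c a e k) :
    ‖x - c k‖ ^ 2 ≤ 3 / 4 * a ^ 2 ∧ |‖x - z (i k)‖ ^ 2 - 1 / 2| ≤ e / 2 := by
  have h1 := hx.1
  rw [sub_sub_sub_cancel_right] at h1
  exact ⟨h1, hx.2⟩

namespace IsBumpFamily

lemma norm_sub_lt_of_mem_region (hc : IsBumpFamily z g i c a e) {x : E d} {k : κ}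
    (hx : x ∈ region z i c a e k) : ‖x - c k‖ < a := by
  have h1 := (norm_sub_sq_le_of_mem_region hx).1
  have h2 := hc.a_pos
  nlinarith [norm_nonneg (x - c k)]

lemma eq_of_mem_region (hc : IsBumpFamily z g i c a e) {x : E d} {k l : κ}
    (hk : x ∈ region z i c a e k) (hl : x ∈ region z i c a e l) : k = l := by
  by_contra hne
  have h1 := norm_sub_le (x - c l) (x - c k)
  rw [sub_sub_sub_cancel_left] at h1
  linarith [hc.sep hne, hc.norm_sub_lt_of_mem_region hk, hc.norm_sub_lt_of_mem_region hl]

/-- On the region around `c k` the subdensity of the class `σ k` exceeds the other one by `δ e`. -/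
lemma margin (hc : IsBumpFamily z g i c a e) (h : IsArrangement z A δ) (σ : κ → Fin 2) {k : κ}
    {x : E d} (hx : x ∈ region z i c a e k) :
    δ * e + subdens z A δ (bumpSum (signs e σ) a c) (1 - σ k) x ≤
      subdens z A δ (bumpSum (signs e σ) a c) (σ k) x := by
  obtain ⟨h1, h2⟩ := norm_sub_sq_le_of_mem_region hx
  have h3 := abs_le.1 h2
  have ha := hc.a_pos
  have he := hc.e_pos
  have he1 := hc.e_le
  have hδ := h.δ_pos
  have hj : ‖x - z (i k)‖ ^ 2 ≤ 3 / 4 := by linarith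
  have hpx : bumpSum (signs e σ) a c x = signs e σ k := by
    rw [bumpSum_eq_of_norm_lt ha hc.sep (hc.norm_sub_lt_of_mem_region hx), prof_eq_one, mul_one]
    rw [norm_smul, norm_inv, Real.norm_of_nonneg ha.le, mul_pow, inv_pow,
      inv_mul_le_iff₀ (by positivity)]
    linarith
  rcases fin_two_eq_or (σ k) 1 with hσ | hσ
  · rw [hσ, sub_self, h.subdens_one_eq hj, h.subdens_zero_eq hj, hpx, signs, if_pos hσ]
    nlinarith
  · rw [sub_self] at hσ
    rw [hσ, sub_zero, h.subdens_one_eq hj, h.subdens_zero_eq hj, hpx, signs, hσ,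
      if_neg zero_ne_one]
    nlinarith

/-- The lower bound by testing all the signs independently: changing one sign changes the law of
the whole sample by a bounded chi-square divergence. -/
lemma minimaxExcess_ge [Nonempty J] [DecidableEq κ] (hd : 1 ≤ d)
    (hc : IsBumpFamily z g i c a e) (h : IsArrangement z A δ) {K : Set (Distr d)} {n : ℕ}
    (hK : ∀ σ, (isSubdensity hd h (hc.isPerturbation σ)).distr ∈ K)
    (hn : n * (20 * δ * e ^ 2 * volume.real (Metric.ball (0 : E d) a)) ≤ 1 / 2) :
    δ * e / 4 * ∑ k, volume.real (cell a e (c k - z (i k))) ≤ minimaxExcess d n K := by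
  have hsum : ∑ k, volume.real (cell a e (c k - z (i k))) =
      ∑ k, volume.real (region z i c a e k) :=
    Finset.sum_congr rfl fun k _ => by rw [measureReal_def, measureReal_def, volume_region]
  rw [hsum]
  have hδ := h.δ_pos
  have he := hc.e_pos
  refine NNLower.minimaxExcess_ge (F := fun σ => subdens z A δ (bumpSum (signs e σ) a c))
    (fun σ => isSubdensity hd h (hc.isPerturbation σ)) hK
    (fun k => ((isClosed_cell _ _ _).preimage (by fun_prop)).measurableSet)
    (fun k => by
      change volume (region z i c a e k) ≠ ∞
      rw [volume_region]
      exact volume_cell_ne_top hc.a_pos _)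
    (fun x k l hk hl => hc.eq_of_mem_region hk hl) (by positivity)
    (fun σ k x hx => hc.margin h σ hx) fun σ k => ?_
  set σ' := Function.update σ k (1 - σ k) with hσ'
  have hout : ∀ x, a ≤ ‖x - c k‖ → bumpSum (signs e σ') a c x = bumpSum (signs e σ) a c x := by
    intro x hx
    refine Finset.sum_congr rfl fun l _ => ?_
    by_cases hl : l = k
    · rw [hl, prof_eq_zero, mul_zero, mul_zero]
      rw [norm_smul, norm_inv, Real.norm_of_nonneg hc.a_pos.le, le_inv_mul_iff₀ hc.a_pos, mul_one]
      exact hx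
    · rw [signs, signs, hσ', Function.update_of_ne hl]
  obtain ⟨L, hLm, hL, hL2⟩ := exists_likelihoodRatio h
    (isSubdensity hd h (hc.isPerturbation σ)) (isSubdensity hd h (hc.isPerturbation σ'))
    (hc.isPerturbation σ).abs_apply_le hc.a_le (hc.norm_sq k) (e := e) hout (fun x => by
      refine (abs_sub _ _).trans ?_
      linarith [abs_bumpSum_le hc.a_pos hc.sep he.le (abs_signs_le he.le σ) x,
        abs_bumpSum_le hc.a_pos hc.sep he.le (abs_signs_le he.le σ') x])
  refine ⟨L, hLm, hL, ?_⟩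
  set χ : ℝ := 20 * δ * e ^ 2 * volume.real (Metric.ball (c k) a) with hχ
  have hball : volume.real (Metric.ball (c k) a) = volume.real (Metric.ball (0 : E d) a) := by
    rw [measureReal_def, measureReal_def, Measure.addHaar_ball_center]
  have hχ0 : 0 ≤ χ := by positivity
  have hnχ : n * χ ≤ 1 / 2 := by rw [hχ, hball]; exact hn
  calc (∫⁻ w, L w ^ 2 ∂jointLaw (subdens z A δ (bumpSum (signs e σ) a c))) ^ n
      ≤ ENNReal.ofReal (1 + χ) ^ n := by gcongr
    _ = ENNReal.ofReal ((1 + χ) ^ n) := (ENNReal.ofReal_pow (by linarith) n).symm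
    _ ≤ ENNReal.ofReal 2 := by
        refine ENNReal.ofReal_le_ofReal ?_
        calc (1 + χ) ^ n ≤ Real.exp χ ^ n := by
              gcongr
              linarith [Real.add_one_le_exp χ]
          _ = Real.exp (n * χ) := (Real.exp_nat_mul χ n).symm
          _ ≤ Real.exp (1 / 2) := Real.exp_le_exp.2 hnχ
          _ ≤ 2 := by
              have h1 := Real.exp_one_lt_d9
              have h2 : Real.exp (1 / 2) ^ 2 = Real.exp 1 := by
                rw [← Real.exp_nat_mul]; norm_num
              nlinarith [Real.exp_pos (1 / 2)]
    _ = 2 := by simp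

end IsBumpFamily

end BumpFamily

/-! ### The choice of the parameters -/

section Parameters

variable {d : ℕ}

/-- Points on the lattice of mesh `4`, away from the coordinate hyperplanes. -/
def grid (d m : ℕ) (k : Fin d → Fin (m + 1)) : E d := WithLp.toLp 2 fun i => 4 * ((k i : ℝ) + 1)

lemma le_norm_grid (hd : 1 ≤ d) (m : ℕ) (k : Fin d → Fin (m + 1)) : 4 ≤ ‖grid d m k‖ := by
  refine le_trans ?_ (PiLp.norm_apply_le (grid d m k) ⟨0, hd⟩)
  change 4 ≤ ‖4 * ((k ⟨0, hd⟩ : ℝ) + 1)‖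
  rw [Real.norm_of_nonneg (by positivity)]
  have : (0 : ℝ) ≤ (k ⟨0, hd⟩ : ℝ) := Nat.cast_nonneg _
  linarith

lemma grid_sep (m : ℕ) : Pairwise fun k l => 4 ≤ ‖grid d m k - grid d m l‖ := by
  intro k l hkl
  obtain ⟨i, hi⟩ := Function.ne_iff.1 hkl
  refine le_trans ?_ (PiLp.norm_apply_le (grid d m k - grid d m l) i)
  change 4 ≤ ‖4 * ((k i : ℝ) + 1) - 4 * ((l i : ℝ) + 1)‖
  rw [← mul_sub, add_sub_add_right_eq_sub, norm_mul, Real.norm_ofNat]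
  have h1 : (1 : ℤ) ≤ |((k i : ℕ) : ℤ) - ((l i : ℕ) : ℤ)| :=
    Int.one_le_abs (sub_ne_zero.2 fun h => hi (Fin.ext (by exact_mod_cast h)))
  have h2 : (1 : ℝ) ≤ |((k i : ℕ) : ℝ) - ((l i : ℕ) : ℝ)| := by exact_mod_cast h1
  rw [Real.norm_eq_abs]
  linarith

lemma norm_grid_add_one_le (hd : 1 ≤ d) (m : ℕ) (k : Fin d → Fin (m + 1)) :
    ‖grid d m k‖ + 1 ≤ 5 * d * (m + 1) := by
  have hd1 : (1 : ℝ) ≤ d := by exact_mod_cast hd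
  have hm : (0 : ℝ) ≤ m := Nat.cast_nonneg m
  have h1 : ‖grid d m k‖ ^ 2 ≤ (4 * d * (m + 1)) ^ 2 := by
    rw [EuclideanSpace.norm_sq_eq]
    calc ∑ i, ‖grid d m k i‖ ^ 2 ≤ ∑ _i : Fin d, (4 * ((m : ℝ) + 1)) ^ 2 := by
          refine Finset.sum_le_sum fun i _ => ?_
          change ‖4 * ((k i : ℝ) + 1)‖ ^ 2 ≤ _
          rw [Real.norm_of_nonneg (by positivity)]
          have : (k i : ℝ) ≤ m := by exact_mod_cast Nat.lt_succ_iff.1 (k i).2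
          gcongr
      _ = d * (4 * ((m : ℝ) + 1)) ^ 2 := by simp
      _ ≤ (d * d) * (4 * ((m : ℝ) + 1)) ^ 2 := by
          gcongr
          nlinarith
      _ = _ := by ring
  have h2 : ‖grid d m k‖ ≤ 4 * d * (m + 1) := (sq_le_sq₀ (norm_nonneg _) (by positivity)).1 h1
  nlinarith

/-- The requirements on the parameters of the classes; `B` bounds the derivatives of the
profile. -/
structure IsAdmissible (d : ℕ) (B ρ γ lam M₀ ε₀ : ℝ) (l : ℝ → ℝ) : Prop where
  ρ_pos : 0 < ρ
  γ_pos : 0 < γ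
  γ_le : γ ≤ 2
  bound : IsProfBound (E d) B
  le_lam : 2 * (B * (∫ x : E d, prof x)⁻¹) ≤ lam
  three_le : 3 ≤ M₀
  ε_pos : 0 < ε₀
  ε_le : ε₀ ≤ 1 / 100
  ε_le_pow : ε₀ ≤ (1 / 2) ^ d
  ε_mul_le : ε₀ * M₀ ≤ 1 / 4
  le_l : ∀ δ, 0 < δ → 2 / ε₀ ≤ l δ

variable {B ρ γ lam M₀ ε₀ : ℝ} {l : ℝ → ℝ}

lemma mem_classes (hd : 1 ≤ d) (P : IsAdmissible d B ρ γ lam M₀ ε₀ l) {J : Type*} [Fintype J]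
    [Nonempty J] {z : J → E d} {A δ R c : ℝ} {g : ℝ → ℝ} {p : E d → ℝ}
    (h : IsArrangement z A δ) (hg : IsClassG g) (hp : IsPerturbation z g p) (hδ1 : δ ≤ 1)
    (hA : A ≤ (∫ x : E d, prof x)⁻¹) (hδ : δ ≤ (∫ x : E d, prof x)⁻¹) (hR0 : 0 ≤ R)
    (hR : ∀ j, ‖z j‖ + 1 ≤ R)
    (hmom : (A + Fintype.card J * (δ * R ^ ρ)) * ∫ x : E d, prof x ≤ M₀)
    (hc : ∀ (z : E d) (p : E d → ℝ) (S : Set (E d)),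
      (∀ x y, |p y - p x| ≤ 1 / (2 * d) * ‖y - x‖) →
      (∀ x ∈ S, ‖x - z‖ ^ 2 + p x = 1 / 2 ∧ 9 / 20 ≤ ‖x - z‖ ^ 2 ∧ ‖x - z‖ ≤ 1) →
      μHE[d - 1] S ≤ ENNReal.ofReal c)
    (hsurf : δ ^ ((d : ℝ) / (ρ + d)) * (Fintype.card J * c) ≤ M₀) :
    (isSubdensity hd h hp).distr ∈ classP d ε₀ M₀ ρ l g ∩ classQ d γ lam := by
  have hd1 : (1 : ℝ) ≤ d := by exact_mod_cast hd
  set hF := isSubdensity hd h hp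
  have hμ : margX hF.distr = volume.withDensity fun x => ENNReal.ofReal (dens z A δ x) := by
    rw [hF.margX_distr]
    simp_rw [subdens_zero_add_one]
  have hfin : IsFiniteMeasure (margX hF.distr) := by
    unfold margX
    infer_instance
  have hl : 0 ≤ l δ := le_trans (by have := P.ε_pos; positivity) (P.le_l δ h.δ_pos)
  refine ⟨hF.mem_classP subdens_zero_add_one (fun x => rfl)
    (marginalCond hd h hp hμ P.ε_le P.ε_le_pow (hδ1.trans (by linarith [P.three_le])) hl)
    (regressionCond hd h hp hg P.ε_pos P.ε_le P.ε_mul_le P.three_le P.le_l)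
    ⟨moment_le h hμ P.ρ_pos hR0 hR hmom,
      surface_le h hp (fun j S hS => hc (z j) p S (fun x y => ?_) hS) hsurf⟩,
    mem_classQ hF subdens_zero_add_one h P.bound hA hδ P.le_lam P.γ_pos P.γ_le⟩
  refine (hp.lipschitz x y).trans ?_
  gcongr
  norm_num

/-- The plateaus: about `R ^ d` of them at distance of order `R`, with height of order
`R ^ (-(ρ + d))`, the largest order that the moment and surface conditions allow. -/
lemma exists_arrangement (hd : 1 ≤ d) (P : IsAdmissible d B ρ γ lam M₀ ε₀ l) :
    ∃ κ : ℝ, 0 < κ ∧ 40 * κ * volume.real (Metric.ball (0 : E d) 1) ≤ 1 ∧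
      ∀ R : ℝ, 1 ≤ R → ∃ m : ℕ, R / 2 ≤ m + 1 ∧ ∃ (A : ℝ)
        (h : IsArrangement (grid d m) A (κ * R ^ (-(ρ + d)))), ∀ (g : ℝ → ℝ) (p : E d → ℝ)
          (_ : IsClassG g) (hp : IsPerturbation (grid d m) g p),
          (isSubdensity hd h hp).distr ∈ classP d ε₀ M₀ ρ l g ∩ classQ d γ lam := by
  have hρ := P.ρ_pos
  have hd1 : (1 : ℝ) ≤ d := by exact_mod_cast hd
  obtain ⟨c, hc0, hc⟩ := exists_surface_bound hd
  set I := ∫ x : E d, prof x with hI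
  have hI0 : 0 < I := prof_integral_pos
  set ω := volume.real (Metric.ball (0 : E d) 1) with hω
  have hω0 : 0 ≤ ω := measureReal_nonneg
  -- the bounds on `κ` serve the heights, the mass of the bulk, the moment condition, the surface
  -- condition, and the detection of single perturbations
  obtain ⟨κ, hκ0, hκ1, hκ2, hκ3, hκ4, hκ5⟩ : ∃ κ : ℝ, 0 < κ ∧ κ ≤ 1 ∧ κ ≤ 1 / (2 * I) ∧
      κ ≤ 1 / ((5 * d) ^ ρ * I) ∧ κ ≤ (1 / c) ^ ((ρ + d) / d) ∧ κ ≤ 1 / (40 * (ω + 1)) := by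
    refine ⟨min 1 (min (1 / (2 * I)) (min (1 / ((5 * d) ^ ρ * I))
      (min ((1 / c) ^ ((ρ + d) / d)) (1 / (40 * (ω + 1)))))), by positivity, ?_⟩
    simp
  refine ⟨κ, hκ0, ?_, fun R hR => ?_⟩
  · rw [le_div_iff₀ (by positivity)] at hκ5
    nlinarith
  have hR0 : 0 < R := by linarith
  set δ := κ * R ^ (-(ρ + d)) with hδ
  have hRd : R ^ (-(ρ + d)) = R ^ (-ρ) * (R ^ d)⁻¹ := by
    rw [neg_add, Real.rpow_add hR0, Real.rpow_neg hR0.le d, Real.rpow_natCast]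
  have hδ0 : 0 < δ := by positivity
  have hδκ : δ ≤ κ := mul_le_of_le_one_right hκ0.le
    (Real.rpow_le_one_of_one_le_of_nonpos hR (by linarith))
  have hm1 : 1 ≤ ⌊R⌋₊ := Nat.le_floor (by exact_mod_cast hR)
  obtain ⟨m, hm⟩ : ∃ m : ℕ, ⌊R⌋₊ = m + 1 := ⟨⌊R⌋₊ - 1, by omega⟩
  have hmR : (m : ℝ) + 1 ≤ R := by
    have := Nat.floor_le hR0.le
    rw [hm] at this
    exact_mod_cast this
  have hmR' : R / 2 ≤ m + 1 := by
    have := Nat.lt_floor_add_one R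
    rw [hm] at this
    push_cast at this
    have : (0 : ℝ) ≤ m := Nat.cast_nonneg m
    linarith
  have hcard : (Fintype.card (Fin d → Fin (m + 1)) : ℝ) = ((m : ℝ) + 1) ^ d := by simp
  have hN : ((m : ℝ) + 1) ^ d ≤ R ^ d := by gcongr
  have hNδ : ((m : ℝ) + 1) ^ d * δ ≤ κ * R ^ (-ρ) := by
    calc ((m : ℝ) + 1) ^ d * δ ≤ R ^ d * δ := by gcongr
      _ = κ * R ^ (-ρ) := by rw [hδ, hRd]; field_simp
  have hRρ : R ^ (-ρ) ≤ 1 := Real.rpow_le_one_of_one_le_of_nonpos hR (by linarith)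
  have hNκ : ((m : ℝ) + 1) ^ d * δ ≤ κ := hNδ.trans (mul_le_of_le_one_right hκ0.le hRρ)
  have h2I : 1 / (2 * I) < I⁻¹ := by
    rw [one_div, mul_inv]
    have := inv_pos.2 hI0
    linarith
  -- the height of the bulk makes up for the mass of the plateaus
  have h : IsArrangement (grid d m) (I⁻¹ - ((m : ℝ) + 1) ^ d * δ) δ := by
    refine ⟨le_norm_grid hd m, grid_sep m, by linarith, hδ0, ?_⟩
    rw [hcard, sub_add_cancel, inv_mul_cancel₀ hI0.ne']
  refine ⟨m, hmR', _, h, fun g p hg hp => ?_⟩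
  refine mem_classes hd P h hg hp (R := 5 * d * R) (hδκ.trans hκ1)
    (sub_le_self _ (by positivity)) (by linarith) (by positivity)
    (fun j => (norm_grid_add_one_le hd m j).trans (by gcongr)) ?_ hc ?_
  · rw [hcard, Real.mul_rpow (by positivity) hR0.le]
    have h1 : ((m : ℝ) + 1) ^ d * (δ * ((5 * d) ^ ρ * R ^ ρ)) ≤ κ * (5 * d) ^ ρ := by
      calc ((m : ℝ) + 1) ^ d * (δ * ((5 * d) ^ ρ * R ^ ρ))
          = (((m : ℝ) + 1) ^ d * δ) * ((5 * d) ^ ρ * R ^ ρ) := by ring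
        _ ≤ (κ * R ^ (-ρ)) * ((5 * d) ^ ρ * R ^ ρ) := by gcongr
        _ = κ * (5 * d) ^ ρ * (R ^ (-ρ) * R ^ ρ) := by ring
        _ = κ * (5 * d) ^ ρ := by rw [← Real.rpow_add hR0]; simp
    have h2 : κ * ((5 * d) ^ ρ * I) ≤ 1 := by rwa [le_div_iff₀ (by positivity)] at hκ3
    have h3 : 0 ≤ ((m : ℝ) + 1) ^ d * δ := by positivity
    calc (I⁻¹ - ((m : ℝ) + 1) ^ d * δ + ((m : ℝ) + 1) ^ d * (δ * ((5 * d) ^ ρ * R ^ ρ))) * I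
        ≤ (I⁻¹ + κ * (5 * d) ^ ρ) * I := by gcongr; linarith
      _ = 1 + κ * ((5 * d) ^ ρ * I) := by rw [add_mul, inv_mul_cancel₀ hI0.ne']; ring
      _ ≤ M₀ := by linarith [P.three_le]
  · rw [hcard]
    have h1 : κ ^ ((d : ℝ) / (ρ + d)) ≤ 1 / c := by
      calc κ ^ ((d : ℝ) / (ρ + d)) ≤ ((1 / c) ^ ((ρ + d) / d)) ^ ((d : ℝ) / (ρ + d)) := by gcongr
        _ = 1 / c := by
          rw [← Real.rpow_mul (by positivity), div_mul_div_cancel₀ (by positivity),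
            div_self (by positivity), Real.rpow_one]
    have h2 : δ ^ ((d : ℝ) / (ρ + d)) = κ ^ ((d : ℝ) / (ρ + d)) * (R ^ d)⁻¹ := by
      rw [hδ, Real.mul_rpow hκ0.le (by positivity), ← Real.rpow_mul hR0.le, neg_mul,
        mul_div_cancel₀ _ (by positivity), Real.rpow_neg hR0.le, Real.rpow_natCast]
    rw [h2]
    calc κ ^ ((d : ℝ) / (ρ + d)) * (R ^ d)⁻¹ * (((m : ℝ) + 1) ^ d * c)
        ≤ 1 / c * (R ^ d)⁻¹ * (R ^ d * c) := by gcongr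
      _ = 1 := by field_simp
      _ ≤ M₀ := by linarith [P.three_le]

/-- The centres of the perturbations: copies of the same points of the sphere around all the
points `z j`. -/
lemma centres_sep {J : Type*} {z : J → E d} (hz : Pairwise fun j j' => 4 ≤ ‖z j - z j'‖) {a : ℝ}
    (ha : a ≤ 1 / 100) {Y : Finset (E d)} (hY : ∀ y ∈ Y, ‖y‖ ^ 2 = 1 / 2)
    (hsep : ∀ x ∈ Y, ∀ y ∈ Y, x ≠ y → 2 * a < ‖x - y‖) :
    Pairwise fun k l : J × Y => 2 * a < ‖(z k.1 + k.2) - (z l.1 + l.2)‖ := by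
  rintro ⟨j, y, hy⟩ ⟨j', y', hy'⟩ hne
  by_cases hj : j = j'
  · subst hj
    simp only [add_sub_add_left_eq_sub]
    exact hsep y hy y' hy' fun h => hne (by subst h; rfl)
  · have h1 : 4 ≤ ‖z j - z j'‖ := hz hj
    have h2 : z j - z j' = ((z j + y) - (z j' + y')) - (y - y') := by abel
    have h3 := norm_sub_le ((z j + y) - (z j' + y')) (y - y')
    have h4 := norm_sub_le y y'
    rw [← h2] at h3
    have h5 : ‖y‖ ≤ 1 := by nlinarith [hY y hy, norm_nonneg y]
    have h6 : ‖y'‖ ≤ 1 := by nlinarith [hY y' hy', norm_nonneg y']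
    change 2 * a < ‖(z j + y) - (z j' + y')‖
    linarith

/-- The admissible height of the perturbations at scale `r`: the Hessians are of order
`t = g⁻¹(r)`, and the slope bound on `g` takes care of the scales below `t`. -/
lemma isBumpFamily_of_slope {J κ : Type*} [Fintype J] [Fintype κ] {z : J → E d} {g : ℝ → ℝ}
    {i : κ → J} {c : κ → E d} {c₁ K r t : ℝ} (hB : IsProfBound (E d) B) (hd : (1 : ℝ) ≤ d)
    (hc₁ : 0 < c₁) (hBK : 200 * c₁ * B * K ≤ 1) (hBd : 200 * c₁ * B * d ≤ 1)
    (hr0 : 0 < r) (hr1 : r ≤ 1) (ht0 : 0 < t) (ht1 : t ≤ 1)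
    (hslope : ∀ ε ∈ Ioo (0 : ℝ) 1, ε < t → g ε * t ≤ K * ε * r)
    (hsep : Pairwise fun k l => 2 * (r / 100) < ‖c k - c l‖)
    (hc : ∀ k, ‖c k - z (i k)‖ ^ 2 = 1 / 2) :
    IsBumpFamily z g i c (r / 100) (c₁ * t * (r / 100) ^ 2) := by
  have hB1 := hB.one_le
  have hc₁B : 200 * (c₁ * B) ≤ 1 := by
    calc 200 * (c₁ * B) ≤ 200 * (c₁ * B) * d := le_mul_of_one_le_right (by positivity) hd
      _ ≤ 1 := by linarith
  have hc₁1 : 200 * c₁ ≤ 1 := by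
    calc 200 * c₁ ≤ 200 * c₁ * B := le_mul_of_one_le_right (by positivity) hB1
      _ ≤ 1 := by linarith
  set a := r / 100 with ha
  have ha0 : 0 < a := by positivity
  have ha1 : a ≤ 1 / 100 := by rw [ha]; linarith
  have e1 : c₁ * t * a ^ 2 * a⁻¹ = c₁ * t * a := by field_simp
  have e2 : c₁ * t * a ^ 2 * a⁻¹ * a⁻¹ = c₁ * t := by field_simp
  have e3 : c₁ * t * a ^ 2 * a⁻¹ * a⁻¹ * a⁻¹ = 100 * c₁ * t / r := by
    rw [e2, ha]; field_simp
  refine isBumpFamily_of_bounds hB ha0 ha1 (by positivity) ?_ hsep hc ?_ ?_ ?_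
  · calc c₁ * t * a ^ 2 ≤ (1 / 200) * 1 * 1 ^ 2 := by gcongr <;> linarith
      _ ≤ 1 / 100 := by norm_num
  · rw [e1, le_div_iff₀ (by positivity)]
    calc c₁ * t * a * B * (100 * d) = (200 * c₁ * B * d) * (t * (a / 2)) := by ring
      _ ≤ 1 * (1 * 1) := by gcongr; linarith
      _ = 1 := by norm_num
  · rw [e2]
    calc c₁ * t * B = (200 * (c₁ * B)) * t / 200 := by ring
      _ ≤ 1 * 1 / 200 := by gcongr
      _ ≤ 1 / 2 := by norm_num
  · intro ε hε
    have hε0 := hε.1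
    rcases le_or_gt t ε with hle | hlt
    · left
      rw [e2]
      calc 2 * (c₁ * t * B) = (200 * (c₁ * B)) * t / 100 := by ring
        _ ≤ 1 * ε / 100 := by gcongr
        _ ≤ ε := by linarith
    · right
      rw [e3]
      have h1 := hslope ε hε hlt
      have h2 : 2 * (100 * c₁ * t / r * B) * g ε = 200 * c₁ * B * (g ε * t) / r := by ring
      rw [h2, div_le_iff₀ hr0]
      calc 200 * c₁ * B * (g ε * t) ≤ 200 * c₁ * B * (K * ε * r) := by gcongr
        _ = (200 * c₁ * B * K) * (ε * r) := by ring
        _ ≤ 1 * (ε * r) := by gcongr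
        _ = ε * r := one_mul _

/-- The lower bound in terms of the scale `1 / q` of the perturbations, for all sample sizes up to
the one at which perturbations of that scale become detectable. -/
theorem exists_lower_bound (hd : 1 ≤ d) (P : IsAdmissible d B ρ γ lam M₀ ε₀ l) {g : ℝ → ℝ}
    (hg : IsClassG g)
    (hmono : ∃ r₀ : ℝ, 0 < r₀ ∧ MonotoneOn (fun r => r / gInv g r) (Ioo 0 r₀)) :
    ∃ c : ℝ, 0 < c ∧ ∀ (n : ℕ) (ν q : ℝ), 0 ≤ ν → 1 / supNorm g < q →
      (n : ℝ) ≤ q ^ rateDenom d ρ ν / gInv g (1 / q) ^ 2 →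
      c * gInv g (1 / q) ^ 2 * q ^ (-(4 + ν * ρ)) ≤
        minimaxExcess d n (classP d ε₀ M₀ ρ l g ∩ classQ d γ lam) := by
  have hρ := P.ρ_pos
  have hd1 : (1 : ℝ) ≤ d := by exact_mod_cast hd
  obtain ⟨κ, hκ0, hκω, harr⟩ := exists_arrangement hd P
  obtain ⟨K, hK1, hK⟩ := hg.exists_slope_bound hmono
  have hB := P.bound.one_le
  set ω := volume.real (Metric.ball (0 : E d) 1) with hω
  have hω0 : 0 < ω := by
    rw [hω, measureReal_def]
    exact ENNReal.toReal_pos (Metric.measure_ball_pos _ _ one_pos).ne' measure_ball_lt_top.ne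
  -- `B` and `K` enter through the modulus of the Hessian, `d` through the gradient of the
  -- perturbation
  set c₁ : ℝ := 1 / (200 * B * K * d) with hc₁
  have hc₁0 : 0 < c₁ := by positivity
  have hBK : 1 ≤ B * K := one_le_mul_of_one_le_of_one_le hB hK1
  have hc₁d : 200 * c₁ * B * K * d = 1 := by rw [hc₁]; field_simp
  have hc₁BK : 200 * c₁ * B * K ≤ 1 := by
    rw [← hc₁d]
    exact le_mul_of_one_le_right (by positivity) hd1
  have hc₁Bd : 200 * c₁ * B * d ≤ 1 := by
    rw [← hc₁d]
    calc 200 * c₁ * B * d ≤ (200 * c₁ * B * d) * K := le_mul_of_one_le_right (by positivity) hK1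
      _ = _ := by ring
  have hc₁B : 200 * c₁ * B ≤ 1 :=
    le_trans (le_mul_of_one_le_right (by positivity) hd1) hc₁Bd
  have hc₁1 : 200 * c₁ ≤ 1 := le_trans (le_mul_of_one_le_right (by positivity) hB) hc₁B
  refine ⟨κ * c₁ ^ 2 * ω / (12 * 32 ^ d * 2 ^ d * 100 ^ 4), by positivity,
    fun n ν q hν hq hn => ?_⟩
  have hs0 := hg.supNorm_pos
  have hs1 := hg.supNorm_le_one
  have hq1 : 1 < q := lt_of_le_of_lt ((one_le_div hs0).2 hs1) hq
  have hq0 : 0 < q := by linarith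
  set r := 1 / q with hr
  have hr0 : 0 < r := by positivity
  have hr1 : r ≤ 1 := (div_le_one hq0).2 hq1.le
  set t := gInv g r with ht
  have ht0 : 0 < t := hg.gInv_pos hr0
  have ht1 : t ≤ 1 := gInv_le_one g r
  set R := q ^ ν with hR
  have hR1 : 1 ≤ R := Real.one_le_rpow hq1.le hν
  obtain ⟨m, hm, A, h, hmem⟩ := harr R hR1
  set δ := κ * R ^ (-(ρ + d)) with hδ
  have hδ0 : 0 < δ := h.δ_pos
  set a := r / 100 with ha
  have ha0 : 0 < a := by positivity
  have ha1 : a ≤ 1 / 100 := by rw [ha]; linarith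
  set e := c₁ * t * a ^ 2 with he
  have he0 : 0 < e := by positivity
  have hct : c₁ * t ≤ 1 / 200 := by nlinarith
  have hea : e ≤ a / 10 := by
    rw [he]
    nlinarith [mul_le_mul hct (le_refl (a ^ 2)) (by positivity) (by norm_num)]
  obtain ⟨Y, hY1, hY2, hY3⟩ := exists_separated_cells (d := d) hd ha0 ha1 he0 hea
  let i : (Fin d → Fin (m + 1)) × Y → Fin d → Fin (m + 1) := Prod.fst
  let c : (Fin d → Fin (m + 1)) × Y → E d := fun k => grid d m k.1 + k.2
  have hcz : ∀ k, c k - grid d m (i k) = k.2 := fun k => add_sub_cancel_left _ _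
  have hfam : IsBumpFamily (grid d m) g i c a e :=
    isBumpFamily_of_slope P.bound hd1 hc₁0 hc₁BK hc₁Bd hr0 hr1 ht0 ht1
      (fun ε hε hlt => hK r ε hr0 hε hlt) (centres_sep h.sep ha1 hY1 hY2)
      (fun k => by rw [hcz]; exact hY1 _ k.2.2)
  have hqR : q ^ rateDenom d ρ ν = q ^ 4 * q ^ d * R ^ (ρ + d) := by
    rw [rateDenom, Real.rpow_add hq0, Real.rpow_add hq0, Real.rpow_mul hq0.le,
      Real.rpow_natCast]
    norm_cast
  have hRR : R ^ (-(ρ + d)) * R ^ (ρ + d) = 1 := by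
    rw [← Real.rpow_add (by linarith)]; simp
  have hrq : r * q = 1 := by rw [hr]; field_simp
  -- the side goal left open here is that a single sign cannot be detected from `n` observations
  have hmain := hfam.minimaxExcess_ge hd h (n := n)
    (fun σ => hmem g _ hg (hfam.isPerturbation σ)) ?_
  · refine le_trans ?_ hmain
    have hsum : ∑ k : (Fin d → Fin (m + 1)) × Y,
        volume.real (cell a e (c k - grid d m (i k))) =
        ((m : ℝ) + 1) ^ d * ∑ y ∈ Y, volume.real (cell a e y) := by
      simp_rw [hcz]
      rw [Fintype.sum_prod_type]
      simp only [Finset.sum_const, Finset.card_univ, nsmul_eq_mul, Fintype.card_pi, Fintype.card_fin,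
        Finset.prod_const]
      rw [Finset.sum_coe_sort Y fun y => volume.real (cell a e y)]
      push_cast
      rfl
    rw [hsum]
    have hRd : R ^ (-(ρ + d)) * R ^ d = R ^ (-ρ) := by
      rw [← Real.rpow_natCast R d, ← Real.rpow_add (by linarith)]
      congr 1; ring
    have hqν : q ^ (-(4 + ν * ρ)) = r ^ 4 * R ^ (-ρ) := by
      rw [neg_add, Real.rpow_add hq0, hR, ← Real.rpow_mul hq0.le, Real.rpow_neg hq0.le, hr,
        one_div, inv_pow, mul_neg]
      norm_cast
    calc κ * c₁ ^ 2 * ω / (12 * 32 ^ d * 2 ^ d * 100 ^ 4) * t ^ 2 * q ^ (-(4 + ν * ρ))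
        = δ * e / 4 * ((R / 2) ^ d * (ω / (3 * 32 ^ d) * e)) := by
          rw [hqν, ← hRd, hδ, he, ha]
          simp only [div_pow]
          ring
      _ ≤ δ * e / 4 * (((m : ℝ) + 1) ^ d * ∑ y ∈ Y, volume.real (cell a e y)) := by
          gcongr
  · have hvol : volume.real (Metric.ball (0 : E d) a) = a ^ d * ω := by
      rw [measureReal_def, Measure.addHaar_ball_of_pos _ _ ha0, ENNReal.toReal_mul,
        ENNReal.toReal_ofReal (by positivity), finrank_euclideanSpace_fin, hω, measureReal_def]
    rw [hvol]
    rw [le_div_iff₀ (by positivity), hqR] at hn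
    calc n * (20 * δ * e ^ 2 * (a ^ d * ω))
        = (n * t ^ 2) * (20 * κ * ω * c₁ ^ 2 * R ^ (-(ρ + d)) * (a ^ 4 * a ^ d)) := by
          rw [hδ, he]; ring
      _ ≤ (q ^ 4 * q ^ d * R ^ (ρ + d)) *
          (20 * κ * ω * c₁ ^ 2 * R ^ (-(ρ + d)) * (r ^ 4 * r ^ d)) := by
          have har : a ≤ r := by rw [ha]; linarith
          gcongr
      _ = 20 * κ * ω * c₁ ^ 2 * ((r * q) ^ 4 * (r * q) ^ d *
          (R ^ (-(ρ + d)) * R ^ (ρ + d))) := by ring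
      _ = 20 * κ * ω * c₁ ^ 2 := by rw [hrq, hRR]; ring
      _ ≤ 20 * κ * ω * 1 ^ 2 := by gcongr; linarith
      _ ≤ 1 / 2 := by linarith

end Parameters

/-! ### The rate -/

section Rate

variable {d : ℕ}

/-- At a solution of the rate equation the rate is `g⁻¹(1/q)² q ^ (-(4 + νρ))`. -/
lemma rate_eq_of_solvesRate {n : ℕ} {ρ ν q : ℝ} {g : ℝ → ℝ} (hg : IsClassG g) (hρ : 0 < ρ)
    (hν : 0 ≤ ν) (hq : SolvesRate d n ρ ν g q) :
    gInv g (1 / q) ^ (2 * d * (1 + ν) / rateDenom d ρ ν) *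
      (n : ℝ) ^ (-((4 + ν * ρ) / rateDenom d ρ ν)) =
      gInv g (1 / q) ^ 2 * q ^ (-(4 + ν * ρ)) := by
  obtain ⟨hq1, hq2⟩ := hq
  have hq0 : 0 < q := lt_trans (one_div_pos.2 hg.supNorm_pos) hq1
  have ht : 0 < gInv g (1 / q) := hg.gInv_pos (one_div_pos.2 hq0)
  have hD := rateDenom_pos (d := d) hρ hν
  set t := gInv g (1 / q)
  set D := rateDenom d ρ ν with hDdef
  rw [← hq2, Real.div_rpow (by positivity) (by positivity), ← Real.rpow_mul hq0.le,
    ← Real.rpow_natCast t 2, ← Real.rpow_mul ht.le, mul_div_assoc', div_eq_mul_inv,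
    ← Real.rpow_neg ht.le, mul_right_comm, ← Real.rpow_add ht]
  congr 2
  · rw [hDdef] at hD ⊢
    field_simp
    rw [rateDenom]
    push_cast
    ring
  · field_simp

/-- The exponents available for `ν ≥ 0` approach `min {4 / (4 + d), ρ / (ρ + d)}`: the first value
is attained at `ν = 0`, the second one is the limit as `ν → ∞`. -/
lemma exists_exponent_le {ρ ε : ℝ} (hρ : 0 < ρ) (hε : 0 < ε) :
    ∃ ν : ℝ, 0 ≤ ν ∧
      (4 + ν * ρ) / rateDenom d ρ ν ≤ min (4 / (4 + (d : ℝ))) (ρ / (ρ + d)) + ε := by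
  have hd : (0 : ℝ) ≤ d := Nat.cast_nonneg d
  rcases le_total (4 / (4 + (d : ℝ))) (ρ / (ρ + d)) with h | h
  · refine ⟨0, le_rfl, ?_⟩
    rw [min_eq_left h, rateDenom]
    simp only [zero_mul, add_zero]
    linarith
  · refine ⟨4 / (ε * (ρ + d)), by positivity, ?_⟩
    rw [min_eq_right h]
    set ν := 4 / (ε * (ρ + d)) with hν
    have hν0 : 0 ≤ ν := by positivity
    have hD := rateDenom_pos (d := d) hρ hν0
    have h1 : ε * (ν * (ρ + d)) = 4 := by rw [hν]; field_simp
    have h2 : 4 ≤ ε * rateDenom d ρ ν := by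
      rw [← h1, rateDenom]
      gcongr
      linarith
    rw [div_le_iff₀ hD, add_mul]
    have h3 : ρ / (ρ + d) * rateDenom d ρ ν = ρ / (ρ + d) * (4 + d) + ν * ρ := by
      rw [rateDenom]; field_simp
    have h4 : 0 ≤ ρ / (ρ + d) * (4 + d) := by positivity
    rw [h3]
    linarith

/-- The polynomial lower bound, from scales `1 / q` with `q` a multiple of the `D`-th root of the
sample size, `D = rateDenom d ρ ν`. The inverse `g⁻¹` decays more slowly than every power, so it
costs an arbitrarily small exponent. -/
lemma exists_polynomial_lower_bound {ρ ε c : ℝ} {g : ℝ → ℝ} {m : ℕ → ℝ} (hg : IsClassG g)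
    (hρ : 0 < ρ) (hε : 0 < ε) (hc : 0 < c)
    (h : ∀ (n : ℕ) (ν q : ℝ), 0 ≤ ν → 1 / supNorm g < q →
      (n : ℝ) ≤ q ^ rateDenom d ρ ν / gInv g (1 / q) ^ 2 →
      c * gInv g (1 / q) ^ 2 * q ^ (-(4 + ν * ρ)) ≤ m n) :
    ∃ c : ℝ, 0 < c ∧ ∀ n : ℕ, 1 ≤ n →
      c * (n : ℝ) ^ (-(min (4 / (4 + (d : ℝ))) (ρ / (ρ + d)) + ε)) ≤ m n := by
  -- half of `ε` goes to the exponent, the other half to the power `τ` lost in `g⁻¹`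
  obtain ⟨ν, hν, hνε⟩ := exists_exponent_le (d := d) hρ (half_pos hε)
  have hD := rateDenom_pos (d := d) hρ hν
  set D := rateDenom d ρ ν
  set μ := min (4 / (4 + (d : ℝ))) (ρ / (ρ + d))
  set τ := ε * D / 4 with hτ
  have hτ0 : 0 < τ := by positivity
  obtain ⟨b, hb0, hb⟩ := hg.exists_rpow_le_gInv hτ0
  have hs0 := hg.supNorm_pos
  have hs1 := hg.supNorm_le_one
  -- the factor `Q` keeps `q` above `1 / ‖g‖_∞` even for `n = 1`
  set Q := 2 / supNorm g with hQ
  have hQ0 : 0 < Q := by positivity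
  have hQs : 1 / supNorm g < Q := by
    rw [hQ]
    gcongr
    norm_num
  have hQ1 : 1 ≤ Q := ((one_le_div hs0).2 hs1).trans hQs.le
  set S := 4 + ν * ρ + 2 * τ with hS
  refine ⟨c * b ^ 2 * Q ^ (-S), by positivity, fun n hn => ?_⟩
  have hn1 : (1 : ℝ) ≤ n := by exact_mod_cast hn
  have hn0 : (0 : ℝ) < n := by linarith
  set N := (n : ℝ) ^ (1 / D) with hN
  have hN1 : 1 ≤ N := Real.one_le_rpow hn1 (by positivity)
  have hqN : Q ≤ Q * N := le_mul_of_one_le_right hQ0.le hN1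
  set q := Q * N with hq
  have hq1 : 1 / supNorm g < q := hQs.trans_le hqN
  have hq1' : 1 < q := lt_of_le_of_lt ((one_le_div hs0).2 hs1) hq1
  have hq0 : 0 < q := by linarith
  have hr : 1 / q ∈ Ioo (0 : ℝ) 1 := ⟨by positivity, (div_lt_one hq0).2 hq1'⟩
  have ht := hg.gInv_pos hr.1
  have hND : N ^ D = n := by rw [hN, ← Real.rpow_mul hn0.le, one_div_mul_cancel hD.ne', Real.rpow_one]
  have hnq : (n : ℝ) ≤ q ^ D / gInv g (1 / q) ^ 2 := by
    rw [le_div_iff₀ (by positivity), hq, Real.mul_rpow hQ0.le (by linarith), hND, mul_comm]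
    have h1 : gInv g (1 / q) ^ 2 ≤ 1 := pow_le_one₀ ht.le (gInv_le_one g _)
    have h2 : 1 ≤ Q ^ D := Real.one_le_rpow hQ1 hD.le
    gcongr
    exact h1.trans h2
  refine le_trans ?_ (h n ν q hν hq1 hnq)
  have h3 : (b * (1 / q) ^ τ) ^ 2 ≤ gInv g (1 / q) ^ 2 := by
    have := hb _ hr
    have := hr.1
    gcongr
  have h4 : (b * (1 / q) ^ τ) ^ 2 * q ^ (-(4 + ν * ρ)) = b ^ 2 * q ^ (-S) := by
    rw [one_div, Real.inv_rpow hq0.le, ← Real.rpow_neg hq0.le, mul_pow, ← Real.rpow_natCast,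
      ← Real.rpow_natCast (q ^ (-τ)), ← Real.rpow_mul hq0.le, mul_assoc, ← Real.rpow_add hq0, hS]
    congr 2
    push_cast
    ring
  have h5 : (n : ℝ) ^ (-(μ + ε)) ≤ N ^ (-S) := by
    rw [hN, ← Real.rpow_mul hn0.le]
    refine Real.rpow_le_rpow_of_exponent_le hn1 ?_
    have h6 : S / D = (4 + ν * ρ) / D + ε / 2 := by
      rw [hS, hτ]; field_simp; ring
    have h7 : 1 / D * -S = -(S / D) := by ring
    rw [h7, h6]
    linarith
  calc c * b ^ 2 * Q ^ (-S) * (n : ℝ) ^ (-(μ + ε)) ≤ c * b ^ 2 * Q ^ (-S) * N ^ (-S) := by gcongr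
    _ = c * (b ^ 2 * q ^ (-S)) := by rw [hq, Real.mul_rpow hQ0.le (by linarith)]; ring
    _ = c * (b * (1 / q) ^ τ) ^ 2 * q ^ (-(4 + ν * ρ)) := by rw [← h4]; ring
    _ ≤ c * gInv g (1 / q) ^ 2 * q ^ (-(4 + ν * ρ)) := by gcongr

end Rate

end NNLower

end

theorem theorem4 (d : ℕ) (hd : 1 ≤ d) :
    ∃ lamStar epsStar MStar : ℝ, 0 < lamStar ∧ 0 < epsStar ∧ 0 < MStar ∧
      ∀ (ρ : ℝ) (g : ℝ → ℝ) (γ : ℝ), 0 < ρ → NNLower.IsClassG g →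
        (∃ r₀ : ℝ, 0 < r₀ ∧ MonotoneOn (fun r => r / NNLower.gInv g r) (Ioo 0 r₀)) →
        0 < γ → γ ≤ 2 →
      ∀ (lam M₀ ε₀ : ℝ) (l : ℝ → ℝ), lamStar ≤ lam → MStar ≤ M₀ → 1 ≤ M₀ →
        0 < ε₀ → ε₀ ≤ epsStar → ε₀ ≤ 1 / (4 * M₀) →
        NNLower.IsClassL l → (∀ δ, 0 < δ → 2 / ε₀ ≤ l δ) →
      (∀ (n : ℕ) (ν : ℝ), 1 ≤ n → 0 ≤ ν →
        NNLower.supNorm g ^ (-NNLower.rateDenom d ρ ν) < n →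
        ∃! q : ℝ, NNLower.SolvesRate d n ρ ν g q) ∧
      (∃ c : ℝ, 0 < c ∧ ∀ (n : ℕ) (ν q : ℝ), 1 ≤ n → 0 ≤ ν → NNLower.SolvesRate d n ρ ν g q →
        c * NNLower.gInv g (1 / q) ^ (2 * d * (1 + ν) / NNLower.rateDenom d ρ ν) *
            (n : ℝ) ^ (-((4 + ν * ρ) / NNLower.rateDenom d ρ ν)) ≤
          NNLower.minimaxExcess d n
            (NNLower.classP d ε₀ M₀ ρ l g ∩ NNLower.classQ d γ lam)) ∧
      (∀ ε : ℝ, 0 < ε → ∃ c : ℝ, 0 < c ∧ ∀ n : ℕ, 1 ≤ n →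
        c * (n : ℝ) ^ (-(min (4 / (4 + (d : ℝ))) (ρ / (ρ + d)) + ε)) ≤
          NNLower.minimaxExcess d n
            (NNLower.classP d ε₀ M₀ ρ l g ∩ NNLower.classQ d γ lam)) := by
  obtain ⟨B, hB⟩ := NNLower.exists_isProfBound (NNLower.E d)
  have hB1 := hB.one_le
  have hI : 0 < ∫ x : NNLower.E d, NNLower.prof x := NNLower.prof_integral_pos
  refine ⟨2 * (B * (∫ x : NNLower.E d, NNLower.prof x)⁻¹), min (1 / 100) ((1 / 2) ^ d), 3,
    by positivity, by positivity, by norm_num, ?_⟩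
  intro ρ g γ hρ hg hmono hγ hγ2 lam M₀ ε₀ l hlam hM hM1 hε hε1 hεM _ hl
  have P : NNLower.IsAdmissible d B ρ γ lam M₀ ε₀ l := by
    refine ⟨hρ, hγ, hγ2, hB, hlam, hM, hε, hε1.trans (min_le_left _ _),
      hε1.trans (min_le_right _ _), ?_, hl⟩
    rw [le_div_iff₀ (by positivity)] at hεM
    linarith
  obtain ⟨c, hc, hlow⟩ := NNLower.exists_lower_bound hd P hg hmono
  refine ⟨fun n ν _ hν hn => NNLower.existsUnique_solvesRate hg hρ hν hn,
    ⟨c, hc, fun n ν q _ hν hq => ?_⟩,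
    fun ε hε => NNLower.exists_polynomial_lower_bound hg hρ hε hc hlow⟩
  rw [mul_assoc, NNLower.rate_eq_of_solvesRate hg hρ hν hq, ← mul_assoc]
  exact hlow n ν q hν hq.1 hq.2.ge
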